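/- For $\sigma\ge 0$, $s\in\mathbb R$ let $\|f\|_{G^{\sigma,s}}=\|e^{\sigma\|D\|}\langle D\rangle^s f\|_{L^2(\mathbb R^d)}$, where $D=-i\nabla$ has Fourier symbol $\xi$, $\|\xi\|=\sum_{i=1}^d|\xi_i|$ and $\langle\xi\rangle=\sqrt{1+|\xi|^2}$. For $h:\mathbb R^d\to\mathbb R$ let $$\|f\|_{X_h^{\sigma,s,b}}=\big\|e^{\sigma\|\xi\|}\langle\xi\rangle^s\langle\tau-h(\xi)\rangle^b\widehat f(\tau,\xi)\big\|_{L^2_{\tau,\xi}},\qquad \widehat f(\tau,\xi)=\int_{\mathbb R^{1+d}}e^{-i(t\tau+x\cdot\xi)}f(t,x)\,dt\,dx,$$ and $\|f\|_{X_h^{\sigma,s,b}(\delta)}=\inf\{\|g\|_{X_h^{\sigma,s,b}}: g=f \text{ on } (0,\delta)\times\mathbb R^d\}$. Write $X^{\sigma,s,b}$ for $h(\xi)=-|\xi|^2$ and $X_\pm^{\sigma,s,b}$ for $h(\xi)=\mp|\xi|$. Consider the Cauchy problem $$\begin{cases} i\partial_t u+\Delta u=-u(n_++n_-)/2, & u(0)=u_0,\\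 i\partial_t n_+-\langle D\rangle n_+=-\langle D\rangle^{-1}|u|^2, & n_+(0)=\phi_+,\\ i\partial_t n_-+\langle D\rangle n_-=\langle D\rangle^{-1}|u|^2, & n_-(0)=\phi_-\end{cases}\tag{1}$$ on $\mathbb R^d$, for complex-valued $u,n_+,n_-$. **Theorem.** Let $d\in\{1,2,3\}$, $q=\max\{4/(4-d),2\}$ and $\varepsilon>0$. There are $b_0>1/2$, $C>0$ and $K\ge 0$, depending only on $d$ and $\varepsilon$, such that the following holds for every $\sigma>0$ and all $(u_0,\phi_+,\phi_-)\in G^{\sigma,0}\times G^{\sigma,1}\times G^{\sigma,1}$. Put $$\delta=C\big(1+\|u_0\|_{G^{\sigma,0}}+\|\phi_+\|_{G^{\sigma,1}}+\|\phi_-\|_{G^{\sigma,1}}\big)^{-(q+\varepsilon)}.$$ Then (1) has a unique solution $(u,n_+,n_-)\in C([0,\delta];G^{\sigma,0}\times G^{\sigma,1}\times G^{\sigma,1})$ on $[0,\delta]$ (with the time derivatives taken in $L^2(\mathbb R^d)$), and for every $b$ with $1/2<b\le b_0$ it satisfies $$\|u\|_{X^{\sigma,0,b}(\delta)}\le K\|u_0\|_{G^{\sigma,0}},\qquad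 \|n_\pm\|_{X_\pm^{\sigma,1,b}(\delta)}\le K\big(\|\phi_\pm\|_{G^{\sigma,1}}+\|u_0\|_{G^{\sigma,0}}\big).$$ -/

import Mathlib

open MeasureTheory FourierTransform
open scoped ENNReal NNReal

namespace KGS

noncomputable section

/-- The space `ℝ^d` with the Euclidean norm. -/
abbrev Space (d : ℕ) : Type := EuclideanSpace ℝ (Fin d)

/-- Space-time `ℝ^{1+d}`; a point is `WithLp.toLp 2 (t, x)`. -/
abbrev SpaceTime (d : ℕ) : Type := WithLp 2 (ℝ × Space d)

/-- `L²(ℝ^d; ℂ)`. -/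
abbrev L2 (d : ℕ) : Type := Lp ℂ 2 (volume : Measure (Space d))

/-- `L²(ℝ^{1+d}; ℂ)`. -/
abbrev L2ST (d : ℕ) : Type := Lp ℂ 2 (volume : Measure (SpaceTime d))

/-- `⟨r⟩ = √(1 + r²)`, for a real number or for the length `r = |ξ|` of a vector. -/
def bracket (r : ℝ) : ℝ := Real.sqrt (1 + r ^ 2)

/-- `‖ξ‖ = ∑ |ξ_i|`. -/
def l1 {d : ℕ} (ξ : Space d) : ℝ := ∑ i, |ξ i|

/-- The symbol `e^{σ‖ξ‖} ⟨ξ⟩^s` of `e^{σ‖D‖} ⟨D⟩^s`. -/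
def gevreySymbol {d : ℕ} (σ s : ℝ) (ξ : Space d) : ℝ :=
  Real.exp (σ * l1 ξ) * bracket ‖ξ‖ ^ s

/-- `g = m(D) f` for `f, g ∈ L²(ℝ^d)`, where `D = -i∇` has the symbol `ξ`. Mathlib's (unitary)
Fourier transform has the phase `e^{-2πi x·ξ}`, so that `D` acts as multiplication by `2πξ`. -/
def IsFourierMultiplier {d : ℕ} (m : Space d → ℝ) (f g : L2 d) : Prop :=
  (𝓕 g : L2 d) =ᵐ[volume]
    fun ξ => ((m ((2 * Real.pi) • ξ) : ℝ) : ℂ) * (𝓕 f : L2 d) ξ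

/-- The Gevrey norm `‖f‖_{G^{σ,s}} = ‖e^{σ‖D‖} ⟨D⟩^s f‖_{L²}`, with value `∞` if `f ∉ G^{σ,s}`
(the last norm is computed on the Fourier side by Plancherel's theorem). For `σ, s ≥ 0`, the space
`G^{σ,s}` is contained in `L²`. -/
def gevreyNorm {d : ℕ} (σ s : ℝ) (f : L2 d) : ℝ≥0∞ :=
  eLpNorm (fun ξ => ((gevreySymbol σ s ((2 * Real.pi) • ξ) : ℝ) : ℂ) * (𝓕 f : L2 d) ξ) 2 volume

/-- `f ∈ G^{σ,s}(ℝ^d)`. -/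
def MemGevrey {d : ℕ} (σ s : ℝ) (f : L2 d) : Prop := gevreyNorm σ s f < ∞

/-- `f ∈ C([0,δ]; G^{σ,s})`. -/
def GevreyContinuous {d : ℕ} (σ s δ : ℝ) (f : ℝ → L2 d) : Prop :=
  ∀ t ∈ Set.Icc 0 δ, MemGevrey σ s (f t) ∧
    Filter.Tendsto (fun t' => gevreyNorm σ s (f t' - f t))
      (nhdsWithin t (Set.Icc 0 δ)) (nhds 0)

/-- The space-time Fourier transform `∫ e^{-i(tτ + x·ξ)} f(t,x) dt dx` of `f ∈ L²(ℝ^{1+d})`, at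
`ζ = (τ, ξ)`. -/
def stFourier {d : ℕ} (f : L2ST d) (ζ : SpaceTime d) : ℂ :=
  (𝓕 f : L2ST d) ((2 * Real.pi)⁻¹ • ζ)

/-- The Gevrey-Bourgain norm
`‖f‖_{X_h^{σ,s,b}} = ‖e^{σ‖ξ‖} ⟨ξ⟩^s ⟨τ - h(ξ)⟩^b f̂(τ,ξ)‖_{L²_{τ,ξ}}`, with value `∞` if `f` does
not belong to `X_h^{σ,s,b}`. For `σ, s, b ≥ 0`, the space `X_h^{σ,s,b}` is contained in `L²`. -/
def bourgainNorm {d : ℕ} (h : Space d → ℝ) (σ s b : ℝ) (f : L2ST d) : ℝ≥0∞ :=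
  eLpNorm (fun ζ : SpaceTime d =>
    ((gevreySymbol σ s ζ.snd * bracket (ζ.fst - h ζ.snd) ^ b : ℝ) : ℂ) * stFourier f ζ) 2 volume

/-- `g = f` on `(0,δ) × ℝ^d`. -/
def AgreesOnSlab {d : ℕ} (δ : ℝ) (f : ℝ → L2 d) (g : L2ST d) : Prop :=
  ∀ᵐ t : ℝ, t ∈ Set.Ioo 0 δ → ∀ᵐ x : Space d, g (WithLp.toLp 2 (t, x)) = f t x

/-- The norm `‖f‖_{X_h^{σ,s,b}(δ)}` of the restriction space to the slab `(0,δ) × ℝ^d`: the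
infimum of `‖g‖_{X_h^{σ,s,b}}` over all extensions `g` (and `∞` if there are none). -/
def slabNorm {d : ℕ} (h : Space d → ℝ) (σ s b δ : ℝ) (f : ℝ → L2 d) : ℝ≥0∞ :=
  ⨅ (g : L2ST d) (_ : AgreesOnSlab δ f g), bourgainNorm h σ s b g

/-- `h(ξ) = -|ξ|²`, for `X^{σ,s,b}`. -/
def hSchr {d : ℕ} (ξ : Space d) : ℝ := -‖ξ‖ ^ 2

/-- `h(ξ) = -|ξ|`, for `X_+^{σ,s,b}`. -/
def hPlus {d : ℕ} (ξ : Space d) : ℝ := -‖ξ‖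

/-- `h(ξ) = |ξ|`, for `X_-^{σ,s,b}`. -/
def hMinus {d : ℕ} (ξ : Space d) : ℝ := ‖ξ‖

/-- The three equations at the time `t`, with the one-sided time derivative in `L²(ℝ^d)` at the
end points of `[0,δ]`:
* `i ∂_t u + Δ u = - u (n₊ + n₋) / 2`,
* `i ∂_t n₊ - ⟨D⟩ n₊ = - ⟨D⟩⁻¹ |u|²`,
* `i ∂_t n₋ + ⟨D⟩ n₋ = ⟨D⟩⁻¹ |u|²`.
Here `ut`, `npt`, `nmt` are the time derivatives, `Lu = Δ u`, `Dnp = ⟨D⟩ n₊`, `Dnm = ⟨D⟩ n₋`,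
`P = u (n₊ + n₋) / 2`, `Q = |u|²` and `R = ⟨D⟩⁻¹ |u|²`, all of them in `L²(ℝ^d)`. -/
def SatisfiesEquationsAt {d : ℕ} (δ : ℝ) (u np nm : ℝ → L2 d) (t : ℝ) : Prop :=
  ∃ ut npt nmt Lu Dnp Dnm P Q R : L2 d,
    HasDerivWithinAt u ut (Set.Icc 0 δ) t ∧
    HasDerivWithinAt np npt (Set.Icc 0 δ) t ∧
    HasDerivWithinAt nm nmt (Set.Icc 0 δ) t ∧
    IsFourierMultiplier (fun ξ => -‖ξ‖ ^ 2) (u t) Lu ∧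
    IsFourierMultiplier (fun ξ => bracket ‖ξ‖) (np t) Dnp ∧
    IsFourierMultiplier (fun ξ => bracket ‖ξ‖) (nm t) Dnm ∧
    (P =ᵐ[volume] fun x => u t x * ((np t x + nm t x) / 2)) ∧
    (Q =ᵐ[volume] fun x => ((‖u t x‖ ^ 2 : ℝ) : ℂ)) ∧
    IsFourierMultiplier (fun ξ => (bracket ‖ξ‖)⁻¹) Q R ∧
    Complex.I • ut + Lu = -P ∧
    Complex.I • npt - Dnp = -R ∧
    Complex.I • nmt + Dnm = R

/-- `(u, n₊, n₋) ∈ C([0,δ]; G^{σ,0} × G^{σ,1} × G^{σ,1})` solves the Cauchy problem on `[0,δ]` with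
the initial data `(u₀, φ₊, φ₋)`. -/
structure IsSolution {d : ℕ} (σ δ : ℝ) (u₀ φp φm : L2 d) (u np nm : ℝ → L2 d) : Prop where
  cont_u : GevreyContinuous σ 0 δ u
  cont_np : GevreyContinuous σ 1 δ np
  cont_nm : GevreyContinuous σ 1 δ nm
  init_u : u 0 = u₀
  init_np : np 0 = φp
  init_nm : nm 0 = φm
  eqs : ∀ t ∈ Set.Icc 0 δ, SatisfiesEquationsAt δ u np nm t

/-- `q = max {4/(4-d), 2}`. -/
def lifespanExponent (d : ℕ) : ℝ := max (4 / (4 - (d : ℝ))) 2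

end

end KGS

/-! The problem is solved in the interaction picture. Up to the factors 2π of the Fourier transform,
write the transform of u as e^{-σ‖ξ‖} e^{-it|ξ|²} X₁ and those of n₊, n₋ as e^{-σ‖ξ‖} ⟨ξ⟩⁻¹
e^{∓it⟨ξ⟩} X₂, X₃. The Gevrey norms become L² norms of the profile X, and (1) becomes X' = B(t)(X,
X). The form B(t) is not bounded on L² at a fixed time; what is bounded is its time integral for
constant arguments: ∫_I ‖B(t)(x, y)‖ dt ≤ c |I|^α ‖x‖ ‖y‖ with α = 1 - d/4 and |I| ≤ 1.

This estimate is Hölder's inequality L²_t L⁴_x · L²_t L⁴_x → L¹_t L²_x. For u it needs the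
Strichartz estimate in L²_t L⁴_x (`strichartz`), obtained by TT* from the L^{4/3} → L⁴ dispersive
decay |t|^{-d/4} (`dispersive`), which is locally integrable because d < 4. For n₊ and n₋ it needs
only the Sobolev embedding H¹ ⊂ L⁴ (`exists_normFour_brkInv_le`). The Gevrey weight is distributed
over a product without taking absolute values on the Fourier side, which would destroy the
oscillation: e^{σ‖ξ‖} is at most the sum over the 2^d sign vectors of e^{σ ε·ξ}, and each of these
is multiplicative under convolution (`enorm_mulL_cv_le`). All constants are therefore independent of
σ.

An estimate for constant arguments passes to curves x₀ + ∫₀ᵗ F with F in L¹, since by linearity they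
are superpositions of constant vectors (`lintegral_apply_curve_le`). Hence F = X' is found by
contraction in L¹(0, δ) as soon as δ^α ‖x₀‖ is small (`exists_quadratic_solution`). Since σ > 0,
multiplication by e^{-σ‖ξ‖} smooths, and the resulting mild solution satisfies the equations in L²
at every time (`hasDerivWithinAt_curve`, `IsProfile.satisfiesEquationsAt`). Uniqueness is separate:
σ > 0 bounds solutions pointwise, and Gronwall's inequality applies to the L² difference
(`IsSolution.unique`).

For the Bourgain norms, F also satisfies ∫_I ‖F‖ ≤ c ‖x₀‖ |I|^α ‖u₀‖ on every window I. The curve is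
constant outside [0, δ], so a time cutoff of it yields an extension. The weight ⟨τ - h⟩^b is
controlled by a dyadic sum of mean square increments (`lintegral_bracket_fourier_le`), and the
window bound makes an increment by θ of size θ^{1/2+κ}, which leaves room for b > 1/2. The wave
symbols ±⟨ξ⟩ and ±|ξ| differ by at most 1, which changes the weight by a bounded factor. Finally, c
‖x₀‖ δ^{α-κ} must be bounded independently of the data; this holds for small κ > 0 because (q + ε) α
> 1. -/

namespace KGS

noncomputable section

set_option linter.unusedSectionVars false

/-! ### The L² Fourier transform and the Fourier integral -/

section FourierL2

variable {V F : Type*} [NormedAddCommGroup V] [InnerProductSpace ℝ V] [FiniteDimensional ℝ V]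
  [MeasurableSpace V] [BorelSpace V]
  [NormedAddCommGroup F] [InnerProductSpace ℂ F] [CompleteSpace F]

/-- The L² transform is compatible with that of tempered distributions. Testing against Schwartz
functions is the way in which L² transforms are identified below. -/
theorem integral_schwartz_smul_fourier (f : Lp F 2 (volume : Measure V)) (φ : SchwartzMap V ℂ) :
    ∫ x, φ x • (𝓕 f : Lp F 2 (volume : Measure V)) x = ∫ x, (𝓕 φ) x • f x := by
  have h := Lp.fourier_toTemperedDistribution_eq f
  have h2 := DFunLike.congr_fun h φ
  rw [TemperedDistribution.fourier_apply, Lp.toTemperedDistribution_apply,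
    Lp.toTemperedDistribution_apply] at h2
  exact h2.symm

theorem integral_schwartz_smul_fourierInv (f : Lp F 2 (volume : Measure V)) (φ : SchwartzMap V ℂ) :
    ∫ x, φ x • (𝓕⁻ f : Lp F 2 (volume : Measure V)) x = ∫ x, (𝓕⁻ φ) x • f x := by
  have h := integral_schwartz_smul_fourier (𝓕⁻ f : Lp F 2 (volume : Measure V)) (𝓕⁻ φ)
  rw [fourier_fourierInv_eq, fourier_fourierInv_eq] at h
  exact h.symm

theorem integral_fourier_smul_schwartz {f : V → F} (hf : Integrable f) (φ : SchwartzMap V ℂ) :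
    ∫ x, φ x • 𝓕 f x = ∫ x, (𝓕 φ) x • f x := by
  have h := VectorFourier.integral_fourierIntegral_smul_eq_flip (L := innerₗ V) (μ := volume)
    (ν := volume) (f := φ) (g := f) Real.continuous_fourierChar continuous_inner
    φ.integrable hf
  rw [flip_innerₗ] at h
  rw [SchwartzMap.fourier_coe]
  exact h.symm

theorem ae_eq_of_integral_schwartz_smul_eq {f g : V → F} (hf : LocallyIntegrable f)
    (hg : LocallyIntegrable g)
    (h : ∀ φ : SchwartzMap V ℂ, ∫ x, φ x • f x = ∫ x, φ x • g x) : f =ᵐ[volume] g := by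
  refine ae_eq_of_integral_contDiff_smul_eq hf hg fun φ hφ hc => ?_
  have hφ' : ContDiff ℝ (⊤ : ℕ∞) (fun x => (φ x : ℂ)) := Complex.ofRealCLM.contDiff.comp hφ
  have hc' : HasCompactSupport (fun x => (φ x : ℂ)) := hc.comp_left (g := Complex.ofReal) rfl
  have := h (hc'.toSchwartzMap hφ')
  simpa using this

theorem lp_fourier_ae_eq (f : Lp F 2 (volume : Measure V)) (hf : Integrable f) :
    (𝓕 f : Lp F 2 (volume : Measure V)) =ᵐ[volume] 𝓕 (f : V → F) := by
  refine ae_eq_of_integral_schwartz_smul_eq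
    ((Lp.memLp _).locallyIntegrable (by norm_num)) ?_ fun φ => ?_
  · refine Continuous.locallyIntegrable ?_
    exact VectorFourier.fourierIntegral_continuous Real.continuous_fourierChar
      continuous_inner hf
  · rw [integral_schwartz_smul_fourier, integral_fourier_smul_schwartz hf]

theorem lp_fourierInv_ae_eq (f : Lp F 2 (volume : Measure V)) (hf : Integrable f) :
    (𝓕⁻ f : Lp F 2 (volume : Measure V)) =ᵐ[volume] 𝓕⁻ (f : V → F) := by
  have hc : Continuous (𝓕 (f : V → F)) :=
    VectorFourier.fourierIntegral_continuous Real.continuous_fourierChar continuous_inner hf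
  have he : 𝓕⁻ (f : V → F) = fun x => 𝓕 (f : V → F) (-x) := by
    ext x; rw [Real.fourierInv_eq_fourier_neg]
  refine ae_eq_of_integral_schwartz_smul_eq
    ((Lp.memLp _).locallyIntegrable (by norm_num)) ?_ fun φ => ?_
  · rw [he]; exact (hc.comp continuous_neg).locallyIntegrable
  · rw [integral_schwartz_smul_fourierInv]
    -- The function `𝓕⁻ (𝓕⁻ φ)` is the reflection of `φ`. Testing with it turns the identity for `𝓕`
    -- into one for `𝓕⁻`, up to a change of variables.
    have h1 := integral_fourier_smul_schwartz hf (𝓕⁻ (𝓕⁻ φ))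
    rw [fourier_fourierInv_eq] at h1
    rw [← h1, he, ← integral_neg_eq_self]
    refine integral_congr_ae (Filter.Eventually.of_forall fun x => ?_)
    have h2 : (𝓕⁻ (𝓕⁻ φ)) (-x) = φ x := by
      have h3 : (𝓕⁻ (𝓕⁻ φ)) (-x) = (𝓕 (𝓕⁻ φ)) x := by
        rw [SchwartzMap.fourierInv_coe (𝓕⁻ φ), SchwartzMap.fourier_coe,
          Real.fourierInv_eq_fourier_neg, neg_neg]
      rw [h3, fourier_fourierInv_eq]
    simp only [h2]

theorem fourier_toLp_ae_eq {f : V → F} (hf : Integrable f) (h2 : MemLp f 2) :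
    (𝓕 (h2.toLp f) : Lp F 2 (volume : Measure V)) =ᵐ[volume] 𝓕 f := by
  refine (lp_fourier_ae_eq _ (hf.congr h2.coeFn_toLp.symm)).trans ?_
  refine Filter.Eventually.of_forall fun x => ?_
  exact Real.fourier_congr_ae h2.coeFn_toLp x

theorem fourierInv_toLp_ae_eq {f : V → F} (hf : Integrable f) (h2 : MemLp f 2) :
    (𝓕⁻ (h2.toLp f) : Lp F 2 (volume : Measure V)) =ᵐ[volume] 𝓕⁻ f := by
  refine (lp_fourierInv_ae_eq _ (hf.congr h2.coeFn_toLp.symm)).trans ?_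
  refine Filter.Eventually.of_forall fun x => ?_
  exact Real.fourierInv_congr_ae h2.coeFn_toLp x

theorem memLp_fourier {f : V → F} (hf : Integrable f) (h2 : MemLp f 2) : MemLp (𝓕 f) 2 :=
  (memLp_congr_ae (fourier_toLp_ae_eq hf h2)).1 (Lp.memLp _)

/-- An integrable function whose Fourier transform is square integrable is square integrable. -/
theorem ae_eq_fourierInv_of_memLp {f : V → F} (hf : Integrable f) (h2 : MemLp (𝓕 f) 2) :
    (𝓕⁻ (h2.toLp (𝓕 f)) : Lp F 2 (volume : Measure V)) =ᵐ[volume] f := by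
  refine ae_eq_of_integral_schwartz_smul_eq
    ((Lp.memLp _).locallyIntegrable (by norm_num)) hf.locallyIntegrable fun φ => ?_
  rw [integral_schwartz_smul_fourierInv]
  have h1 := integral_fourier_smul_schwartz hf (𝓕⁻ φ)
  rw [fourier_fourierInv_eq] at h1
  rw [← h1]
  refine integral_congr_ae ?_
  filter_upwards [h2.coeFn_toLp] with x hx
  rw [hx]

theorem eLpNorm_eq_eLpNorm_fourier {f : V → F} (hf : Integrable f) (h2 : MemLp (𝓕 f) 2) :
    eLpNorm f 2 volume = eLpNorm (𝓕 f) 2 volume := by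
  rw [← eLpNorm_congr_ae (ae_eq_fourierInv_of_memLp hf h2), ← Lp.enorm_def]
  have : ‖(𝓕⁻ (h2.toLp (𝓕 f)) : Lp F 2 (volume : Measure V))‖ₑ = ‖h2.toLp (𝓕 f)‖ₑ :=
    (Lp.fourierTransformₗᵢ V F).symm.enorm_map _
  rw [this, Lp.enorm_toLp]

end FourierL2

/-! ### Young's inequality -/

section Young

variable {V : Type*} [NormedAddCommGroup V] [NormedSpace ℝ V] [FiniteDimensional ℝ V]
  [MeasurableSpace V] [BorelSpace V] {μ : Measure V} [μ.IsAddHaarMeasure]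

/-- Young's inequality `L^{4/3} * L^{4/3} → L²`, for the correlation of nonnegative functions. -/
theorem lintegral_correlation_sq_le {f g : V → ℝ≥0∞} (hf : Measurable f) (hg : Measurable g) :
    ∫⁻ x, (∫⁻ y, f y * g (y - x) ∂μ) ^ (2 : ℝ) ∂μ ≤
      (∫⁻ y, f y ^ (4 / 3 : ℝ) ∂μ) ^ (3 / 2 : ℝ) * (∫⁻ y, g y ^ (4 / 3 : ℝ) ∂μ) ^ (3 / 2 : ℝ) := by
  set A := ∫⁻ y, f y ^ (4 / 3 : ℝ) ∂μ with hA
  set B := ∫⁻ y, g y ^ (4 / 3 : ℝ) ∂μ with hB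
  have hpt : ∀ x, (∫⁻ y, f y * g (y - x) ∂μ) ^ (2 : ℝ) ≤
      (∫⁻ y, f y ^ (4 / 3 : ℝ) * g (y - x) ^ (4 / 3 : ℝ) ∂μ) *
        (A ^ (1 / 2 : ℝ) * B ^ (1 / 2 : ℝ)) := by
    intro x
    have hgx : Measurable fun y => g (y - x) := hg.comp (measurable_id.sub_const x)
    have hBx : ∫⁻ y, g (y - x) ^ (4 / 3 : ℝ) ∂μ = B :=
      lintegral_sub_right_eq_self (fun y => g y ^ (4 / 3 : ℝ)) x
    -- Hölder with the exponents 1/2, 1/4, 1/4 for f g = (f^{4/3} g^{4/3})^{1/2} (f^{4/3})^{1/4}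
    -- (g^{4/3})^{1/4}. The last two integrals do not depend on x; the first, after squaring, is
    -- integrated by Tonelli.
    have h3 := ENNReal.lintegral_prod_norm_pow_le (μ := μ) (Finset.univ : Finset (Fin 3))
      (f := ![fun y => f y ^ (4 / 3 : ℝ) * g (y - x) ^ (4 / 3 : ℝ), fun y => f y ^ (4 / 3 : ℝ),
        fun y => g (y - x) ^ (4 / 3 : ℝ)])
      (by
        intro i _
        fin_cases i
        · exact ((hf.pow_const _).mul (hgx.pow_const _)).aemeasurable
        · exact (hf.pow_const _).aemeasurable
        · exact (hgx.pow_const _).aemeasurable)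
      (p := ![1 / 2, 1 / 4, 1 / 4]) (by simp [Fin.sum_univ_three]; norm_num)
      (by intro i _; fin_cases i <;> simp)
    simp only [Fin.prod_univ_three, Matrix.cons_val_zero, Matrix.cons_val_one, Matrix.cons_val] at h3
    have h4 : ∀ y, (f y ^ (4 / 3 : ℝ) * g (y - x) ^ (4 / 3 : ℝ)) ^ (1 / 2 : ℝ) *
        (f y ^ (4 / 3 : ℝ)) ^ (1 / 4 : ℝ) * (g (y - x) ^ (4 / 3 : ℝ)) ^ (1 / 4 : ℝ) =
        f y * g (y - x) := by
      intro y
      rw [ENNReal.mul_rpow_of_nonneg _ _ (by norm_num)]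
      simp only [← ENNReal.rpow_mul]
      have e : ∀ z : ℝ≥0∞, z ^ (4 / 3 * (1 / 2) : ℝ) * z ^ (4 / 3 * (1 / 4) : ℝ) = z := by
        intro z
        rw [← ENNReal.rpow_add_of_nonneg _ _ (by norm_num) (by norm_num)]
        norm_num
      calc _ = (f y ^ (4 / 3 * (1 / 2) : ℝ) * f y ^ (4 / 3 * (1 / 4) : ℝ)) *
          (g (y - x) ^ (4 / 3 * (1 / 2) : ℝ) * g (y - x) ^ (4 / 3 * (1 / 4) : ℝ)) := by ring
        _ = _ := by rw [e, e]
    simp only [h4, hBx, ← hA] at h3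
    calc _ ≤ _ := ENNReal.rpow_le_rpow h3 (by norm_num)
      _ = _ := by
        rw [ENNReal.mul_rpow_of_nonneg _ _ (by norm_num),
          ENNReal.mul_rpow_of_nonneg _ _ (by norm_num)]
        simp only [← ENNReal.rpow_mul]
        norm_num [mul_assoc]
  calc _ ≤ ∫⁻ x, (∫⁻ y, f y ^ (4 / 3 : ℝ) * g (y - x) ^ (4 / 3 : ℝ) ∂μ) *
        (A ^ (1 / 2 : ℝ) * B ^ (1 / 2 : ℝ)) ∂μ := lintegral_mono hpt
    _ = (∫⁻ x, ∫⁻ y, f y ^ (4 / 3 : ℝ) * g (y - x) ^ (4 / 3 : ℝ) ∂μ ∂μ) *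
        (A ^ (1 / 2 : ℝ) * B ^ (1 / 2 : ℝ)) := by
      rw [lintegral_mul_const]
      exact Measurable.lintegral_prod_right' (f := fun p : V × V =>
        f p.2 ^ (4 / 3 : ℝ) * g (p.2 - p.1) ^ (4 / 3 : ℝ)) (by fun_prop)
    _ = (A * B) * (A ^ (1 / 2 : ℝ) * B ^ (1 / 2 : ℝ)) := by
      congr 1
      rw [lintegral_lintegral_swap (by fun_prop)]
      have : ∀ y, ∫⁻ x, f y ^ (4 / 3 : ℝ) * g (y - x) ^ (4 / 3 : ℝ) ∂μ =
          f y ^ (4 / 3 : ℝ) * B := by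
        intro y
        rw [lintegral_const_mul _ (by fun_prop)]
        rw [lintegral_sub_left_eq_self (fun z => g z ^ (4 / 3 : ℝ)) y]
      simp only [this]
      rw [lintegral_mul_const _ (by fun_prop)]
    _ = _ := by
      have e : ∀ z : ℝ≥0∞, z * z ^ (1 / 2 : ℝ) = z ^ (3 / 2 : ℝ) := by
        intro z
        nth_rw 1 [← ENNReal.rpow_one z]
        rw [← ENNReal.rpow_add_of_nonneg _ _ (by norm_num) (by norm_num)]
        norm_num
      rw [← e, ← e]; ring

end Young

/-! ### Fourier pairs, Parseval, modulation and translation -/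

section FourierPairs

variable {V : Type*} [NormedAddCommGroup V] [InnerProductSpace ℝ V] [FiniteDimensional ℝ V]
  [MeasurableSpace V] [BorelSpace V]

/-- `g` is the `L²` Fourier transform of `f`. -/
def IsFT (f g : V → ℂ) : Prop :=
  ∃ F : Lp ℂ 2 (volume : Measure V), F =ᵐ[volume] f ∧ (𝓕 F : Lp ℂ 2 (volume : Measure V)) =ᵐ[volume] g

theorem IsFT.memLp_left {f g : V → ℂ} (h : IsFT f g) : MemLp f 2 := by
  obtain ⟨F, h1, -⟩ := h
  exact (memLp_congr_ae h1).1 (Lp.memLp _)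

theorem IsFT.memLp_right {f g : V → ℂ} (h : IsFT f g) : MemLp g 2 := by
  obtain ⟨F, -, h1⟩ := h
  exact (memLp_congr_ae h1).1 (Lp.memLp _)

theorem isFT_coe (F : Lp ℂ 2 (volume : Measure V)) :
    IsFT F (𝓕 F : Lp ℂ 2 (volume : Measure V)) := ⟨F, ae_eq_rfl, ae_eq_rfl⟩

theorem isFT_inv_coe (F : Lp ℂ 2 (volume : Measure V)) :
    IsFT (𝓕⁻ F : Lp ℂ 2 (volume : Measure V)) F :=
  ⟨𝓕⁻ F, ae_eq_rfl, by rw [fourier_fourierInv_eq]⟩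

theorem isFT_fourierInv {g : V → ℂ} (hg : Integrable g) (h2 : MemLp g 2) : IsFT (𝓕⁻ g) g :=
  ⟨𝓕⁻ (h2.toLp g), fourierInv_toLp_ae_eq hg h2, by
    rw [fourier_fourierInv_eq]; exact h2.coeFn_toLp⟩

theorem integral_conj_mul_eq_inner {F G : Lp ℂ 2 (volume : Measure V)} {f g : V → ℂ}
    (hf : F =ᵐ[volume] f) (hg : G =ᵐ[volume] g) :
    ∫ x, (starRingEnd ℂ) (f x) * g x = inner ℂ F G := by
  rw [L2.inner_def]
  refine integral_congr_ae ?_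
  filter_upwards [hf, hg] with x h1 h2
  rw [h1, h2, RCLike.inner_apply, mul_comm]

theorem IsFT.parseval {f g f' g' : V → ℂ} (h : IsFT f g) (h' : IsFT f' g') :
    ∫ x, (starRingEnd ℂ) (f x) * f' x = ∫ ξ, (starRingEnd ℂ) (g ξ) * g' ξ := by
  obtain ⟨F, h1, h2⟩ := h
  obtain ⟨F', h1', h2'⟩ := h'
  rw [integral_conj_mul_eq_inner h1 h1', integral_conj_mul_eq_inner h2 h2', Lp.inner_fourier_eq]

/-- The character `x ↦ e^{2πi x·a}`. -/
def chr (a x : V) : ℂ := ((Real.fourierChar (inner ℝ x a) : Circle) : ℂ)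

theorem norm_chr (a x : V) : ‖chr a x‖ = 1 := Circle.norm_coe _

theorem continuous_chr (a : V) : Continuous (chr a) :=
  continuous_induced_dom.comp (Real.continuous_fourierChar.comp (by fun_prop))

theorem chr_eq (a x : V) : chr a x = Complex.exp ((2 * Real.pi * inner ℝ x a : ℝ) * Complex.I) := by
  rw [chr, Real.fourierChar_apply]

theorem schwartz_fourier_sub (φ : SchwartzMap V ℂ) (a x : V) :
    (𝓕 (φ.compSubConstCLM ℂ a)) x = chr (-a) x * (𝓕 φ) x := by
  have h := VectorFourier.fourierIntegral_comp_add_right Real.fourierChar (volume : Measure V)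
    (innerₗ V) φ (-a)
  have h2 := congrFun h x
  simp only [Circle.smul_def, smul_eq_mul, innerₗ_apply_apply, inner_neg_left] at h2
  have h3 : (φ.compSubConstCLM ℂ a : V → ℂ) = φ ∘ fun v => v + -a := by
    ext v; simp [sub_eq_add_neg]
  rw [SchwartzMap.fourier_coe, SchwartzMap.fourier_coe, chr, inner_neg_right, real_inner_comm, h3]
  exact h2

theorem schwartz_fourierInv_sub (φ : SchwartzMap V ℂ) (a x : V) :
    (𝓕⁻ (φ.compSubConstCLM ℂ a)) x = chr a x * (𝓕⁻ φ) x := by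
  have h := schwartz_fourier_sub φ a (-x)
  rw [SchwartzMap.fourier_coe, SchwartzMap.fourier_coe] at h
  rw [SchwartzMap.fourierInv_coe, SchwartzMap.fourierInv_coe,
    Real.fourierInv_eq_fourier_neg, Real.fourierInv_eq_fourier_neg, h]
  simp only [chr, inner_neg_neg]

theorem memLp_char_mul {f : V → ℂ} (h : MemLp f 2) (a : V) :
    MemLp (fun x => chr a x * f x) 2 := by
  refine MemLp.of_le h ?_ (Filter.Eventually.of_forall fun x => by simp [norm_chr])
  exact AEStronglyMeasurable.mul (continuous_chr a).aestronglyMeasurable h.1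

theorem memLp_comp_sub {f : V → ℂ} (h : MemLp f 2) (a : V) :
    MemLp (fun x => f (x - a)) 2 :=
  h.comp_measurePreserving (measurePreserving_sub_right volume a)

theorem IsFT.modulate {f g : V → ℂ} (h : IsFT f g) (a : V) :
    IsFT (fun x => chr a x * f x) (fun ξ => g (ξ - a)) := by
  have hm := memLp_char_mul h.memLp_left a
  refine ⟨hm.toLp _, hm.coeFn_toLp, ?_⟩
  have hg := memLp_comp_sub h.memLp_right a
  obtain ⟨F, h1, h2⟩ := h
  refine ae_eq_of_integral_schwartz_smul_eq
    ((Lp.memLp _).locallyIntegrable (by norm_num)) (hg.locallyIntegrable (by norm_num)) fun φ => ?_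
  rw [integral_schwartz_smul_fourier]
  have e1 : ∫ x, φ x • g (x - a) = ∫ x, φ.compSubConstCLM ℂ (-a) x • g x := by
    rw [← integral_sub_right_eq_self (fun x => φ.compSubConstCLM ℂ (-a) x • g x) a]
    simp
  have e2 : ∫ x, φ.compSubConstCLM ℂ (-a) x • g x =
      ∫ x, φ.compSubConstCLM ℂ (-a) x • (𝓕 F : Lp ℂ 2 (volume : Measure V)) x := by
    refine integral_congr_ae ?_
    filter_upwards [h2] with x hx
    rw [hx]
  rw [e1, e2, integral_schwartz_smul_fourier]
  refine integral_congr_ae ?_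
  filter_upwards [h1, hm.coeFn_toLp] with x hx hx2
  rw [hx, hx2, schwartz_fourier_sub]
  simp only [neg_neg, smul_eq_mul]
  ring

theorem IsFT.translate {f g : V → ℂ} (h : IsFT f g) (a : V) :
    IsFT (fun x => f (x + a)) (fun ξ => chr a ξ * g ξ) := by
  have hm := memLp_char_mul h.memLp_right a
  have hf := memLp_comp_sub h.memLp_left (-a)
  simp only [sub_neg_eq_add] at hf
  refine ⟨𝓕⁻ (hm.toLp _), ?_, by rw [fourier_fourierInv_eq]; exact hm.coeFn_toLp⟩
  obtain ⟨F, h1, h2⟩ := h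
  refine ae_eq_of_integral_schwartz_smul_eq
    ((Lp.memLp _).locallyIntegrable (by norm_num)) (hf.locallyIntegrable (by norm_num)) fun φ => ?_
  rw [integral_schwartz_smul_fourierInv]
  have e1 : ∫ x, φ x • f (x + a) = ∫ x, φ.compSubConstCLM ℂ a x • f x := by
    rw [← integral_add_right_eq_self (fun x => φ.compSubConstCLM ℂ a x • f x) a]
    simp
  have e2 : ∫ x, φ.compSubConstCLM ℂ a x • f x =
      ∫ x, φ.compSubConstCLM ℂ a x •
        (𝓕⁻ (𝓕 F : Lp ℂ 2 (volume : Measure V)) : Lp ℂ 2 (volume : Measure V)) x := by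
    refine integral_congr_ae ?_
    rw [fourierInv_fourier_eq]
    filter_upwards [h1] with x hx
    rw [hx]
  rw [e1, e2, integral_schwartz_smul_fourierInv]
  refine integral_congr_ae ?_
  filter_upwards [h2, hm.coeFn_toLp] with x hx hx2
  rw [hx, hx2, schwartz_fourierInv_sub]
  simp only [smul_eq_mul]
  ring

end FourierPairs

/-! ### Bounded multipliers and unitary phases on L² -/

section Multipliers

variable {V : Type*} [MeasurableSpace V] {μ : Measure V}

theorem memLp_mul_of_bounded {m : V → ℂ} (hm : Measurable m) {C : ℝ} (hC : ∀ x, ‖m x‖ ≤ C)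
    {f : V → ℂ} (hf : MemLp f 2 μ) : MemLp (fun x => m x * f x) 2 μ :=
  MemLp.of_le_mul (c := C) hf (hm.aestronglyMeasurable.mul hf.1)
    (Filter.Eventually.of_forall fun x => by
      rw [norm_mul]; exact mul_le_mul_of_nonneg_right (hC x) (norm_nonneg _))

open scoped Classical in
/-- Multiplication by a bounded measurable function on `L²` (zero if the function is not bounded
and measurable). -/
def mulL (m : V → ℂ) : Lp ℂ 2 μ →L[ℂ] Lp ℂ 2 μ :=
  if h : Measurable m ∧ ∃ C, ∀ x, ‖m x‖ ≤ C then
    LinearMap.mkContinuousOfExistsBound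
      { toFun := fun f => (memLp_mul_of_bounded h.1 h.2.choose_spec (Lp.memLp f)).toLp _
        map_add' := fun f g => by
          rw [← MemLp.toLp_add, MemLp.toLp_eq_toLp_iff]
          filter_upwards [Lp.coeFn_add f g] with x hx
          simp only [hx, Pi.add_apply, mul_add]
        map_smul' := fun c f => by
          rw [RingHom.id_apply, ← MemLp.toLp_const_smul, MemLp.toLp_eq_toLp_iff]
          filter_upwards [Lp.coeFn_smul c f] with x hx
          simp only [hx, Pi.smul_apply, smul_eq_mul]
          ring }
      ⟨h.2.choose, fun f => by
        refine Lp.norm_le_mul_norm_of_ae_le_mul ?_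
        filter_upwards [MemLp.coeFn_toLp
          (memLp_mul_of_bounded h.1 h.2.choose_spec (Lp.memLp f))] with x hx
        change ‖(MemLp.toLp (fun x => m x * f x)
          (memLp_mul_of_bounded h.1 h.2.choose_spec (Lp.memLp f)) : Lp ℂ 2 μ) x‖ ≤ _
        rw [hx, norm_mul]
        exact mul_le_mul_of_nonneg_right (h.2.choose_spec x) (norm_nonneg _)⟩
  else 0

theorem mulL_coe {m : V → ℂ} (hm : Measurable m) {C : ℝ} (hC : ∀ x, ‖m x‖ ≤ C) (f : Lp ℂ 2 μ) :
    mulL m f =ᵐ[μ] fun x => m x * f x := by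
  have h : Measurable m ∧ ∃ C, ∀ x, ‖m x‖ ≤ C := ⟨hm, C, hC⟩
  rw [mulL, dif_pos h]
  exact MemLp.coeFn_toLp (memLp_mul_of_bounded h.1 h.2.choose_spec (Lp.memLp f))

theorem norm_mulL_le {m : V → ℂ} (hm : Measurable m) {C : ℝ} (hC : ∀ x, ‖m x‖ ≤ C)
    (f : Lp ℂ 2 μ) : ‖mulL m f‖ ≤ C * ‖f‖ := by
  refine Lp.norm_le_mul_norm_of_ae_le_mul ?_
  filter_upwards [mulL_coe hm hC f] with x hx
  rw [hx, norm_mul]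
  exact mul_le_mul_of_nonneg_right (hC x) (norm_nonneg _)

theorem norm_sq_eq_integral (f : Lp ℂ 2 μ) : ‖f‖ ^ 2 = ∫ x, ‖f x‖ ^ 2 ∂μ := by
  have h2 := inner_self_eq_norm_sq_to_K (𝕜 := ℂ) f
  rw [L2.inner_def] at h2
  have h3 : ∀ x, inner ℂ (f x) (f x) = ((‖f x‖ ^ 2 : ℝ) : ℂ) := fun x => by
    rw [inner_self_eq_norm_sq_to_K]; norm_cast
  simp only [h3] at h2
  rw [integral_complex_ofReal] at h2
  refine Complex.ofReal_injective ?_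
  rw [h2]
  push_cast
  rfl

/-- The phase `e^{i t m(ξ)}`. -/
def ph (m : V → ℝ) (t : ℝ) (x : V) : ℂ := Complex.exp ((t * m x : ℝ) * Complex.I)

theorem norm_ph (m : V → ℝ) (t : ℝ) (x : V) : ‖ph m t x‖ = 1 := Complex.norm_exp_ofReal_mul_I _

theorem norm_ph_le (m : V → ℝ) (t : ℝ) (x : V) : ‖ph m t x‖ ≤ 1 := (norm_ph m t x).le

theorem measurable_ph {m : V → ℝ} (hm : Measurable m) (t : ℝ) : Measurable (ph m t) := by
  unfold ph; fun_prop

theorem ph_add (m : V → ℝ) (s t : ℝ) (x : V) : ph m (s + t) x = ph m s x * ph m t x := by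
  rw [ph, ph, ph, ← Complex.exp_add]; congr 1; push_cast; ring

theorem ph_zero (m : V → ℝ) (x : V) : ph m 0 x = 1 := by simp [ph]

theorem conj_ph (m : V → ℝ) (t : ℝ) (x : V) : (starRingEnd ℂ) (ph m t x) = ph m (-t) x := by
  rw [ph, ph, ← Complex.exp_conj]; congr 1; simp

theorem mulL_ph_coe {m : V → ℝ} (hm : Measurable m) (t : ℝ) (f : Lp ℂ 2 μ) :
    mulL (ph m t) f =ᵐ[μ] fun x => ph m t x * f x :=
  mulL_coe (measurable_ph hm t) (norm_ph_le m t) f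

theorem norm_mulL_ph {m : V → ℝ} (hm : Measurable m) (t : ℝ) (f : Lp ℂ 2 μ) :
    ‖mulL (ph m t) f‖ = ‖f‖ := by
  rw [Lp.norm_def, Lp.norm_def]
  congr 1
  refine eLpNorm_congr_norm_ae ?_
  filter_upwards [mulL_ph_coe hm t f] with x hx
  rw [hx, norm_mul, norm_ph, one_mul]

theorem mulL_ph_add {m : V → ℝ} (hm : Measurable m) (s t : ℝ) (f : Lp ℂ 2 μ) :
    mulL (ph m (s + t)) f = mulL (ph m s) (mulL (ph m t) f) := by
  refine Lp.ext ?_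
  filter_upwards [mulL_ph_coe hm (s + t) f, mulL_ph_coe hm s (mulL (ph m t) f),
    mulL_ph_coe hm t f] with x h1 h2 h3
  rw [h1, h2, h3, ph_add, mul_assoc]

theorem mulL_ph_zero {m : V → ℝ} (hm : Measurable m) (f : Lp ℂ 2 μ) :
    mulL (ph m 0) f = f := by
  refine Lp.ext ?_
  filter_upwards [mulL_ph_coe hm 0 f] with x h1
  rw [h1, ph_zero, one_mul]

theorem continuous_mulL_ph_const {m : V → ℝ} (hm : Measurable m) (f : Lp ℂ 2 μ) :
    Continuous fun t : ℝ => mulL (ph m t) f := by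
  rw [continuous_iff_continuousAt]
  intro t₀
  have key : ∀ t, ‖mulL (ph m t) f - mulL (ph m t₀) f‖ ^ 2 =
      ∫ x, ‖(ph m t x - ph m t₀ x) * f x‖ ^ 2 ∂μ := by
    intro t
    rw [norm_sq_eq_integral]
    refine integral_congr_ae ?_
    filter_upwards [Lp.coeFn_sub (mulL (ph m t) f) (mulL (ph m t₀) f), mulL_ph_coe hm t f,
      mulL_ph_coe hm t₀ f] with x h1 h2 h3
    rw [h1, Pi.sub_apply, h2, h3, sub_mul]
  have hc : Continuous fun t => ∫ x, ‖(ph m t x - ph m t₀ x) * f x‖ ^ 2 ∂μ := by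
    refine continuous_of_dominated (bound := fun x => 4 * ‖f x‖ ^ 2) ?_ ?_ ?_ ?_
    · intro t
      have h1 : Measurable (fun x => ph m t x - ph m t₀ x) :=
        (measurable_ph hm t).sub (measurable_ph hm t₀)
      exact ((h1.aestronglyMeasurable.mul (Lp.aestronglyMeasurable f)).norm.pow 2)
    · intro t
      refine Filter.Eventually.of_forall fun x => ?_
      have h1 : ‖ph m t x - ph m t₀ x‖ ≤ 2 := by
        refine (norm_sub_le _ _).trans ?_
        rw [norm_ph, norm_ph]; norm_num
      have h2 : ‖ph m t x - ph m t₀ x‖ ^ 2 ≤ 4 := by nlinarith [norm_nonneg (ph m t x - ph m t₀ x)]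
      rw [Real.norm_of_nonneg (by positivity), norm_mul, mul_pow]
      exact mul_le_mul_of_nonneg_right h2 (by positivity)
    · exact ((memLp_two_iff_integrable_sq_norm (Lp.aestronglyMeasurable f)).1 (Lp.memLp f)).const_mul 4
    · refine Filter.Eventually.of_forall fun x => ?_
      unfold ph
      fun_prop
  have h0 : Filter.Tendsto (fun t => ‖mulL (ph m t) f - mulL (ph m t₀) f‖ ^ 2) (nhds t₀)
      (nhds 0) := by
    simp only [key]
    have := hc.tendsto t₀
    simpa using this
  rw [ContinuousAt, tendsto_iff_norm_sub_tendsto_zero]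
  have := h0.sqrt
  simpa [Real.sqrt_sq (norm_nonneg _)] using this

/-- For an unbounded symbol the phases need not be continuous in operator norm. Joint continuity
comes from strong continuity, because each phase is an isometry. -/
theorem continuous_mulL_ph {m : V → ℝ} (hm : Measurable m) :
    Continuous fun p : ℝ × Lp ℂ 2 μ => mulL (ph m p.1) p.2 := by
  rw [continuous_iff_continuousAt]
  rintro ⟨t₀, f₀⟩
  rw [ContinuousAt, tendsto_iff_norm_sub_tendsto_zero]
  have h1 : ∀ p : ℝ × Lp ℂ 2 μ, ‖mulL (ph m p.1) p.2 - mulL (ph m t₀) f₀‖ ≤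
      ‖p.2 - f₀‖ + ‖mulL (ph m p.1) f₀ - mulL (ph m t₀) f₀‖ := by
    intro p
    calc _ = ‖mulL (ph m p.1) (p.2 - f₀) + (mulL (ph m p.1) f₀ - mulL (ph m t₀) f₀)‖ := by
          rw [map_sub]; congr 1; abel
      _ ≤ _ := by
          refine (norm_add_le _ _).trans ?_
          rw [norm_mulL_ph hm]
  have h2 : Filter.Tendsto (fun p : ℝ × Lp ℂ 2 μ => ‖p.2 - f₀‖ +
      ‖mulL (ph m p.1) f₀ - mulL (ph m t₀) f₀‖) (nhds (t₀, f₀)) (nhds 0) := by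
    have hc : Continuous (fun p : ℝ × Lp ℂ 2 μ => ‖p.2 - f₀‖ +
      ‖mulL (ph m p.1) f₀ - mulL (ph m t₀) f₀‖) :=
      (continuous_snd.sub continuous_const).norm.add
        (((continuous_mulL_ph_const hm f₀).comp continuous_fst).sub continuous_const).norm
    simpa using hc.tendsto (t₀, f₀)
  exact squeeze_zero (fun _ => norm_nonneg _) h1 h2

attribute [irreducible] mulL

end Multipliers

/-! ### Hausdorff–Young and the dispersive estimate -/

section Dispersive

variable {V : Type*} [NormedAddCommGroup V] [InnerProductSpace ℝ V] [FiniteDimensional ℝ V]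
  [MeasurableSpace V] [BorelSpace V]

theorem lintegral_correlation_sq_le_ae {f g : V → ℝ≥0∞} (hf : AEMeasurable f)
    (hg : AEMeasurable g) :
    ∫⁻ x, (∫⁻ y, f y * g (y - x)) ^ (2 : ℝ) ≤
      (∫⁻ y, f y ^ (4 / 3 : ℝ)) ^ (3 / 2 : ℝ) * (∫⁻ y, g y ^ (4 / 3 : ℝ)) ^ (3 / 2 : ℝ) := by
  have h1 : ∀ x, ∫⁻ y, f y * g (y - x) = ∫⁻ y, hf.mk f y * hg.mk g (y - x) := by
    intro x
    refine lintegral_congr_ae ?_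
    have h2 := (measurePreserving_sub_right (volume : Measure V) x).quasiMeasurePreserving.ae_eq_comp
      hg.ae_eq_mk
    filter_upwards [hf.ae_eq_mk, h2] with y h3 h4
    simp only [Function.comp] at h4
    rw [h3, h4]
  have h2 : ∫⁻ y, f y ^ (4 / 3 : ℝ) = ∫⁻ y, hf.mk f y ^ (4 / 3 : ℝ) :=
    lintegral_congr_ae (by filter_upwards [hf.ae_eq_mk] with y h; rw [← h])
  have h3 : ∫⁻ y, g y ^ (4 / 3 : ℝ) = ∫⁻ y, hg.mk g y ^ (4 / 3 : ℝ) :=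
    lintegral_congr_ae (by filter_upwards [hg.ae_eq_mk] with y h; rw [← h])
  simp only [h1, h2, h3]
  exact lintegral_correlation_sq_le hf.measurable_mk hg.measurable_mk

/-- The Fourier integral at η pairs f with the modulation of f' by -η, and Parseval turns this
modulation into a translation. This gives the transform of a product of two L² functions pointwise.
-/
theorem IsFT.fourier_conj_mul {f g f' g' : V → ℂ} (h : IsFT f g) (h' : IsFT f' g') (η : V) :
    𝓕 (fun x => (starRingEnd ℂ) (f x) * f' x) η = ∫ ξ, (starRingEnd ℂ) (g ξ) * g' (ξ + η) := by
  have h1 := h.parseval (h'.modulate (-η))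
  simp only [sub_neg_eq_add] at h1
  rw [← h1, Real.fourier_eq]
  refine integral_congr_ae (Filter.Eventually.of_forall fun x => ?_)
  simp only [Circle.smul_def, smul_eq_mul, chr, inner_neg_right]
  ring

/-- The left side is the squared L² norm of |f|², whose Fourier transform is the autocorrelation of
g. Since |f|² is integrable, Plancherel applies once its transform is square integrable; otherwise
the right side is infinite. -/
theorem IsFT.lintegral_pow_four_le {f g : V → ℂ} (h : IsFT f g) :
    ∫⁻ x, ‖f x‖ₑ ^ (4 : ℝ) ≤
      ∫⁻ η, ‖∫ ξ, (starRingEnd ℂ) (g ξ) * g (ξ + η)‖ₑ ^ (2 : ℝ) := by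
  have hf := h.memLp_left
  set k : V → ℂ := fun x => (starRingEnd ℂ) (f x) * f x with hk
  have hconj : MemLp (fun x => (starRingEnd ℂ) (f x)) 2 := hf.star
  have hki : Integrable k := hconj.integrable_mul hf
  have hF : ∀ η, 𝓕 k η = ∫ ξ, (starRingEnd ℂ) (g ξ) * g (ξ + η) := h.fourier_conj_mul h
  simp only [← hF]
  by_cases hfin : ∫⁻ η, ‖𝓕 k η‖ₑ ^ (2 : ℝ) = ∞
  · rw [hfin]; exact le_top
  have hm : AEStronglyMeasurable (𝓕 k) volume :=
    (VectorFourier.fourierIntegral_continuous Real.continuous_fourierChar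
      continuous_inner hki).aestronglyMeasurable
  have h2 : MemLp (𝓕 k) 2 := by
    refine ⟨hm, ?_⟩
    rw [eLpNorm_lt_top_iff_lintegral_rpow_enorm_lt_top (by norm_num) (by norm_num)]
    simpa using lt_top_iff_ne_top.2 hfin
  have h3 := eLpNorm_eq_eLpNorm_fourier hki h2
  have h4 : ∫⁻ x, ‖k x‖ₑ ^ (2 : ℝ) = ∫⁻ η, ‖𝓕 k η‖ₑ ^ (2 : ℝ) := by
    rw [eLpNorm_eq_lintegral_rpow_enorm_toReal (by norm_num) (by norm_num),
      eLpNorm_eq_lintegral_rpow_enorm_toReal (by norm_num) (by norm_num)] at h3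
    simp only [ENNReal.toReal_ofNat] at h3
    have := congrArg (fun z : ℝ≥0∞ => z ^ (2 : ℝ)) h3
    simp only [← ENNReal.rpow_mul] at this
    norm_num at this
    simpa using this
  rw [← h4]
  refine lintegral_mono fun x => ?_
  simp only [hk, enorm_mul, RCLike.enorm_conj]
  rw [ENNReal.mul_rpow_of_nonneg _ _ (by norm_num),
    ← ENNReal.rpow_add_of_nonneg _ _ (by norm_num) (by norm_num)]
  norm_num

/-- The Hausdorff–Young inequality `‖f‖₄ ≤ ‖f̂‖_{4/3}`. -/
theorem IsFT.hausdorff_young {f g : V → ℂ} (h : IsFT f g) :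
    ∫⁻ x, ‖f x‖ₑ ^ (4 : ℝ) ≤ (∫⁻ ξ, ‖g ξ‖ₑ ^ (4 / 3 : ℝ)) ^ (3 : ℝ) := by
  refine h.lintegral_pow_four_le.trans ?_
  have hg : AEMeasurable (fun ξ => ‖g ξ‖ₑ) := h.memLp_right.1.enorm
  have hY := lintegral_correlation_sq_le_ae hg hg
  rw [← ENNReal.rpow_add_of_nonneg _ _ (by norm_num) (by norm_num)] at hY
  norm_num at hY
  rw [← lintegral_neg_eq_self] at hY
  norm_num
  refine le_trans (lintegral_mono fun η => ?_) hY
  refine pow_le_pow_left' ?_ 2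
  refine (enorm_integral_le_lintegral_enorm _).trans (le_of_eq ?_)
  simp only [enorm_mul, RCLike.enorm_conj, sub_neg_eq_add]

/-- The Schrödinger symbol, for the Fourier transform with the phase `e^{-2πi x·ξ}`. -/
def schSymbol (ξ : V) : ℝ := -‖(2 * Real.pi) • ξ‖ ^ 2

theorem measurable_schSymbol : Measurable (schSymbol : V → ℝ) := by
  unfold schSymbol; fun_prop

theorem lintegral_comp_smul_eq (F : V → ℝ≥0∞) (hF : Measurable F) {r : ℝ} (hr : r ≠ 0) :
    ∫⁻ x, F (r • x) = ENNReal.ofReal (|r ^ Module.finrank ℝ V|⁻¹) * ∫⁻ x, F x := by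
  have h := Measure.map_addHaar_smul (volume : Measure V) hr
  have h2 : ∫⁻ x, F (r • x) = ∫⁻ x, F x ∂(Measure.map (fun x : V => r • x) volume) := by
    rw [lintegral_map hF (measurable_const_smul r)]
  rw [h2]
  have h3 : Measure.map (fun x : V => r • x) volume =
    ENNReal.ofReal |(r ^ Module.finrank ℝ V)⁻¹| • (volume : Measure V) := h
  rw [h3, lintegral_smul_measure, abs_inv, smul_eq_mul]

/-- The dispersive estimate `‖e^{itΔ}f‖₄ ≤ (4π|t|)^{-d/4} ‖f‖_{4/3}`. -/
theorem dispersive {f g v : V → ℂ} (h : IsFT f g) {t : ℝ} (ht : t ≠ 0)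
    (hv : IsFT v (fun ξ => ph schSymbol t ξ * g ξ)) :
    ∫⁻ x, ‖v x‖ₑ ^ (4 : ℝ) ≤ ENNReal.ofReal ((4 * Real.pi * |t|) ^ Module.finrank ℝ V)⁻¹ *
      (∫⁻ x, ‖f x‖ₑ ^ (4 / 3 : ℝ)) ^ (3 : ℝ) := by
  have hf0 := h.memLp_left.1.enorm
  have hr : (4 * Real.pi * t) ≠ 0 := by positivity
  -- The symbol is quadratic, so its difference between ξ + η and ξ is affine in ξ. The evolved
  -- autocorrelation is therefore, up to a unimodular factor, a pairing of g with a modulated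
  -- translate of itself. By Parseval it is a correlation of f with its translate by 4πtη, and no
  -- oscillatory kernel has to be computed.
  have hpt : ∀ η : V, ‖∫ ξ, (starRingEnd ℂ) (ph schSymbol t ξ * g ξ) *
      (ph schSymbol t (ξ + η) * g (ξ + η))‖ₑ ≤
      ∫⁻ y, ‖f y‖ₑ * ‖f (y - (4 * Real.pi * t) • η)‖ₑ := by
    intro η
    have h1 := (h.modulate (-η)).translate (-((4 * Real.pi * t) • η))
    have h2 := h.parseval h1
    have h3 : ∀ ξ, (starRingEnd ℂ) (ph schSymbol t ξ * g ξ) *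
      (ph schSymbol t (ξ + η) * g (ξ + η)) = ph schSymbol t η *
        ((starRingEnd ℂ) (g ξ) * (chr (-((4 * Real.pi * t) • η)) ξ * g (ξ - -η))) := by
      intro ξ
      have : (starRingEnd ℂ) (ph schSymbol t ξ) * ph schSymbol t (ξ + η) =
          ph schSymbol t η * chr (-((4 * Real.pi * t) • η)) ξ := by
        rw [conj_ph, chr_eq, ph, ph, ph, ← Complex.exp_add, ← Complex.exp_add]
        congr 1
        simp only [schSymbol, norm_smul, mul_pow, norm_add_sq_real, inner_neg_right,
          inner_smul_right]
        push_cast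
        simp only [Real.norm_eq_abs, abs_of_pos Real.pi_pos, abs_of_pos (two_pos : (0 : ℝ) < 2),
          abs_mul]
        push_cast
        ring
      rw [map_mul, sub_neg_eq_add]
      linear_combination ((starRingEnd ℂ) (g ξ) * g (ξ + η)) * this
    simp only [h3]
    rw [integral_const_mul, ← h2, enorm_mul]
    have h4 : ‖ph schSymbol t η‖ₑ = 1 := by
      rw [← ofReal_norm, norm_ph, ENNReal.ofReal_one]
    rw [h4, one_mul]
    refine (enorm_integral_le_lintegral_enorm _).trans (le_of_eq ?_)
    refine lintegral_congr fun x => ?_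
    have h5 : ∀ a b : V, ‖chr a b‖ₑ = 1 := fun a b => by
      rw [← ofReal_norm, norm_chr, ENNReal.ofReal_one]
    simp only [enorm_mul, RCLike.enorm_conj, h5, one_mul, sub_eq_add_neg]
  refine hv.lintegral_pow_four_le.trans ?_
  calc _ ≤ ∫⁻ η : V, (∫⁻ y, ‖f y‖ₑ * ‖f (y - (4 * Real.pi * t) • η)‖ₑ) ^ (2 : ℝ) :=
        lintegral_mono fun η => ENNReal.rpow_le_rpow (hpt η) (by norm_num)
    _ = ∫⁻ η : V, (∫⁻ y, hf0.mk _ y * hf0.mk _ (y - (4 * Real.pi * t) • η)) ^ (2 : ℝ) := by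
        refine lintegral_congr fun η => ?_
        congr 1
        refine lintegral_congr_ae ?_
        have h2 := (measurePreserving_sub_right (volume : Measure V)
          ((4 * Real.pi * t) • η)).quasiMeasurePreserving.ae_eq_comp hf0.ae_eq_mk
        filter_upwards [hf0.ae_eq_mk, h2] with y h3 h4
        simp only [Function.comp] at h4
        rw [h3, h4]
    -- The decay in time is the Jacobian of η ↦ 4πtη; Young's inequality then bounds what remains.
    _ = ENNReal.ofReal (|(4 * Real.pi * t) ^ Module.finrank ℝ V|⁻¹) *
        ∫⁻ z : V, (∫⁻ y, hf0.mk _ y * hf0.mk _ (y - z)) ^ (2 : ℝ) := by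
        have hm := hf0.measurable_mk
        refine lintegral_comp_smul_eq
          (fun z => (∫⁻ y, hf0.mk _ y * hf0.mk _ (y - z)) ^ (2 : ℝ)) ?_ hr
        refine Measurable.pow_const ?_ _
        exact Measurable.lintegral_prod_right' (f := fun p : V × V =>
          hf0.mk _ p.2 * hf0.mk _ (p.2 - p.1))
          ((hm.comp measurable_snd).mul (hm.comp (measurable_snd.sub measurable_fst)))
    _ ≤ _ := by
        have hY := lintegral_correlation_sq_le (μ := (volume : Measure V)) hf0.measurable_mk
          hf0.measurable_mk
        rw [← ENNReal.rpow_add_of_nonneg _ _ (by norm_num) (by norm_num)] at hY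
        have e1 : ∫⁻ x, ‖f x‖ₑ ^ (4 / 3 : ℝ) = ∫⁻ y, hf0.mk _ y ^ (4 / 3 : ℝ) :=
          lintegral_congr_ae (by filter_upwards [hf0.ae_eq_mk] with y h; rw [← h])
        rw [e1]
        refine mul_le_mul' (le_of_eq ?_) (hY.trans (le_of_eq (by norm_num)))
        congr 2
        rw [abs_pow, abs_mul, abs_mul, abs_of_pos Real.pi_pos, abs_of_pos (by norm_num : (0:ℝ) < 4)]

end Dispersive

/-! ### The singular time kernel and the cubic nonlinearity -/

theorem lintegral_rpow_neg_le {β h : ℝ} (hβ : β < 1) (hh : 0 ≤ h) :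
    ∫⁻ r in Set.Ioc 0 h, ENNReal.ofReal (|r| ^ (-β)) = ENNReal.ofReal (h ^ (1 - β) / (1 - β)) := by
  have h1 : ∫ r in (0 : ℝ)..h, r ^ (-β) = h ^ (1 - β) / (1 - β) := by
    rw [integral_rpow (Or.inl (by linarith)), Real.zero_rpow (by linarith)]
    rw [sub_zero]; congr 1 <;> ring_nf
  have hi : IntegrableOn (fun r : ℝ => r ^ (-β)) (Set.Ioc 0 h) :=
    (intervalIntegrable_iff_integrableOn_Ioc_of_le hh).1
      (intervalIntegral.intervalIntegrable_rpow' (by linarith))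
  rw [← h1, intervalIntegral.integral_of_le hh,
    ofReal_integral_eq_lintegral_ofReal hi ((ae_restrict_iff' measurableSet_Ioc).2
      (Filter.Eventually.of_forall fun r hr => Real.rpow_nonneg hr.1.le _))]
  refine setLIntegral_congr_fun measurableSet_Ioc fun r hr => ?_
  simp only [abs_of_pos hr.1]

theorem lintegral_abs_sub_rpow_neg_le {β h a t : ℝ} (hβ : β < 1) (hh : 0 ≤ h)
    (ht : t ∈ Set.Icc a (a + h)) :
    ∫⁻ s in Set.Icc a (a + h), ENNReal.ofReal (|t - s| ^ (-β)) ≤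
      ENNReal.ofReal (2 * (h ^ (1 - β) / (1 - β))) := by
  have hL := lintegral_rpow_neg_le hβ hh
  have h2 : ENNReal.ofReal (2 * (h ^ (1 - β) / (1 - β))) =
      ENNReal.ofReal (h ^ (1 - β) / (1 - β)) + ENNReal.ofReal (h ^ (1 - β) / (1 - β)) := by
    have : 0 ≤ h ^ (1 - β) / (1 - β) := div_nonneg (Real.rpow_nonneg hh _) (by linarith)
    rw [← ENNReal.ofReal_add this this, two_mul]
  set k : ℝ → ℝ≥0∞ := fun r => ENNReal.ofReal (|r| ^ (-β)) with hk
  have hkneg : ∀ r, k (-r) = k r := fun r => by simp [hk]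
  have hright : ∫⁻ s in Set.Icc t (a + h), k (t - s) ≤ ENNReal.ofReal (h ^ (1 - β) / (1 - β)) := by
    rw [← hL, setLIntegral_congr Ioc_ae_eq_Icc.symm, ← lintegral_indicator measurableSet_Ioc,
      ← lintegral_indicator measurableSet_Ioc,
      ← lintegral_sub_right_eq_self (fun r => (Set.Ioc 0 h).indicator k r) t]
    refine lintegral_mono fun s => ?_
    by_cases hs : s ∈ Set.Ioc t (a + h)
    · rw [Set.indicator_of_mem hs, Set.indicator_of_mem
        (show s - t ∈ Set.Ioc 0 h from ⟨by linarith [hs.1], by linarith [hs.2, ht.1]⟩),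
        ← hkneg, neg_sub]
    · rw [Set.indicator_of_notMem hs]; exact zero_le
  have hleft : ∫⁻ s in Set.Icc a t, k (t - s) ≤ ENNReal.ofReal (h ^ (1 - β) / (1 - β)) := by
    rw [← hL, setLIntegral_congr Ico_ae_eq_Icc.symm, ← lintegral_indicator measurableSet_Ico,
      ← lintegral_indicator measurableSet_Ioc,
      ← lintegral_sub_left_eq_self (fun r => (Set.Ioc 0 h).indicator k r) t]
    refine lintegral_mono fun s => ?_
    by_cases hs : s ∈ Set.Ico a t
    · rw [Set.indicator_of_mem hs, Set.indicator_of_mem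
        (show t - s ∈ Set.Ioc 0 h from ⟨by linarith [hs.2], by linarith [hs.1, ht.2]⟩)]
    · rw [Set.indicator_of_notMem hs]; exact zero_le
  rw [h2, ← Set.Icc_union_Icc_eq_Icc ht.1 ht.2]
  exact (lintegral_union_le _ _ _).trans (add_le_add hleft hright)

/-- It makes t ↦ |v|²v continuous in L² when v is uniformly bounded, as needed for the dual function
in the TT* argument. -/
theorem norm_cube_sub_le {B : ℝ} {a b : ℂ} (ha : ‖a‖ ≤ B) (hb : ‖b‖ ≤ B) :
    ‖((‖a‖ ^ 2 : ℝ) : ℂ) * a - ((‖b‖ ^ 2 : ℝ) : ℂ) * b‖ ≤ 3 * B ^ 2 * ‖a - b‖ := by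
  have e : ((‖a‖ ^ 2 : ℝ) : ℂ) * a - ((‖b‖ ^ 2 : ℝ) : ℂ) * b =
      ((‖a‖ ^ 2 : ℝ) : ℂ) * (a - b) + ((‖a‖ ^ 2 - ‖b‖ ^ 2 : ℝ) : ℂ) * b := by
    push_cast; ring
  rw [e]
  refine (norm_add_le _ _).trans ?_
  rw [norm_mul, norm_mul, Complex.norm_real, Complex.norm_real, Real.norm_eq_abs, Real.norm_eq_abs]
  have h1 : |‖a‖ - ‖b‖| ≤ ‖a - b‖ := abs_norm_sub_norm_le a b
  have h2 : |‖a‖ ^ 2 - ‖b‖ ^ 2| ≤ 2 * B * ‖a - b‖ := by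
    have : ‖a‖ ^ 2 - ‖b‖ ^ 2 = (‖a‖ + ‖b‖) * (‖a‖ - ‖b‖) := by ring
    rw [this, abs_mul, abs_of_nonneg (by positivity)]
    exact mul_le_mul (by linarith) h1 (abs_nonneg _) (by linarith [norm_nonneg a])
  have hB : 0 ≤ B := (norm_nonneg a).trans ha
  have h3 : |‖a‖ ^ 2 - ‖b‖ ^ 2| * ‖b‖ ≤ 2 * B * ‖a - b‖ * B :=
    mul_le_mul h2 hb (norm_nonneg _) (by positivity)
  have h4 : |‖a‖ ^ 2| * ‖a - b‖ ≤ B ^ 2 * ‖a - b‖ := by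
    rw [abs_of_nonneg (by positivity)]
    exact mul_le_mul_of_nonneg_right (pow_le_pow_left₀ (norm_nonneg _) ha 2) (norm_nonneg _)
  nlinarith

/-! ### The Strichartz estimate by the TT* method -/

section Strichartz

variable {V : Type*} [NormedAddCommGroup V] [InnerProductSpace ℝ V] [FiniteDimensional ℝ V]
  [MeasurableSpace V] [BorelSpace V]

theorem inner_mulL_ph {m : V → ℝ} (hm : Measurable m) (t : ℝ) (f g : Lp ℂ 2 (volume : Measure V)) :
    inner ℂ (mulL (ph m (-t)) f) g = inner ℂ f (mulL (ph m t) g) := by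
  rw [L2.inner_def, L2.inner_def]
  refine integral_congr_ae ?_
  filter_upwards [mulL_ph_coe hm (-t) f, mulL_ph_coe hm t g] with x h1 h2
  rw [h1, h2, RCLike.inner_apply, RCLike.inner_apply, map_mul, conj_ph, neg_neg]
  ring

/-- Hölder's inequality for the `L²` pairing with the exponents `4/3` and `4`. -/
theorem enorm_inner_le (f g : Lp ℂ 2 (volume : Measure V)) :
    ‖inner ℂ f g‖ₑ ≤ (∫⁻ x, ‖f x‖ₑ ^ (4 / 3 : ℝ)) ^ (3 / 4 : ℝ) *
      (∫⁻ x, ‖g x‖ₑ ^ (4 : ℝ)) ^ (1 / 4 : ℝ) := by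
  rw [L2.inner_def]
  refine (enorm_integral_le_lintegral_enorm _).trans ?_
  have h := ENNReal.lintegral_mul_le_Lp_mul_Lq (volume : Measure V) (p := 4 / 3) (q := 4)
    (by rw [Real.holderConjugate_iff]; norm_num)
    (Lp.aestronglyMeasurable f).enorm (Lp.aestronglyMeasurable g).enorm
  norm_num at h ⊢
  refine le_trans (lintegral_mono fun x => ?_) h
  rw [mul_comm]

/-- The kernel bound for TT*: Hölder pairs L^{4/3} with L⁴, and the dispersive estimate brings the
L⁴ factor back to L^{4/3}. The constant (4π)^{-d/4} ≤ 1 is dropped. -/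
theorem enorm_inner_evolved_le (F G : Lp ℂ 2 (volume : Measure V)) {t : ℝ} (ht : t ≠ 0) :
    ‖inner ℂ (𝓕 F : Lp ℂ 2 (volume : Measure V))
      (mulL (ph schSymbol t) (𝓕 G : Lp ℂ 2 (volume : Measure V)))‖ₑ ≤
      ENNReal.ofReal (|t| ^ (-(Module.finrank ℝ V / 4 : ℝ))) *
        ((∫⁻ x, ‖F x‖ₑ ^ (4 / 3 : ℝ)) ^ (3 / 4 : ℝ) *
          (∫⁻ x, ‖G x‖ₑ ^ (4 / 3 : ℝ)) ^ (3 / 4 : ℝ)) := by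
  set w : Lp ℂ 2 (volume : Measure V) :=
    𝓕⁻ (mulL (ph schSymbol t) (𝓕 G : Lp ℂ 2 (volume : Measure V)))
  have h1 : inner ℂ (𝓕 F : Lp ℂ 2 (volume : Measure V))
      (mulL (ph schSymbol t) (𝓕 G : Lp ℂ 2 (volume : Measure V))) = inner ℂ F w := by
    rw [← Lp.inner_fourier_eq F w, fourier_fourierInv_eq]
  rw [h1]
  refine (enorm_inner_le F w).trans ?_
  have hw : IsFT w (fun ξ => ph schSymbol t ξ * (𝓕 G : Lp ℂ 2 (volume : Measure V)) ξ) :=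
    ⟨w, ae_eq_rfl, by rw [fourier_fourierInv_eq]; exact mulL_ph_coe measurable_schSymbol t _⟩
  have hd := ENNReal.rpow_le_rpow (dispersive (isFT_coe G) ht hw) (show (0:ℝ) ≤ 1 / 4 by norm_num)
  rw [ENNReal.mul_rpow_of_nonneg _ _ (by norm_num), ← ENNReal.rpow_mul] at hd
  have h2 : ENNReal.ofReal ((4 * Real.pi * |t|) ^ Module.finrank ℝ V)⁻¹ ^ (1 / 4 : ℝ) ≤
      ENNReal.ofReal (|t| ^ (-(Module.finrank ℝ V / 4 : ℝ))) := by
    have ht' : 0 < |t| := abs_pos.2 ht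
    rw [ENNReal.ofReal_rpow_of_nonneg (by positivity) (by norm_num)]
    refine ENNReal.ofReal_le_ofReal ?_
    have h3 : ((4 * Real.pi * |t|) ^ Module.finrank ℝ V)⁻¹ ≤ (|t| ^ Module.finrank ℝ V)⁻¹ := by
      refine inv_anti₀ (by positivity) (pow_le_pow_left₀ ht'.le ?_ _)
      nlinarith [Real.pi_gt_three]
    refine (Real.rpow_le_rpow (by positivity) h3 (by norm_num)).trans (le_of_eq ?_)
    rw [← Real.rpow_natCast, ← Real.rpow_neg ht'.le, ← Real.rpow_mul ht'.le]
    congr 1; ring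
  calc _ ≤ (∫⁻ x, ‖F x‖ₑ ^ (4 / 3 : ℝ)) ^ (3 / 4 : ℝ) *
        (ENNReal.ofReal ((4 * Real.pi * |t|) ^ Module.finrank ℝ V)⁻¹ ^ (1 / 4 : ℝ) *
          (∫⁻ x, ‖G x‖ₑ ^ (4 / 3 : ℝ)) ^ (3 * (1 / 4) : ℝ)) := by gcongr
    _ ≤ (∫⁻ x, ‖F x‖ₑ ^ (4 / 3 : ℝ)) ^ (3 / 4 : ℝ) *
        (ENNReal.ofReal (|t| ^ (-(Module.finrank ℝ V / 4 : ℝ))) *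
          (∫⁻ x, ‖G x‖ₑ ^ (4 / 3 : ℝ)) ^ (3 * (1 / 4) : ℝ)) := by gcongr
    _ = _ := by norm_num; ring

/-- The `L²_t L⁴_x` Strichartz estimate, by the `TT*` method. -/
theorem strichartz_aux (hd : Module.finrank ℝ V < 4) (f : Lp ℂ 2 (volume : Measure V))
    (hf0 : f ≠ 0) (G₀ v : ℝ → Lp ℂ 2 (volume : Measure V))
    (hv : ∀ t, v t = 𝓕⁻ (mulL (ph schSymbol t) f))
    (hG₀ : ∀ t, G₀ t =ᵐ[volume] fun x => ((‖v t x‖ ^ 2 : ℝ) : ℂ) * v t x)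
    (hGc : Continuous G₀) {a h : ℝ} (hh : 0 ≤ h) :
    ∫⁻ t in Set.Icc a (a + h), (∫⁻ x, ‖v t x‖ₑ ^ (4 : ℝ)) ^ (1 / 2 : ℝ) ≤
      ENNReal.ofReal (2 * (h ^ (1 - (Module.finrank ℝ V / 4 : ℝ)) /
        (1 - (Module.finrank ℝ V / 4 : ℝ)))) * ‖f‖ₑ ^ 2 := by
  set β : ℝ := (Module.finrank ℝ V / 4 : ℝ) with hβdef
  have hβ : β < 1 := by
    have : (Module.finrank ℝ V : ℝ) < 4 := by exact_mod_cast hd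
    rw [hβdef]; linarith
  set Cst : ℝ := 2 * (h ^ (1 - β) / (1 - β)) with hCst
  have hC0 : 0 ≤ Cst :=
    mul_nonneg two_pos.le (div_nonneg (Real.rpow_nonneg hh _) (by linarith))
  have hvc : Continuous v := by
    have : v = fun t => 𝓕⁻ (mulL (ph schSymbol t) f) := funext hv
    rw [this]
    exact (Lp.fourierTransformₗᵢ V ℂ).symm.continuous.comp
      (continuous_mulL_ph_const measurable_schSymbol f)
  -- the fourth power of the `L⁴` norm
  set y : ℝ → ℝ := fun t => (inner ℂ (G₀ t) (v t)).re with hy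
  have hyc : Continuous y := Complex.continuous_re.comp (hGc.inner hvc)
  have hin : ∀ t, (fun x => inner ℂ (G₀ t x) (v t x)) =ᵐ[volume]
      fun x => ((‖v t x‖ ^ 4 : ℝ) : ℂ) := by
    intro t
    filter_upwards [hG₀ t] with x hx
    rw [hx, RCLike.inner_apply, map_mul, Complex.conj_ofReal, mul_comm, mul_assoc,
      Complex.conj_mul']
    push_cast; ring
  have hinteg : ∀ t, Integrable (fun x => ‖v t x‖ ^ 4) := by
    intro t
    have h1 : Integrable (fun x => inner ℂ (G₀ t x) (v t x)) volume := L2.integrable_inner _ _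
    exact (h1.congr (hin t)).re.congr (Filter.Eventually.of_forall fun x => by
      simp only [RCLike.re_eq_complex_re, Complex.ofReal_re])
  have hinner : ∀ t, inner ℂ (G₀ t) (v t) = ((∫ x, ‖v t x‖ ^ 4 : ℝ) : ℂ) := by
    intro t
    rw [L2.inner_def, integral_congr_ae (hin t), integral_complex_ofReal]
  have hyint : ∀ t, y t = ∫ x, ‖v t x‖ ^ 4 := fun t => by
    simp only [hy, hinner t, Complex.ofReal_re]
  have hylin : ∀ t, ∫⁻ x, ‖v t x‖ₑ ^ (4 : ℝ) = ENNReal.ofReal (y t) := by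
    intro t
    rw [hyint, ofReal_integral_eq_lintegral_ofReal (hinteg t)
      (Filter.Eventually.of_forall fun x => by positivity)]
    refine lintegral_congr fun x => ?_
    rw [← ofReal_norm, ENNReal.ofReal_rpow_of_nonneg (norm_nonneg _) (by norm_num)]
    norm_num
  -- The flow is isometric and f ≠ 0, so v(t) never vanishes and negative powers of y are
  -- continuous.
  have hypos : ∀ t, 0 < y t := by
    intro t
    have h0 : 0 ≤ y t := by rw [hyint]; exact integral_nonneg fun x => by positivity
    refine lt_of_le_of_ne h0 fun h0 => hf0 ?_
    rw [hyint] at h0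
    have h1 := (integral_eq_zero_iff_of_nonneg (fun x => by positivity) (hinteg t)).1 h0.symm
    have h2 : v t = 0 := by
      refine Lp.ext ?_
      filter_upwards [h1, Lp.coeFn_zero ℂ 2 (volume : Measure V)] with x hx hx0
      rw [hx0]
      simpa using hx
    have h3 : ‖v t‖ = ‖f‖ := by
      rw [hv]
      exact ((Lp.fourierTransformₗᵢ V ℂ).symm.norm_map _).trans
        (norm_mulL_ph measurable_schSymbol t f)
    rw [h2, norm_zero] at h3
    exact norm_eq_zero.1 h3.symm
  -- the dual function
  set c : ℝ → ℝ := fun t => y t ^ (-(1 / 2) : ℝ) with hc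
  have hcc : Continuous c := hyc.rpow_const fun t => Or.inl (hypos t).ne'
  set G : ℝ → Lp ℂ 2 (volume : Measure V) := fun t => (c t : ℂ) • G₀ t with hG
  have hGcont : Continuous G := (Complex.continuous_ofReal.comp hcc).smul hGc
  -- With y = ‖v‖₄⁴, the factor y^{-1/2} gives ‖G‖_{4/3} = y^{-1/2} y^{3/4} = ‖v‖₄ and ⟨G, v⟩ =
  -- ‖v‖₄²: at each time G is extremal for the duality of L⁴ and L^{4/3}.
  have hGnorm : ∀ t, (∫⁻ x, ‖G t x‖ₑ ^ (4 / 3 : ℝ)) ^ (3 / 4 : ℝ) =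
      ENNReal.ofReal (y t ^ (1 / 4 : ℝ)) := by
    intro t
    have h1 : ∀ᵐ x, ‖G t x‖ₑ ^ (4 / 3 : ℝ) =
        ENNReal.ofReal (c t ^ (4 / 3 : ℝ)) * ‖v t x‖ₑ ^ (4 : ℝ) := by
      filter_upwards [Lp.coeFn_smul (c t : ℂ) (G₀ t), hG₀ t] with x hx hx2
      have hc0 : 0 ≤ c t := Real.rpow_nonneg (hypos t).le _
      have : ‖G t x‖ₑ = ENNReal.ofReal (c t * ‖v t x‖ ^ 3) := by
        rw [hG, ← ofReal_norm]
        simp only at hx ⊢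
        rw [hx, Pi.smul_apply, hx2, norm_smul, norm_mul, Complex.norm_real, Complex.norm_real,
          Real.norm_of_nonneg hc0, Real.norm_of_nonneg (by positivity)]
        congr 1
      rw [this, ← ofReal_norm, ENNReal.ofReal_rpow_of_nonneg (by positivity) (by norm_num),
        ENNReal.ofReal_rpow_of_nonneg (norm_nonneg _) (by norm_num),
        ← ENNReal.ofReal_mul (by positivity), Real.mul_rpow hc0 (by positivity),
        ← Real.rpow_natCast, ← Real.rpow_mul (norm_nonneg _)]
      norm_num
    rw [lintegral_congr_ae h1, lintegral_const_mul' _ _ ENNReal.ofReal_ne_top, hylin,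
      ← ENNReal.ofReal_mul (Real.rpow_nonneg (Real.rpow_nonneg (hypos t).le _) _),
      ENNReal.ofReal_rpow_of_nonneg
        (mul_nonneg (Real.rpow_nonneg (Real.rpow_nonneg (hypos t).le _) _) (hypos t).le)
        (by norm_num)]
    congr 1
    have : c t ^ (4 / 3 : ℝ) * y t = y t ^ (1 / 3 : ℝ) := by
      rw [hc]
      simp only
      rw [← Real.rpow_mul (hypos t).le]
      nth_rw 2 [← Real.rpow_one (y t)]
      rw [← Real.rpow_add (hypos t)]
      norm_num
    rw [this, ← Real.rpow_mul (hypos t).le]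
    norm_num
  -- K is G carried back to time 0. Its integral Z is T*G, so ⟨Z, f⟩ is the quantity Φ to be
  -- bounded, and ‖Z‖² is a double integral of inner products of G with an evolved G.
  set K : ℝ → Lp ℂ 2 (volume : Measure V) := fun t =>
    mulL (ph schSymbol (-t)) (𝓕 (G t) : Lp ℂ 2 (volume : Measure V)) with hK
  have hKc : Continuous K := (continuous_mulL_ph measurable_schSymbol).comp
    (continuous_neg.prodMk ((Lp.fourierTransformₗᵢ V ℂ).continuous.comp hGcont))
  have hKf : ∀ t, inner ℂ (K t) f = ((y t ^ (1 / 2 : ℝ) : ℝ) : ℂ) := by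
    intro t
    rw [hK]
    simp only
    rw [inner_mulL_ph measurable_schSymbol]
    have : mulL (ph schSymbol t) f = (𝓕 (v t) : Lp ℂ 2 (volume : Measure V)) := by
      rw [hv, fourier_fourierInv_eq]
    rw [this, Lp.inner_fourier_eq, hG]
    simp only
    rw [inner_smul_left, hinner, ← hyint, Complex.conj_ofReal, ← Complex.ofReal_mul]
    congr 1
    have e : y t ^ (-(1 / 2) : ℝ) * y t ^ (1 : ℝ) = y t ^ (1 / 2 : ℝ) := by
      rw [← Real.rpow_add (hypos t)]; norm_num
    rwa [Real.rpow_one] at e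
  -- The arithmetic-geometric mean inequality decouples y(t)^{1/4} y(s)^{1/4}. The kernel can then
  -- be integrated in one variable at a time, as in Schur's test.
  have hKK : ∀ t s, t ≠ s → ‖inner ℂ (K t) (K s)‖ₑ ≤ ENNReal.ofReal (|t - s| ^ (-β)) *
      (ENNReal.ofReal (y t ^ (1 / 2 : ℝ) / 2) + ENNReal.ofReal (y s ^ (1 / 2 : ℝ) / 2)) := by
    intro t s hts
    have h1 : inner ℂ (K t) (K s) = inner ℂ (𝓕 (G t) : Lp ℂ 2 (volume : Measure V))
        (mulL (ph schSymbol (t - s)) (𝓕 (G s) : Lp ℂ 2 (volume : Measure V))) := by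
      rw [hK]
      simp only
      rw [inner_mulL_ph measurable_schSymbol, ← mulL_ph_add measurable_schSymbol, sub_eq_add_neg]
    rw [h1]
    refine (enorm_inner_evolved_le (G t) (G s) (sub_ne_zero.2 hts)).trans ?_
    rw [hGnorm, hGnorm]
    refine mul_le_mul_right ?_ _
    rw [← ENNReal.ofReal_mul (Real.rpow_nonneg (hypos t).le _),
      ← ENNReal.ofReal_add (div_nonneg (Real.rpow_nonneg (hypos t).le _) two_pos.le)
        (div_nonneg (Real.rpow_nonneg (hypos s).le _) two_pos.le)]
    refine ENNReal.ofReal_le_ofReal ?_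
    have e : ∀ z : ℝ, 0 < z → z ^ (1 / 2 : ℝ) = (z ^ (1 / 4 : ℝ)) ^ 2 := fun z hz => by
      rw [← Real.rpow_natCast, ← Real.rpow_mul hz.le]; norm_num
    rw [e _ (hypos t), e _ (hypos s)]
    nlinarith [sq_nonneg (y t ^ (1 / 4 : ℝ) - y s ^ (1 / 4 : ℝ))]
  set I := Set.Icc a (a + h) with hI
  have hKint : IntegrableOn K I := hKc.continuousOn.integrableOn_Icc
  set Z := ∫ t in I, K t with hZ
  have hyhc : Continuous fun t => y t ^ (1 / 2 : ℝ) :=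
    hyc.rpow_const fun t => Or.inl (hypos t).ne'
  set Φ : ℝ := ∫ t in I, y t ^ (1 / 2 : ℝ) with hΦ
  have hyinteg : IntegrableOn (fun t => y t ^ (1 / 2 : ℝ)) I := hyhc.continuousOn.integrableOn_Icc
  have hΦ0 : 0 ≤ Φ := integral_nonneg fun t => Real.rpow_nonneg (hypos t).le _
  have hΦlin : ∫⁻ t in I, ENNReal.ofReal (y t ^ (1 / 2 : ℝ)) = ENNReal.ofReal Φ := by
    rw [hΦ, ofReal_integral_eq_lintegral_ofReal hyinteg
      (Filter.Eventually.of_forall fun t => Real.rpow_nonneg (hypos t).le _)]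
  have hZf : inner ℂ Z f = (Φ : ℂ) := by
    rw [← inner_conj_symm, hZ, ← integral_inner hKint, ← integral_conj]
    simp only [inner_conj_symm, hKf]
    rw [integral_complex_ofReal]
  have hΦle : Φ ≤ ‖Z‖ * ‖f‖ := by
    have := norm_inner_le_norm (𝕜 := ℂ) Z f
    rwa [hZf, Complex.norm_real, Real.norm_of_nonneg hΦ0] at this
  have hZZ : ENNReal.ofReal (‖Z‖ ^ 2) ≤ ENNReal.ofReal (Cst * Φ) := by
    have h1 : ENNReal.ofReal (‖Z‖ ^ 2) = ‖inner ℂ Z Z‖ₑ := by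
      rw [inner_self_eq_norm_sq_to_K, ← ofReal_norm]
      simp
    have h2 : inner ℂ Z Z = ∫ s in I, inner ℂ Z (K s) := by
      rw [integral_inner hKint]
    have h3 : ∀ s, inner ℂ Z (K s) = ∫ t in I, inner ℂ (K t) (K s) := by
      intro s
      rw [← inner_conj_symm, hZ, ← integral_inner hKint, ← integral_conj]
      simp only [inner_conj_symm]
    rw [h1, h2]
    simp only [h3]
    refine (enorm_integral_le_lintegral_enorm _).trans ?_
    have hmk : Measurable fun p : ℝ × ℝ => ENNReal.ofReal (|p.2 - p.1| ^ (-β)) := by fun_prop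
    have hmy : Measurable fun t => ENNReal.ofReal (y t ^ (1 / 2 : ℝ) / 2) :=
      ENNReal.measurable_ofReal.comp (hyhc.measurable.div_const 2)
    calc ∫⁻ s in I, ‖∫ t in I, inner ℂ (K t) (K s)‖ₑ
        ≤ ∫⁻ s in I, ∫⁻ t in I, ENNReal.ofReal (|t - s| ^ (-β)) *
            (ENNReal.ofReal (y t ^ (1 / 2 : ℝ) / 2) + ENNReal.ofReal (y s ^ (1 / 2 : ℝ) / 2)) := by
          refine lintegral_mono fun s => ?_
          refine (enorm_integral_le_lintegral_enorm _).trans ?_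
          refine lintegral_mono_ae ?_
          have : ∀ᵐ t ∂(volume.restrict I), t ≠ s :=
            ae_restrict_of_ae (Measure.ae_ne volume s)
          filter_upwards [this] with t ht
          exact hKK t s ht
      _ = (∫⁻ s in I, ∫⁻ t in I, ENNReal.ofReal (|t - s| ^ (-β)) *
            ENNReal.ofReal (y t ^ (1 / 2 : ℝ) / 2)) +
          ∫⁻ s in I, ∫⁻ t in I, ENNReal.ofReal (|t - s| ^ (-β)) *
            ENNReal.ofReal (y s ^ (1 / 2 : ℝ) / 2) := by
          rw [← lintegral_add_left]
          · refine lintegral_congr fun s => ?_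
            simp only [mul_add]
            rw [lintegral_add_left]
            exact (hmk.comp (measurable_const.prodMk measurable_id)).mul hmy
          · exact Measurable.lintegral_prod_right' (f := fun p : ℝ × ℝ =>
              ENNReal.ofReal (|p.2 - p.1| ^ (-β)) * ENNReal.ofReal (y p.2 ^ (1 / 2 : ℝ) / 2))
              (hmk.mul (hmy.comp measurable_snd))
      _ ≤ (∫⁻ t in I, ENNReal.ofReal Cst * ENNReal.ofReal (y t ^ (1 / 2 : ℝ) / 2)) +
          ∫⁻ s in I, ENNReal.ofReal Cst * ENNReal.ofReal (y s ^ (1 / 2 : ℝ) / 2) := by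
          refine add_le_add ?_ ?_
          · rw [lintegral_lintegral_swap ((hmk.mul (hmy.comp measurable_snd)).aemeasurable)]
            refine setLIntegral_mono' measurableSet_Icc fun t ht => ?_
            rw [lintegral_mul_const' _ _ ENNReal.ofReal_ne_top]
            exact mul_le_mul_left (lintegral_abs_sub_rpow_neg_le hβ hh ht) _
          · refine setLIntegral_mono' measurableSet_Icc fun s hs => ?_
            rw [lintegral_mul_const' _ _ ENNReal.ofReal_ne_top]
            refine mul_le_mul_left ?_ _
            simp only [abs_sub_comm _ s]
            exact lintegral_abs_sub_rpow_neg_le hβ hh hs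
      _ = ENNReal.ofReal (Cst * Φ) := by
          have e : ∫⁻ t in I, ENNReal.ofReal (y t ^ (1 / 2 : ℝ) / 2) = ENNReal.ofReal (Φ / 2) := by
            have : Φ / 2 = ∫ t in I, y t ^ (1 / 2 : ℝ) / 2 := by rw [integral_div]
            rw [this, ofReal_integral_eq_lintegral_ofReal (hyinteg.div_const 2)
              (Filter.Eventually.of_forall fun t =>
                div_nonneg (Real.rpow_nonneg (hypos t).le _) two_pos.le)]
          rw [lintegral_const_mul' _ _ ENNReal.ofReal_ne_top, e, ← ENNReal.ofReal_mul hC0,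
            ← ENNReal.ofReal_add (by positivity) (by positivity)]
          congr 1; ring
  have hZ2 : ‖Z‖ ^ 2 ≤ Cst * Φ := (ENNReal.ofReal_le_ofReal_iff (by positivity)).1 hZZ
  -- Φ² ≤ ‖Z‖² ‖f‖² ≤ Cst Φ ‖f‖², and one factor Φ, a finite real number, cancels.
  have hfin : Φ ≤ Cst * ‖f‖ ^ 2 := by
    rcases hΦ0.eq_or_lt with h0 | h0
    · rw [← h0]; positivity
    · have h1 : Φ ^ 2 ≤ (‖Z‖ * ‖f‖) ^ 2 := pow_le_pow_left₀ hΦ0 hΦle 2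
      have h2 : Φ * Φ ≤ (Cst * ‖f‖ ^ 2) * Φ := by
        calc Φ * Φ = Φ ^ 2 := by ring
          _ ≤ ‖Z‖ ^ 2 * ‖f‖ ^ 2 := by rw [← mul_pow]; exact h1
          _ ≤ (Cst * Φ) * ‖f‖ ^ 2 := mul_le_mul_of_nonneg_right hZ2 (by positivity)
          _ = _ := by ring
      exact le_of_mul_le_mul_right h2 h0
  calc _ = ∫⁻ t in I, ENNReal.ofReal (y t ^ (1 / 2 : ℝ)) := by
        refine lintegral_congr fun t => ?_
        rw [hylin, ENNReal.ofReal_rpow_of_nonneg (hypos t).le (by norm_num)]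
    _ = ENNReal.ofReal Φ := hΦlin
    _ ≤ ENNReal.ofReal (Cst * ‖f‖ ^ 2) := ENNReal.ofReal_le_ofReal hfin
    _ = _ := by
        rw [ENNReal.ofReal_mul hC0, ENNReal.ofReal_pow (norm_nonneg _), ofReal_norm]

/-- Integrability of f bounds its evolution pointwise, uniformly in time. Hence |v|²v lies in L² and
depends continuously on time, and the dual function is available. The restriction is removed by
density after the bilinear estimate. -/
theorem strichartz (hd : Module.finrank ℝ V < 4) (f : Lp ℂ 2 (volume : Measure V))
    (hfi : Integrable f) {a h : ℝ} (hh : 0 ≤ h) :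
    ∫⁻ t in Set.Icc a (a + h),
      (∫⁻ x, ‖(𝓕⁻ (mulL (ph schSymbol t) f) : Lp ℂ 2 (volume : Measure V)) x‖ₑ ^ (4 : ℝ)) ^
        (1 / 2 : ℝ) ≤
      ENNReal.ofReal (2 * (h ^ (1 - (Module.finrank ℝ V / 4 : ℝ)) /
        (1 - (Module.finrank ℝ V / 4 : ℝ)))) * ‖f‖ₑ ^ 2 := by
  by_cases hf0 : f = 0
  · have h0 : ∀ t, ∫⁻ x, ‖(𝓕⁻ (mulL (ph schSymbol t) f) : Lp ℂ 2 (volume : Measure V)) x‖ₑ ^ (4 : ℝ)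
        = 0 := by
      intro t
      have : (𝓕⁻ (mulL (ph schSymbol t) f) : Lp ℂ 2 (volume : Measure V)) = 0 := by
        rw [hf0, map_zero]; exact (Lp.fourierTransformₗᵢ V ℂ).symm.map_zero
      rw [this, lintegral_eq_zero_iff' ((Lp.aestronglyMeasurable _).enorm.pow_const _)]
      filter_upwards with x
      simp
    simp only [h0]
    simp
  set v : ℝ → Lp ℂ 2 (volume : Measure V) := fun t => 𝓕⁻ (mulL (ph schSymbol t) f) with hv
  set B : ℝ := ∫ ξ, ‖f ξ‖ with hB
  have hbd : ∀ t, ∀ᵐ x, ‖v t x‖ ≤ B := by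
    intro t
    have hi : Integrable (mulL (ph schSymbol t) f) := by
      refine Integrable.mono hfi (Lp.aestronglyMeasurable _) ?_
      filter_upwards [mulL_ph_coe measurable_schSymbol t f] with x hx
      rw [hx, norm_mul, norm_ph, one_mul]
    filter_upwards [lp_fourierInv_ae_eq _ hi] with x hx
    rw [hv]
    simp only
    rw [hx]
    refine (VectorFourier.norm_fourierIntegral_le_integral_norm _ _ _ _ _).trans (le_of_eq ?_)
    refine integral_congr_ae ?_
    filter_upwards [mulL_ph_coe measurable_schSymbol t f] with x hx
    rw [hx, norm_mul, norm_ph, one_mul]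
  have hvc : Continuous v := (Lp.fourierTransformₗᵢ V ℂ).symm.continuous.comp
      (continuous_mulL_ph_const measurable_schSymbol f)
  have hmem : ∀ t, MemLp (fun x => ((‖v t x‖ ^ 2 : ℝ) : ℂ) * v t x) 2 := by
    intro t
    refine MemLp.of_le_mul (c := B ^ 2) (Lp.memLp (v t)) ?_ ?_
    · exact (Complex.continuous_ofReal.comp_aestronglyMeasurable
        ((Lp.aestronglyMeasurable (v t)).norm.pow 2)).mul (Lp.aestronglyMeasurable (v t))
    · filter_upwards [hbd t] with x hx
      rw [norm_mul, Complex.norm_real, Real.norm_of_nonneg (by positivity)]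
      exact mul_le_mul_of_nonneg_right (pow_le_pow_left₀ (norm_nonneg _) hx 2) (norm_nonneg _)
  set G₀ : ℝ → Lp ℂ 2 (volume : Measure V) := fun t => (hmem t).toLp _ with hG₀
  have hlip : ∀ t s, ‖G₀ t - G₀ s‖ ≤ 3 * B ^ 2 * ‖v t - v s‖ := by
    intro t s
    refine Lp.norm_le_mul_norm_of_ae_le_mul ?_
    filter_upwards [Lp.coeFn_sub (G₀ t) (G₀ s), Lp.coeFn_sub (v t) (v s), (hmem t).coeFn_toLp,
      (hmem s).coeFn_toLp, hbd t, hbd s] with x h1 h2 h3 h4 h5 h6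
    rw [h1, h2, Pi.sub_apply, Pi.sub_apply, h3, h4]
    exact norm_cube_sub_le h5 h6
  have hGc : Continuous G₀ := by
    rw [continuous_iff_continuousAt]
    intro t₀
    rw [ContinuousAt, tendsto_iff_norm_sub_tendsto_zero]
    refine squeeze_zero (fun _ => norm_nonneg _) (fun t => hlip t t₀) ?_
    have : Continuous fun t => 3 * B ^ 2 * ‖v t - v t₀‖ :=
      continuous_const.mul (hvc.sub continuous_const).norm
    simpa using this.tendsto t₀
  exact strichartz_aux hd f hf0 G₀ v (fun t => rfl) (fun t => (hmem t).coeFn_toLp) hGc hh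

end Strichartz

/-! ### Quadratic evolution equations with bounds only after integration in time -/

section Abstract

variable {X Y Z : Type*} [NormedAddCommGroup X] [NormedSpace ℝ X] [CompleteSpace X]
  [NormedAddCommGroup Y] [NormedSpace ℝ Y] [CompleteSpace Y]
  [NormedAddCommGroup Z] [NormedSpace ℝ Z] [CompleteSpace Z]

/-- The curve `t ↦ x₀ + ∫₀ᵗ F dν`. -/
def curve (ν : Measure ℝ) (x₀ : X) (F : ℝ → X) (t : ℝ) : X := x₀ + ∫ s in (0 : ℝ)..t, F s ∂ν

variable {ν : Measure ℝ}

theorem continuous_curve [NullSingletonClass ν] (x₀ : X) {F : ℝ → X} (hF : Integrable F ν) :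
    Continuous (curve ν x₀ F) :=
  continuous_const.add (intervalIntegral.continuous_primitive
    (fun _ _ => hF.intervalIntegrable) 0)

theorem enorm_intervalIntegral_le (F : ℝ → X) (a b : ℝ) :
    ‖∫ s in a..b, F s ∂ν‖ₑ ≤ ∫⁻ s, ‖F s‖ₑ ∂ν := by
  have h : ‖∫ s in a..b, F s ∂ν‖ₑ = ‖∫ s in Set.uIoc a b, F s ∂ν‖ₑ := by
    rw [← ofReal_norm, intervalIntegral.norm_intervalIntegral_eq, ofReal_norm]
  rw [h]
  exact (enorm_integral_le_lintegral_enorm _).trans (setLIntegral_le_lintegral _ _)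

theorem enorm_curve_le (x₀ : X) (F : ℝ → X) (t : ℝ) :
    ‖curve ν x₀ F t‖ₑ ≤ ‖x₀‖ₑ + ∫⁻ s, ‖F s‖ₑ ∂ν :=
  (enorm_add_le _ _).trans (add_le_add le_rfl (enorm_intervalIntegral_le F 0 t))

theorem curve_sub (x₀ y₀ : X) {F G : ℝ → X} (hF : Integrable F ν) (hG : Integrable G ν) (t : ℝ) :
    curve ν x₀ F t - curve ν y₀ G t = curve ν (x₀ - y₀) (F - G) t := by
  simp only [curve, Pi.sub_apply]
  rw [intervalIntegral.integral_sub hF.intervalIntegrable hG.intervalIntegrable]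
  abel

/-- An estimate for constant arguments, integrated in time, extends to absolutely continuous
curves. -/
theorem lintegral_apply_curve_le [SFinite ν] {L : ℝ → X →L[ℝ] Y}
    (hL : Continuous fun p : ℝ × X => L p.1 p.2) {μ : Measure ℝ} [SFinite μ] {M : ℝ≥0∞}
    (hM : ∀ x, ∫⁻ t, ‖L t x‖ₑ ∂μ ≤ M * ‖x‖ₑ) (x₀ : X) {F : ℝ → X} (hF : Integrable F ν) :
    ∫⁻ t, ‖L t (curve ν x₀ F t)‖ₑ ∂μ ≤ M * (‖x₀‖ₑ + ∫⁻ s, ‖F s‖ₑ ∂ν) := by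
  have hjoint : AEMeasurable (fun p : ℝ × ℝ => ‖L p.1 (F p.2)‖ₑ) (μ.prod ν) := by
    have h1 : AEStronglyMeasurable (fun p : ℝ × ℝ => (p.1, F p.2)) (μ.prod ν) :=
      measurable_fst.aestronglyMeasurable.prodMk hF.1.comp_snd
    exact (hL.comp_aestronglyMeasurable h1).enorm
  -- L t passes under the integral. Enlarging the range of integration from [0, t] to the whole line
  -- leaves constant vectors F s, and the hypothesis applies to each of them.
  have h1 : ∀ t, ‖L t (curve ν x₀ F t)‖ₑ ≤ ‖L t x₀‖ₑ + ∫⁻ s, ‖L t (F s)‖ₑ ∂ν := by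
    intro t
    rw [curve, map_add, ← ContinuousLinearMap.intervalIntegral_comp_comm _ hF.intervalIntegrable]
    exact (enorm_add_le _ _).trans (add_le_add le_rfl (enorm_intervalIntegral_le _ 0 t))
  calc _ ≤ ∫⁻ t, (‖L t x₀‖ₑ + ∫⁻ s, ‖L t (F s)‖ₑ ∂ν) ∂μ := lintegral_mono h1
    _ = (∫⁻ t, ‖L t x₀‖ₑ ∂μ) + ∫⁻ t, ∫⁻ s, ‖L t (F s)‖ₑ ∂ν ∂μ := by
      rw [lintegral_add_left]
      exact (hL.comp (continuous_id.prodMk continuous_const)).enorm.measurable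
    _ ≤ M * ‖x₀‖ₑ + ∫⁻ s, M * ‖F s‖ₑ ∂ν := by
      refine add_le_add (hM x₀) ?_
      rw [lintegral_lintegral_swap hjoint]
      exact lintegral_mono fun s => hM (F s)
    _ = _ := by rw [lintegral_const_mul'' _ hF.1.enorm, mul_add]

/-- The linear transfer is used twice: first in the first argument with a constant second one, then
in the second argument for the operators obtained by inserting the first curve. -/
theorem lintegral_bilin_curve_le [SFinite ν] [NullSingletonClass ν] {B : ℝ → X →L[ℝ] Y →L[ℝ] Z}
    (hB : Continuous fun p : ℝ × X × Y => B p.1 p.2.1 p.2.2) {μ : Measure ℝ} [SFinite μ] {M : ℝ≥0∞}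
    (hM : ∀ x y, ∫⁻ t, ‖B t x y‖ₑ ∂μ ≤ M * ‖x‖ₑ * ‖y‖ₑ) (x₀ : X) {F : ℝ → X}
    (hF : Integrable F ν) (y₀ : Y) {G : ℝ → Y} (hG : Integrable G ν) :
    ∫⁻ t, ‖B t (curve ν x₀ F t) (curve ν y₀ G t)‖ₑ ∂μ ≤
      M * (‖x₀‖ₑ + ∫⁻ s, ‖F s‖ₑ ∂ν) * (‖y₀‖ₑ + ∫⁻ s, ‖G s‖ₑ ∂ν) := by
  refine lintegral_apply_curve_le (L := fun t => B t (curve ν x₀ F t)) ?_ (fun y => ?_) y₀ hG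
  · exact hB.comp (continuous_fst.prodMk
      (((continuous_curve x₀ hF).comp continuous_fst).prodMk continuous_snd))
  · have h := lintegral_apply_curve_le (L := fun t => (B t).flip y) (μ := μ) (M := M * ‖y‖ₑ)
      (hB.comp (continuous_fst.prodMk (continuous_snd.prodMk continuous_const)))
      (fun x => (hM x y).trans (le_of_eq (by ring))) x₀ hF
    refine h.trans (le_of_eq (by ring))

/-- The pointwise limit of a bilinear expression exists almost everywhere. -/
theorem ae_exists_tendsto_of_bounded {μ : Measure ℝ} {s : ℕ → ℝ → Z}
    (hs : ∀ n, Continuous (s n)) (hmono : ∀ t, Monotone fun n => ‖s n t‖ₑ)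
    (hlim : ∀ t, (∃ C : ℝ, ∀ n, ‖s n t‖ ≤ C) → ∃ z, Filter.Tendsto (fun n => s n t) Filter.atTop (nhds z))
    {R : ℝ≥0∞} (hR : R ≠ ∞) (hb : ∀ n, ∫⁻ t, ‖s n t‖ₑ ∂μ ≤ R) :
    ∀ᵐ t ∂μ, ∃ z, Filter.Tendsto (fun n => s n t) Filter.atTop (nhds z) := by
  have h1 : ∫⁻ t, ⨆ n, ‖s n t‖ₑ ∂μ ≤ R := by
    rw [lintegral_iSup (fun n => (hs n).enorm.measurable) (fun i j hij t => hmono t hij)]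
    exact iSup_le hb
  have h2 := ae_lt_top (Measurable.iSup fun n => (hs n).enorm.measurable)
    (ne_top_of_le_ne_top hR h1)
  filter_upwards [h2] with t ht
  refine hlim t ⟨(⨆ n, ‖s n t‖ₑ).toReal, fun n => ?_⟩
  rw [← toReal_enorm]
  exact ENNReal.toReal_mono ht.ne (le_iSup (fun n => ‖s n t‖ₑ) n)

theorem lintegral_enorm_limit_le {μ : Measure ℝ} {s : ℕ → ℝ → Z} (hs : ∀ n, Continuous (s n))
    {F : ℝ → Z} (hF : ∀ᵐ t ∂μ, Filter.Tendsto (fun n => s n t) Filter.atTop (nhds (F t)))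
    {R : ℝ≥0∞} (hb : ∀ n, ∫⁻ t, ‖s n t‖ₑ ∂μ ≤ R) : ∫⁻ t, ‖F t‖ₑ ∂μ ≤ R := by
  calc ∫⁻ t, ‖F t‖ₑ ∂μ = ∫⁻ t, Filter.liminf (fun n => ‖s n t‖ₑ) Filter.atTop ∂μ := by
        refine lintegral_congr_ae ?_
        filter_upwards [hF] with t ht
        exact ((continuous_enorm.tendsto _).comp ht).liminf_eq.symm
    _ ≤ Filter.liminf (fun n => ∫⁻ t, ‖s n t‖ₑ ∂μ) Filter.atTop :=
        lintegral_liminf_le fun n => (hs n).enorm.measurable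
    _ ≤ R := by
        refine Filter.liminf_le_of_le (by isBoundedDefault) fun b hb' => ?_
        obtain ⟨n, hn⟩ := hb'.exists
        exact hn.trans (hb n)

/-- Local solvability of `a' = lim_n B_n(t)(a, a)`, `a(0) = x₀`, where the bilinear forms `B_n(t)`
are bounded, uniformly in `n`, only after integration in time. -/
theorem exists_quadratic_solution [IsFiniteMeasure ν] [NullSingletonClass ν] {B : ℕ → ℝ → X →L[ℝ] X →L[ℝ] X}
    (hB : ∀ n, Continuous fun p : ℝ × X × X => B n p.1 p.2.1 p.2.2)
    (hmono : ∀ t x y, Monotone fun n => ‖B n t x y‖ₑ)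
    (hlim : ∀ t x y, (∃ C : ℝ, ∀ n, ‖B n t x y‖ ≤ C) →
      ∃ z, Filter.Tendsto (fun n => B n t x y) Filter.atTop (nhds z))
    {M : ℝ} (hM0 : 0 ≤ M)
    (hM : ∀ n x y, ∫⁻ t, ‖B n t x y‖ₑ ∂ν ≤ ENNReal.ofReal M * ‖x‖ₑ * ‖y‖ₑ) (x₀ : X)
    (hsmall : 8 * M * ‖x₀‖ ≤ 1) :
    ∃ F : ℝ → X, Integrable F ν ∧ ∫⁻ t, ‖F t‖ₑ ∂ν ≤ ‖x₀‖ₑ ∧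
      ∀ᵐ t ∂ν, Filter.Tendsto (fun n => B n t (curve ν x₀ F t) (curve ν x₀ F t)) Filter.atTop
        (nhds (F t)) := by
  have hBc : ∀ n {F : ℝ → X}, Integrable F ν →
      Continuous fun t => B n t (curve ν x₀ F t) (curve ν x₀ F t) := fun n F hF =>
    (hB n).comp (continuous_id.prodMk ((continuous_curve x₀ hF).prodMk (continuous_curve x₀ hF)))
  have hfin : ∀ {F : ℝ → X}, Integrable F ν → ENNReal.ofReal M * (‖x₀‖ₑ + ∫⁻ s, ‖F s‖ₑ ∂ν) *
      (‖x₀‖ₑ + ∫⁻ s, ‖F s‖ₑ ∂ν) ≠ ∞ := by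
    intro F hF
    have : ∫⁻ s, ‖F s‖ₑ ∂ν ≠ ∞ := hF.2.ne
    exact ENNReal.mul_ne_top (ENNReal.mul_ne_top ENNReal.ofReal_ne_top
      (ENNReal.add_ne_top.2 ⟨enorm_ne_top, this⟩)) (ENNReal.add_ne_top.2 ⟨enorm_ne_top, this⟩)
  have hlimae : ∀ {F : ℝ → X}, Integrable F ν → ∀ᵐ t ∂ν,
      Filter.Tendsto (fun n => B n t (curve ν x₀ F t) (curve ν x₀ F t)) Filter.atTop
        (nhds (Filter.limUnder Filter.atTop fun n => B n t (curve ν x₀ F t) (curve ν x₀ F t))) := by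
    intro F hF
    have h := ae_exists_tendsto_of_bounded (μ := ν) (hBc · hF) (fun t => hmono t _ _)
      (fun t => hlim t _ _) (hfin hF)
      (fun n => lintegral_bilin_curve_le (hB n) (hM n) x₀ hF x₀ hF)
    filter_upwards [h] with t ht
    exact tendsto_nhds_limUnder ht
  -- Where the limit does not exist the value is arbitrary; this happens only on a null set of
  -- times.
  set Φ : (ℝ → X) → ℝ → X := fun F t =>
    Filter.limUnder Filter.atTop fun n => B n t (curve ν x₀ F t) (curve ν x₀ F t) with hΦ
  have hΦb : ∀ {F : ℝ → X}, Integrable F ν → ∫⁻ t, ‖Φ F t‖ₑ ∂ν ≤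
      ENNReal.ofReal M * (‖x₀‖ₑ + ∫⁻ s, ‖F s‖ₑ ∂ν) * (‖x₀‖ₑ + ∫⁻ s, ‖F s‖ₑ ∂ν) := fun hF =>
    lintegral_enorm_limit_le (hBc · hF) (hlimae hF)
      (fun n => lintegral_bilin_curve_le (hB n) (hM n) x₀ hF x₀ hF)
  have hΦi : ∀ {F : ℝ → X}, Integrable F ν → Integrable (Φ F) ν := by
    intro F hF
    refine ⟨aestronglyMeasurable_of_tendsto_ae Filter.atTop
      (fun n => (hBc n hF).aestronglyMeasurable) (hlimae hF), ?_⟩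
    exact lt_of_le_of_lt (hΦb hF) (lt_top_iff_ne_top.2 (hfin hF))
  have hΦd : ∀ {F G : ℝ → X}, Integrable F ν → Integrable G ν →
      ∫⁻ t, ‖Φ F t - Φ G t‖ₑ ∂ν ≤ ENNReal.ofReal M * (∫⁻ s, ‖F s - G s‖ₑ ∂ν) *
        (‖x₀‖ₑ + ∫⁻ s, ‖F s‖ₑ ∂ν) +
        ENNReal.ofReal M * (‖x₀‖ₑ + ∫⁻ s, ‖G s‖ₑ ∂ν) * (∫⁻ s, ‖F s - G s‖ₑ ∂ν) := by
    intro F G hF hG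
    have hFG := hF.sub hG
    refine lintegral_enorm_limit_le (F := fun t => Φ F t - Φ G t)
      (s := fun n t => B n t (curve ν x₀ F t) (curve ν x₀ F t) -
        B n t (curve ν x₀ G t) (curve ν x₀ G t)) (fun n => (hBc n hF).sub (hBc n hG)) ?_ fun n => ?_
    · filter_upwards [hlimae hF, hlimae hG] with t h1 h2 using h1.sub h2
    -- Both curves start at x₀, so their difference is a curve from 0 with density F - G, and
    -- bilinearity gives one such factor in each term.
    · have e : ∀ t, B n t (curve ν x₀ F t) (curve ν x₀ F t) -
          B n t (curve ν x₀ G t) (curve ν x₀ G t) =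
          B n t (curve ν 0 (F - G) t) (curve ν x₀ F t) +
            B n t (curve ν x₀ G t) (curve ν 0 (F - G) t) := by
        intro t
        have h := curve_sub (ν := ν) x₀ x₀ hF hG t
        rw [sub_self] at h
        rw [← h]
        simp only [map_sub, sub_apply]
        abel
      simp only [e]
      refine (lintegral_mono fun t => enorm_add_le _ _).trans ?_
      have hc0 := continuous_curve (0 : X) hFG
      have hm : Measurable fun t => ‖B n t (curve ν 0 (F - G) t) (curve ν x₀ F t)‖ₑ :=
        ((hB n).comp (continuous_id.prodMk
          (hc0.prodMk (continuous_curve x₀ hF)))).enorm.measurable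
      rw [lintegral_add_left hm]
      refine add_le_add ?_ ?_
      · refine (lintegral_bilin_curve_le (hB n) (hM n) 0 hFG x₀ hF).trans (le_of_eq ?_)
        simp
      · refine (lintegral_bilin_curve_le (hB n) (hM n) x₀ hG 0 hFG).trans (le_of_eq ?_)
        simp
  -- the contraction
  set T : Lp X 1 ν → Lp X 1 ν := fun F =>
    (hΦi (L1.integrable_coeFn F)).toL1 (Φ F) with hT
  -- On this ball ‖x₀‖ + ‖F‖ ≤ 2‖x₀‖. Then 8M‖x₀‖ ≤ 1 yields both 4M‖x₀‖² ≤ ‖x₀‖/2, so the ball is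
  -- preserved, and the Lipschitz constant 4M‖x₀‖ ≤ 1/2.
  set S : Set (Lp X 1 ν) := Metric.closedBall 0 ‖x₀‖ with hS
  have hnorm : ∀ F : Lp X 1 ν, ∫⁻ s, ‖F s‖ₑ ∂ν = ENNReal.ofReal ‖F‖ := fun F => by
    rw [L1.norm_def, ENNReal.ofReal_toReal (L1.integrable_coeFn F).2.ne]
  have hx₀ : ‖x₀‖ₑ = ENNReal.ofReal ‖x₀‖ := (ofReal_norm _).symm
  have hsum : ∀ F ∈ S, ‖x₀‖ₑ + ∫⁻ s, ‖F s‖ₑ ∂ν ≤ ENNReal.ofReal (2 * ‖x₀‖) := by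
    intro F hF
    rw [hnorm, hx₀, ← ENNReal.ofReal_add (norm_nonneg _) (norm_nonneg _)]
    refine ENNReal.ofReal_le_ofReal ?_
    have : ‖F‖ ≤ ‖x₀‖ := by simpa [hS] using hF
    linarith
  have hTnorm : ∀ F : Lp X 1 ν, ENNReal.ofReal ‖T F‖ = ∫⁻ t, ‖Φ F t‖ₑ ∂ν := by
    intro F
    rw [← hnorm]
    refine lintegral_congr_ae ?_
    filter_upwards [(hΦi (L1.integrable_coeFn F)).coeFn_toL1] with t ht
    rw [hT]; simp only [ht]
  have hmaps : Set.MapsTo T S S := by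
    intro F hF
    have h1 : ENNReal.ofReal ‖T F‖ ≤ ENNReal.ofReal ‖x₀‖ := by
      rw [hTnorm F]
      refine (hΦb (L1.integrable_coeFn F)).trans ?_
      calc _ ≤ ENNReal.ofReal M * ENNReal.ofReal (2 * ‖x₀‖) * ENNReal.ofReal (2 * ‖x₀‖) := by
            have := hsum F hF; gcongr
        _ = ENNReal.ofReal (M * (2 * ‖x₀‖) * (2 * ‖x₀‖)) := by
            rw [← ENNReal.ofReal_mul hM0, ← ENNReal.ofReal_mul (by positivity)]
        _ ≤ _ := by
            refine ENNReal.ofReal_le_ofReal ?_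
            nlinarith [norm_nonneg x₀]
    have h2 := (ENNReal.ofReal_le_ofReal_iff (norm_nonneg _)).1 h1
    simpa [hS] using h2
  have hcontr : ContractingWith (1 / 2) (hmaps.restrict T S S) := by
    refine ⟨by norm_num [← NNReal.coe_lt_coe], ?_⟩
    refine LipschitzWith.of_dist_le_mul ?_
    rintro ⟨F, hF⟩ ⟨G, hG⟩
    simp only [Subtype.dist_eq, Set.MapsTo.val_restrict_apply]
    have h1 : ENNReal.ofReal (dist (T F) (T G)) ≤ ENNReal.ofReal ((1 / 2 : ℝ) * dist F G) := by
      rw [dist_eq_norm, dist_eq_norm, ← hnorm]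
      have e : ∫⁻ s, ‖(T F - T G) s‖ₑ ∂ν = ∫⁻ s, ‖Φ F s - Φ G s‖ₑ ∂ν := by
        refine lintegral_congr_ae ?_
        filter_upwards [Lp.coeFn_sub (T F) (T G), (hΦi (L1.integrable_coeFn F)).coeFn_toL1,
          (hΦi (L1.integrable_coeFn G)).coeFn_toL1] with t h1 h2 h3
        rw [h1, Pi.sub_apply]
        rw [hT]; simp only [h2, h3]
      have e2 : ∫⁻ s, ‖F s - G s‖ₑ ∂ν = ENNReal.ofReal ‖F - G‖ := by
        rw [← hnorm]
        refine lintegral_congr_ae ?_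
        filter_upwards [Lp.coeFn_sub F G] with t h1
        rw [h1, Pi.sub_apply]
      rw [e]
      refine (hΦd (L1.integrable_coeFn F) (L1.integrable_coeFn G)).trans ?_
      rw [e2]
      calc _ ≤ ENNReal.ofReal M * ENNReal.ofReal ‖F - G‖ * ENNReal.ofReal (2 * ‖x₀‖) +
            ENNReal.ofReal M * ENNReal.ofReal (2 * ‖x₀‖) * ENNReal.ofReal ‖F - G‖ := by
            have h1 := hsum F hF
            have h2 := hsum G hG
            gcongr
        _ = ENNReal.ofReal (M * ‖F - G‖ * (2 * ‖x₀‖) + M * (2 * ‖x₀‖) * ‖F - G‖) := by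
            rw [ENNReal.ofReal_add (by positivity) (by positivity), ← ENNReal.ofReal_mul hM0,
              ← ENNReal.ofReal_mul (by positivity), ← ENNReal.ofReal_mul hM0,
              ← ENNReal.ofReal_mul (by positivity)]
        _ ≤ _ := by
            refine ENNReal.ofReal_le_ofReal ?_
            nlinarith [norm_nonneg (F - G)]
    have := (ENNReal.ofReal_le_ofReal_iff (by positivity)).1 h1
    simpa using this
  obtain ⟨F, hFS, hFfix, -⟩ := ContractingWith.exists_fixedPoint' (x := (0 : Lp X 1 ν))
    Metric.isClosed_closedBall.isComplete hmaps hcontr (by simp [hS]) (edist_ne_top _ _)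
  have hfix : T F = F := hFfix
  have hae : F =ᵐ[ν] Φ F := by
    have h1 := (hΦi (L1.integrable_coeFn F)).coeFn_toL1
    have h2 : (F : ℝ → X) = T F := by rw [hfix]
    rw [h2]
    nth_rw 2 [hfix]
    exact h1
  refine ⟨F, L1.integrable_coeFn F, ?_, ?_⟩
  · rw [hnorm, hx₀]
    refine ENNReal.ofReal_le_ofReal ?_
    simpa [hS] using hFS
  · filter_upwards [hae, hlimae (L1.integrable_coeFn F)] with t h1 h2
    rw [h1]; exact h2

end Abstract

/-! ### Convolutions and the L⁴ norm of the inverse transform -/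

section Convolution

open scoped Convolution

variable {V : Type*} [NormedAddCommGroup V] [InnerProductSpace ℝ V] [FiniteDimensional ℝ V]
  [MeasurableSpace V] [BorelSpace V]

theorem continuous_fourier_of_integrable {φ : V → ℂ} (h : Integrable φ) : Continuous (𝓕 φ) :=
  VectorFourier.fourierIntegral_continuous Real.continuous_fourierChar continuous_inner h

theorem norm_fourierInv_le (φ : V → ℂ) (x : V) : ‖𝓕⁻ φ x‖ ≤ ∫ ξ, ‖φ ξ‖ :=
  VectorFourier.norm_fourierIntegral_le_integral_norm _ _ _ _ _

/-- The transform of the convolution is a square integrable function times a bounded one, so the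
convolution itself is in L² and both descriptions of its transform agree. -/
theorem isFT_mul_convolution {φ ψ : V → ℂ} (hφ : Integrable φ) (hφ2 : MemLp φ 2)
    (hψ : Integrable ψ) :
    IsFT (fun x => 𝓕⁻ φ x * 𝓕⁻ ψ x) (φ ⋆[ContinuousLinearMap.mul ℂ ℂ] ψ) := by
  have hc : Integrable (φ ⋆[ContinuousLinearMap.mul ℂ ℂ] ψ) := hφ.integrable_convolution _ hψ
  have h1 : ∀ x, 𝓕 (φ ⋆[ContinuousLinearMap.mul ℂ ℂ] ψ) x = 𝓕 φ x * 𝓕 ψ x := fun x =>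
    Real.fourier_mul_convolution_eq hφ hψ x
  have h2 : MemLp (𝓕 (φ ⋆[ContinuousLinearMap.mul ℂ ℂ] ψ)) 2 := by
    refine MemLp.of_le_mul (c := ∫ ξ, ‖ψ ξ‖) (memLp_fourier hφ hφ2)
      (continuous_fourier_of_integrable hc).aestronglyMeasurable
      (Filter.Eventually.of_forall fun x => ?_)
    rw [h1, norm_mul, mul_comm]
    exact mul_le_mul_of_nonneg_right
      (VectorFourier.norm_fourierIntegral_le_integral_norm _ _ _ _ _) (norm_nonneg _)
  have h3 : MemLp (φ ⋆[ContinuousLinearMap.mul ℂ ℂ] ψ) 2 :=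
    (memLp_congr_ae (ae_eq_fourierInv_of_memLp hc h2)).1 (Lp.memLp _)
  have h4 := isFT_fourierInv hc h3
  have h5 : 𝓕⁻ (φ ⋆[ContinuousLinearMap.mul ℂ ℂ] ψ) = fun x => 𝓕⁻ φ x * 𝓕⁻ ψ x := by
    ext x
    rw [Real.fourierInv_eq_fourier_neg, Real.fourierInv_eq_fourier_neg,
      Real.fourierInv_eq_fourier_neg, h1]
  rwa [h5] at h4

/-- The `L⁴` norm of the inverse Fourier transform. -/
def normFour (f : Lp ℂ 2 (volume : Measure V)) : ℝ≥0∞ :=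
  eLpNorm (𝓕⁻ f : Lp ℂ 2 (volume : Measure V)) 4 volume

theorem normFour_eq (f : Lp ℂ 2 (volume : Measure V)) :
    normFour f =
      (∫⁻ x, ‖(𝓕⁻ f : Lp ℂ 2 (volume : Measure V)) x‖ₑ ^ (4 : ℝ)) ^ (1 / 4 : ℝ) := by
  rw [normFour, eLpNorm_eq_lintegral_rpow_enorm_toReal (by norm_num) (by norm_num)]
  norm_num

/-- Plancherel turns the convolution into a product in physical space, and Hölder splits L² into L⁴
times L⁴. Phases of f and g are kept, so Strichartz remains applicable. -/
theorem eLpNorm_convolution_le {f g : Lp ℂ 2 (volume : Measure V)} (hf : Integrable f)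
    (hg : Integrable g) :
    eLpNorm (f ⋆[ContinuousLinearMap.mul ℂ ℂ] g) 2 volume ≤ normFour f * normFour g := by
  obtain ⟨H, h1, h2⟩ := isFT_mul_convolution hf (Lp.memLp f) hg
  have h3 : eLpNorm (f ⋆[ContinuousLinearMap.mul ℂ ℂ] g) 2 volume =
      eLpNorm (fun x => 𝓕⁻ (f : V → ℂ) x * 𝓕⁻ (g : V → ℂ) x) 2 volume := by
    rw [← eLpNorm_congr_ae h1, ← eLpNorm_congr_ae h2, ← Lp.enorm_def, ← Lp.enorm_def]
    exact (Lp.fourierTransformₗᵢ V ℂ).enorm_map H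
  have h4 : (fun x => 𝓕⁻ (f : V → ℂ) x * 𝓕⁻ (g : V → ℂ) x) =ᵐ[volume]
      (fun x => (𝓕⁻ f : Lp ℂ 2 (volume : Measure V)) x) •
        fun x => (𝓕⁻ g : Lp ℂ 2 (volume : Measure V)) x := by
    filter_upwards [lp_fourierInv_ae_eq f hf, lp_fourierInv_ae_eq g hg] with x h5 h6
    rw [Pi.smul_apply', h5, h6, smul_eq_mul]
  rw [h3, eLpNorm_congr_ae h4]
  have : ENNReal.HolderTriple 4 4 2 := ⟨by
    rw [← two_mul, show (4 : ℝ≥0∞) = 2 * 2 by norm_num,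
      ENNReal.mul_inv (Or.inl (by norm_num)) (Or.inl (by norm_num)), ← mul_assoc,
      ENNReal.mul_inv_cancel (by norm_num) (by norm_num), one_mul]⟩
  exact eLpNorm_smul_le_mul_eLpNorm (Lp.aestronglyMeasurable _) (Lp.aestronglyMeasurable _)

theorem strichartz_normFour (hd : Module.finrank ℝ V < 4) (f : Lp ℂ 2 (volume : Measure V))
    (hfi : Integrable f) {a h : ℝ} (hh : 0 ≤ h) :
    ∫⁻ t in Set.Icc a (a + h), normFour (mulL (ph schSymbol t) f) ^ (2 : ℝ) ≤
      ENNReal.ofReal (2 * (h ^ (1 - (Module.finrank ℝ V / 4 : ℝ)) /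
        (1 - (Module.finrank ℝ V / 4 : ℝ)))) * ‖f‖ₑ ^ (2 : ℝ) := by
  have h1 := strichartz hd f hfi (a := a) hh
  refine le_trans (le_of_eq ?_) (h1.trans (le_of_eq (by norm_num)))
  refine lintegral_congr fun t => ?_
  rw [normFour_eq, ← ENNReal.rpow_mul]
  norm_num

end Convolution

/-! ### Complex conjugation on the Fourier side -/

section Reflection

variable {V : Type*} [NormedAddCommGroup V] [InnerProductSpace ℝ V] [FiniteDimensional ℝ V]
  [MeasurableSpace V] [BorelSpace V]

theorem memLp_conj_neg {f : V → ℂ} (hf : MemLp f 2) :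
    MemLp (fun ξ => (starRingEnd ℂ) (f (-ξ))) 2 :=
  (hf.comp_measurePreserving (Measure.measurePreserving_neg volume)).star

/-- The real-linear map `f ↦ conj f(-·)`, which is complex conjugation on the Fourier side. -/
def conjRefl : Lp ℂ 2 (volume : Measure V) →L[ℝ] Lp ℂ 2 (volume : Measure V) :=
  LinearMap.mkContinuous
    { toFun := fun f => (memLp_conj_neg (Lp.memLp f)).toLp _
      map_add' := fun f g => by
        rw [← MemLp.toLp_add, MemLp.toLp_eq_toLp_iff]
        filter_upwards [(Measure.measurePreserving_neg (volume : Measure V)).quasiMeasurePreserving.ae_eq_comp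
          (Lp.coeFn_add f g)] with x hx
        simp only [Function.comp, Pi.add_apply] at hx
        simp only [hx, Pi.add_apply, map_add]
      map_smul' := fun c f => by
        rw [RingHom.id_apply, ← MemLp.toLp_const_smul, MemLp.toLp_eq_toLp_iff]
        filter_upwards [(Measure.measurePreserving_neg (volume : Measure V)).quasiMeasurePreserving.ae_eq_comp
          (Lp.coeFn_smul c f)] with x hx
        simp only [Function.comp, Pi.smul_apply] at hx
        simp only [hx, Pi.smul_apply, Complex.real_smul, map_mul, Complex.conj_ofReal] }
    1 fun f => by
      rw [one_mul]
      change ‖MemLp.toLp (fun ξ => (starRingEnd ℂ) (f (-ξ))) (memLp_conj_neg (Lp.memLp f))‖ ≤ ‖f‖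
      rw [Lp.norm_toLp, Lp.norm_def]
      refine le_of_eq (congrArg ENNReal.toReal ?_)
      rw [← eLpNorm_comp_measurePreserving (Lp.aestronglyMeasurable f)
        (Measure.measurePreserving_neg (volume : Measure V))]
      refine eLpNorm_congr_norm_ae (Filter.Eventually.of_forall fun x => ?_)
      simp

theorem conjRefl_coe (f : Lp ℂ 2 (volume : Measure V)) :
    conjRefl f =ᵐ[volume] fun ξ => (starRingEnd ℂ) (f (-ξ)) :=
  MemLp.coeFn_toLp (memLp_conj_neg (Lp.memLp f))

theorem integrable_conjRefl {f : Lp ℂ 2 (volume : Measure V)} (hf : Integrable f) :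
    Integrable (conjRefl f) := by
  have h1 : Integrable (fun ξ => f (-ξ)) := hf.comp_neg
  have h2 : Integrable (fun ξ => (starRingEnd ℂ) (f (-ξ))) :=
    (Complex.conjCLE.toContinuousLinearMap).integrable_comp h1
  exact h2.congr (conjRefl_coe f).symm

theorem fourierInv_conjRefl {f : Lp ℂ 2 (volume : Measure V)} (hf : Integrable f) :
    (𝓕⁻ (conjRefl f) : Lp ℂ 2 (volume : Measure V)) =ᵐ[volume]
      fun x => (starRingEnd ℂ) ((𝓕⁻ f : Lp ℂ 2 (volume : Measure V)) x) := by
  filter_upwards [lp_fourierInv_ae_eq _ (integrable_conjRefl hf), lp_fourierInv_ae_eq f hf]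
    with x h1 h2
  rw [h1, h2, Real.fourierInv_congr_ae (conjRefl_coe f) x, Real.fourierInv_eq,
    Real.fourierInv_eq, ← integral_conj, ← integral_neg_eq_self]
  refine integral_congr_ae (Filter.Eventually.of_forall fun ξ => ?_)
  simp only [neg_neg, Circle.smul_def, smul_eq_mul, map_mul, inner_neg_left]
  congr 1
  rw [← Circle.coe_inv_eq_conj, AddChar.map_neg_eq_inv]

theorem normFour_conjRefl {f : Lp ℂ 2 (volume : Measure V)} (hf : Integrable f) :
    normFour (conjRefl f) = normFour f := by
  rw [normFour, normFour, eLpNorm_congr_ae (fourierInv_conjRefl hf)]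
  refine eLpNorm_congr_norm_ae (Filter.Eventually.of_forall fun x => ?_)
  simp

attribute [irreducible] conjRefl

end Reflection

/-! ### Truncation to balls -/

section Cutoff

variable {V : Type*} [NormedAddCommGroup V] [MeasurableSpace V] [BorelSpace V] {μ : Measure V}

/-- The indicator function of the ball of radius `n`. -/
def cut (n : ℕ) (ξ : V) : ℂ := (Metric.closedBall (0 : V) n).indicator 1 ξ

theorem measurable_cut (n : ℕ) : Measurable (cut n : V → ℂ) :=
  measurable_one.indicator Metric.isClosed_closedBall.measurableSet

theorem norm_cut_le (n : ℕ) (ξ : V) : ‖cut n ξ‖ ≤ 1 := by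
  unfold cut
  by_cases h : ξ ∈ Metric.closedBall (0 : V) n
  · simp [Set.indicator_of_mem h]
  · simp [Set.indicator_of_notMem h]

theorem cut_of_le {n : ℕ} {ξ : V} (h : ‖ξ‖ ≤ n) : cut n ξ = 1 := by
  unfold cut
  rw [Set.indicator_of_mem (by simpa using h), Pi.one_apply]

theorem cut_of_lt {n : ℕ} {ξ : V} (h : (n : ℝ) < ‖ξ‖) : cut n ξ = 0 := by
  unfold cut
  rw [Set.indicator_of_notMem (by simpa using h)]

theorem cut_mul_cut {n m : ℕ} (h : n ≤ m) (ξ : V) : cut n ξ * cut m ξ = cut n ξ := by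
  rcases le_or_gt ‖ξ‖ n with h1 | h1
  · rw [cut_of_le h1, cut_of_le (n := m) (h1.trans (by exact_mod_cast h)), mul_one]
  · rw [cut_of_lt h1, zero_mul]

theorem eventually_cut_eq_one (ξ : V) : ∀ᶠ n : ℕ in Filter.atTop, cut n ξ = 1 := by
  obtain ⟨N, hN⟩ := exists_nat_ge ‖ξ‖
  filter_upwards [Filter.eventually_ge_atTop N] with n hn
  exact cut_of_le (hN.trans (by exact_mod_cast hn))

theorem tendsto_mulL_cut (f : Lp ℂ 2 μ) :
    Filter.Tendsto (fun n : ℕ => mulL (cut n) f) Filter.atTop (nhds f) := by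
  have key : ∀ n : ℕ, ‖mulL (cut n) f - f‖ ^ 2 = ∫ x, ‖(cut n x - 1) * f x‖ ^ 2 ∂μ := by
    intro n
    rw [norm_sq_eq_integral]
    refine integral_congr_ae ?_
    filter_upwards [Lp.coeFn_sub (mulL (cut n) f) f, mulL_coe (measurable_cut n) (norm_cut_le n) f]
      with x h1 h2
    rw [h1, Pi.sub_apply, h2, sub_mul, one_mul]
  have h0 : Filter.Tendsto (fun n : ℕ => ∫ x, ‖(cut n x - 1) * f x‖ ^ 2 ∂μ) Filter.atTop
      (nhds (∫ _, (0 : ℝ) ∂μ)) := by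
    refine tendsto_integral_of_dominated_convergence (fun x => 4 * ‖f x‖ ^ 2) ?_ ?_ ?_ ?_
    · intro n
      exact (((measurable_cut n).sub_const 1).aestronglyMeasurable.mul
        (Lp.aestronglyMeasurable f)).norm.pow 2
    · exact ((memLp_two_iff_integrable_sq_norm (Lp.aestronglyMeasurable f)).1
        (Lp.memLp f)).const_mul 4
    · intro n
      refine Filter.Eventually.of_forall fun x => ?_
      have h1 : ‖cut n x - 1‖ ≤ 2 := by
        refine (norm_sub_le _ _).trans ?_
        have := norm_cut_le n x
        simp only [norm_one]; linarith
      have h2 : ‖cut n x - 1‖ ^ 2 ≤ 4 := by nlinarith [norm_nonneg (cut n x - 1)]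
      rw [Real.norm_of_nonneg (by positivity), norm_mul, mul_pow]
      exact mul_le_mul_of_nonneg_right h2 (by positivity)
    · refine Filter.Eventually.of_forall fun x => ?_
      refine Filter.Tendsto.congr' ?_ tendsto_const_nhds
      filter_upwards [eventually_cut_eq_one x] with n hn
      simp [hn]
  simp only [integral_zero, ← key] at h0
  rw [tendsto_iff_norm_sub_tendsto_zero]
  have := h0.sqrt
  simpa [Real.sqrt_sq (norm_nonneg _)] using this

/-- On a ball, L² is contained in L¹. The truncations form the dense class on which the Strichartz
estimate is available. -/
theorem integrable_mulL_cut [IsFiniteMeasureOnCompacts μ] [ProperSpace V] (n : ℕ) (f : Lp ℂ 2 μ) :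
    Integrable (mulL (cut n) f) μ := by
  have h1 : IntegrableOn f (Metric.closedBall (0 : V) n) μ := by
    have : IsFiniteMeasure (μ.restrict (Metric.closedBall (0 : V) n)) :=
      ⟨by rw [Measure.restrict_apply_univ]; exact (isCompact_closedBall 0 _).measure_lt_top⟩
    refine MemLp.integrable (q := 2) (by norm_num) ?_
    exact (Lp.memLp f).restrict _
  have h2 := (integrable_indicator_iff Metric.isClosed_closedBall.measurableSet).2 h1
  refine h2.congr ?_
  filter_upwards [mulL_coe (measurable_cut n) (norm_cut_le n) f] with x hx
  rw [hx, cut]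
  by_cases h : x ∈ Metric.closedBall (0 : V) n
  · simp [Set.indicator_of_mem h]
  · simp [Set.indicator_of_notMem h]

end Cutoff

/-! ### Gevrey weights and products of Gevrey functions -/

section Weights

variable {d : ℕ}

theorem continuous_l1 : Continuous (l1 : Space d → ℝ) := by
  unfold l1; fun_prop

theorem norm_le_l1 (ξ : Space d) : ‖ξ‖ ≤ l1 ξ := by
  rw [EuclideanSpace.norm_eq, l1]
  refine Real.sqrt_le_iff.2 ⟨Finset.sum_nonneg fun _ _ => abs_nonneg _, ?_⟩
  simp only [Real.norm_eq_abs]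
  exact Finset.sum_sq_le_sq_sum_of_nonneg fun _ _ => abs_nonneg _

theorem l1_nonneg (ξ : Space d) : 0 ≤ l1 ξ := Finset.sum_nonneg fun _ _ => abs_nonneg _

/-- `e^{σ‖2πξ‖}`. -/
def wt (σ : ℝ) (ξ : Space d) : ℝ := Real.exp (σ * l1 ((2 * Real.pi) • ξ))

/-- `e^{-σ‖2πξ‖}`. -/
def decay (σ : ℝ) (ξ : Space d) : ℂ := (Real.exp (-(σ * l1 ((2 * Real.pi) • ξ))) : ℝ)

/-- `⟨2πξ⟩`. -/
def brk (ξ : Space d) : ℝ := bracket ‖(2 * Real.pi) • ξ‖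

/-- `⟨2πξ⟩⁻¹`. -/
def brkInv (ξ : Space d) : ℂ := ((brk ξ)⁻¹ : ℝ)

theorem wt_pos (σ : ℝ) (ξ : Space d) : 0 < wt σ ξ := Real.exp_pos _

theorem wt_mul_decay (σ : ℝ) (ξ : Space d) : (wt σ ξ : ℂ) * decay σ ξ = 1 := by
  rw [wt, decay, ← Complex.ofReal_mul, ← Real.exp_add, add_neg_cancel, Real.exp_zero,
    Complex.ofReal_one]

theorem continuous_wt (σ : ℝ) : Continuous (wt σ : Space d → ℝ) := by
  unfold wt
  exact Real.continuous_exp.comp (continuous_const.mul (continuous_l1.comp (by fun_prop)))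

theorem continuous_decay (σ : ℝ) : Continuous (decay σ : Space d → ℂ) := by
  unfold decay
  exact Complex.continuous_ofReal.comp (Real.continuous_exp.comp
    (continuous_const.mul (continuous_l1.comp (by fun_prop))).neg)

theorem norm_decay (σ : ℝ) (ξ : Space d) :
    ‖decay σ ξ‖ = Real.exp (-(σ * l1 ((2 * Real.pi) • ξ))) := by
  rw [decay, Complex.norm_real, Real.norm_of_nonneg (Real.exp_pos _).le]

theorem one_le_bracket (r : ℝ) : 1 ≤ bracket r := by
  rw [bracket, Real.one_le_sqrt]; nlinarith [sq_nonneg r]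

theorem bracket_pos (r : ℝ) : 0 < bracket r := one_pos.trans_le (one_le_bracket r)

theorem continuous_bracket : Continuous bracket := by unfold bracket; fun_prop

theorem one_le_brk (ξ : Space d) : 1 ≤ brk ξ := one_le_bracket _

theorem brk_pos (ξ : Space d) : 0 < brk ξ := bracket_pos _

theorem continuous_brk : Continuous (brk : Space d → ℝ) :=
  continuous_bracket.comp (by fun_prop)

theorem continuous_brkInv : Continuous (brkInv : Space d → ℂ) :=
  Complex.continuous_ofReal.comp (continuous_brk.inv₀ fun ξ => (brk_pos ξ).ne')

theorem norm_brkInv (ξ : Space d) : ‖brkInv ξ‖ = (brk ξ)⁻¹ := by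
  rw [brkInv, Complex.norm_real, Real.norm_of_nonneg (inv_nonneg.2 (brk_pos ξ).le)]

theorem norm_brkInv_le (ξ : Space d) : ‖brkInv ξ‖ ≤ 1 := by
  rw [norm_brkInv]; exact inv_le_one_of_one_le₀ (one_le_brk ξ)

theorem brk_mul_brkInv (ξ : Space d) : (brk ξ : ℂ) * brkInv ξ = 1 := by
  rw [brkInv, ← Complex.ofReal_mul, mul_inv_cancel₀ (brk_pos ξ).ne', Complex.ofReal_one]

theorem decay_le (σ : ℝ) (hσ : 0 ≤ σ) (ξ : Space d) :
    ‖decay σ ξ‖ ≤ Real.exp (-(σ * ‖ξ‖)) := by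
  rw [norm_decay, Real.exp_le_exp, neg_le_neg_iff]
  refine mul_le_mul_of_nonneg_left (le_trans ?_ (norm_le_l1 _)) hσ
  rw [norm_smul, Real.norm_of_nonneg (by positivity)]
  nlinarith [Real.pi_gt_three, norm_nonneg ξ]

theorem norm_decay_le {σ : ℝ} (hσ : 0 ≤ σ) (ξ : Space d) : ‖decay σ ξ‖ ≤ 1 := by
  rw [norm_decay, Real.exp_le_one_iff]
  nlinarith [l1_nonneg ((2 * Real.pi) • ξ), mul_nonneg hσ (l1_nonneg ((2 * Real.pi) • ξ))]

theorem exists_exp_neg_le {c : ℝ} (hc : 0 < c) (n : ℕ) :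
    ∃ C : ℝ, ∀ r : ℝ, 0 ≤ r → Real.exp (-(c * r)) ≤ C * (1 + r) ^ (-(n : ℝ)) := by
  refine ⟨n.factorial * Real.exp c / c ^ n, fun r hr => ?_⟩
  have h1 : (c * (1 + r)) ^ n / n.factorial ≤ Real.exp (c * (1 + r)) :=
    Real.pow_div_factorial_le_exp _ (by positivity) n
  have hf : (0 : ℝ) < n.factorial := by exact_mod_cast Nat.factorial_pos n
  rw [Real.rpow_neg (by linarith), Real.rpow_natCast, ← div_eq_mul_inv, div_div,
    le_div_iff₀ (by positivity), ← mul_pow]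
  rw [div_le_iff₀ hf] at h1
  calc Real.exp (-(c * r)) * (c * (1 + r)) ^ n
      ≤ Real.exp (-(c * r)) * (Real.exp (c * (1 + r)) * n.factorial) :=
        mul_le_mul_of_nonneg_left h1 (Real.exp_pos _).le
    _ = n.factorial * Real.exp c := by
        rw [← mul_assoc, ← Real.exp_add, mul_comm]; congr 2; ring

/-- A basic use of σ > 0: by Cauchy–Schwarz, e^{-σ‖2πξ‖} f is integrable for every f in L². Gevrey
functions are therefore bounded, and their products stay in L². -/
theorem memLp_decay {σ : ℝ} (hσ : 0 < σ) : MemLp (decay σ : Space d → ℂ) 2 := by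
  rw [memLp_two_iff_integrable_sq_norm (continuous_decay σ).aestronglyMeasurable]
  obtain ⟨C, hC⟩ := exists_exp_neg_le (c := 2 * σ) (by linarith) (d + 1)
  have h1 : Integrable (fun x : Space d => C * (1 + ‖x‖) ^ (-((d + 1 : ℕ) : ℝ))) := by
    refine (integrable_one_add_norm ?_).const_mul C
    simp
  refine h1.mono' ((continuous_decay σ).norm.pow 2).aestronglyMeasurable
    (Filter.Eventually.of_forall fun ξ => ?_)
  refine le_trans ?_ (hC ‖ξ‖ (norm_nonneg _))
  rw [Real.norm_of_nonneg (by positivity)]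
  calc ‖decay σ ξ‖ ^ 2 ≤ Real.exp (-(σ * ‖ξ‖)) ^ 2 :=
        pow_le_pow_left₀ (norm_nonneg _) (decay_le σ hσ.le ξ) 2
    _ = _ := by rw [← Real.exp_nat_mul]; congr 1; push_cast; ring

variable (σ : ℝ) [hσ : Fact (0 < σ)]

theorem mulL_decay_coe (f : L2 d) :
    mulL (decay σ) f =ᵐ[volume] fun ξ => decay σ ξ * f ξ :=
  mulL_coe (continuous_decay σ).measurable (norm_decay_le hσ.out.le) f

/-- The `L²` norm of `e^{-σ‖2πξ‖}`. -/
def decayNorm (d : ℕ) : ℝ := (eLpNorm (decay σ : Space d → ℂ) 2 volume).toReal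

theorem integrable_mulL_decay (f : L2 d) : Integrable (mulL (decay σ) f) :=
  (MemLp.integrable_mul (memLp_decay hσ.out) (Lp.memLp f)).congr (mulL_decay_coe σ f).symm

theorem integral_norm_mulL_decay_le (f : L2 d) :
    ∫ ξ, ‖(mulL (decay σ) f : L2 d) ξ‖ ≤ decayNorm σ d * ‖f‖ := by
  have h1 : ∫⁻ ξ, ‖(mulL (decay σ) f : L2 d) ξ‖ₑ ≤
      eLpNorm (decay σ : Space d → ℂ) 2 volume * eLpNorm f 2 volume := by
    rw [← eLpNorm_one_eq_lintegral_enorm, eLpNorm_congr_ae (mulL_decay_coe σ f)]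
    have h := eLpNorm_smul_le_mul_eLpNorm (p := 2) (q := 2) (r := 1)
      (Lp.aestronglyMeasurable f) (continuous_decay (d := d) σ).aestronglyMeasurable
    exact h
  rw [integral_norm_eq_lintegral_enorm (Lp.aestronglyMeasurable _), decayNorm, Lp.norm_def,
    ← ENNReal.toReal_mul]
  exact ENNReal.toReal_mono (ENNReal.mul_ne_top (memLp_decay hσ.out).2.ne (Lp.memLp f).2.ne) h1

/-- The inverse Fourier transform of `e^{-σ‖2πξ‖} f`. -/
def phys (f : L2 d) : L2 d := 𝓕⁻ (mulL (decay σ) f)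

theorem phys_add (f g : L2 d) : phys σ (f + g) = phys σ f + phys σ g := by
  rw [phys, map_add, fourierInv_add]; rfl

theorem phys_smul (c : ℂ) (f : L2 d) : phys σ (c • f) = c • phys σ f := by
  rw [phys, map_smul, fourierInv_smul]; rfl

theorem norm_phys_le (f : L2 d) : ‖phys σ f‖ ≤ ‖f‖ := by
  have h1 : ‖phys σ f‖ = ‖mulL (decay σ) f‖ :=
    (Lp.fourierTransformₗᵢ (Space d) ℂ).symm.norm_map _
  rw [h1]
  simpa using norm_mulL_le (continuous_decay σ).measurable (norm_decay_le hσ.out.le) f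

theorem ae_norm_phys_le (f : L2 d) : ∀ᵐ x, ‖phys σ f x‖ ≤ decayNorm σ d * ‖f‖ := by
  filter_upwards [lp_fourierInv_ae_eq _ (integrable_mulL_decay σ f)] with x hx
  rw [phys, hx]
  exact (norm_fourierInv_le _ x).trans (integral_norm_mulL_decay_le σ f)

theorem memLp_phys_mul (f g : L2 d) : MemLp (fun x => phys σ f x * phys σ g x) 2 := by
  refine MemLp.of_le_mul (c := decayNorm σ d * ‖f‖) (Lp.memLp (phys σ g))
    ((Lp.aestronglyMeasurable _).mul (Lp.aestronglyMeasurable _)) ?_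
  filter_upwards [ae_norm_phys_le σ f] with x hx
  rw [norm_mul]
  exact mul_le_mul_of_nonneg_right hx (norm_nonneg _)

/-- The product of `phys σ f` and `phys σ g`, as a bounded bilinear map on `L²`. -/
def prodL : L2 d →L[ℂ] L2 d →L[ℂ] L2 d :=
  LinearMap.mkContinuous₂
    (LinearMap.mk₂ ℂ (fun f g => (memLp_phys_mul σ f g).toLp _)
      (fun f f' g => by
        rw [← MemLp.toLp_add, MemLp.toLp_eq_toLp_iff, phys_add]
        filter_upwards [Lp.coeFn_add (phys σ f) (phys σ f')] with x hx
        simp only [hx, Pi.add_apply, add_mul])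
      (fun c f g => by
        rw [← MemLp.toLp_const_smul, MemLp.toLp_eq_toLp_iff, phys_smul]
        filter_upwards [Lp.coeFn_smul c (phys σ f)] with x hx
        simp only [hx, Pi.smul_apply, smul_eq_mul, mul_assoc])
      (fun f g g' => by
        rw [← MemLp.toLp_add, MemLp.toLp_eq_toLp_iff, phys_add]
        filter_upwards [Lp.coeFn_add (phys σ g) (phys σ g')] with x hx
        simp only [hx, Pi.add_apply, mul_add])
      (fun c f g => by
        rw [← MemLp.toLp_const_smul, MemLp.toLp_eq_toLp_iff, phys_smul]
        filter_upwards [Lp.coeFn_smul c (phys σ g)] with x hx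
        simp only [hx, Pi.smul_apply, smul_eq_mul, mul_left_comm]))
    (decayNorm σ d) fun f g => by
      have h : ‖(memLp_phys_mul σ f g).toLp _‖ ≤ decayNorm σ d * ‖f‖ * ‖phys σ g‖ := by
        refine Lp.norm_le_mul_norm_of_ae_le_mul ?_
        filter_upwards [ae_norm_phys_le σ f, (memLp_phys_mul σ f g).coeFn_toLp] with x hx h2
        rw [h2, norm_mul]
        exact mul_le_mul_of_nonneg_right hx (norm_nonneg _)
      exact h.trans (mul_le_mul_of_nonneg_left (norm_phys_le σ g)
        (mul_nonneg ENNReal.toReal_nonneg (norm_nonneg _)))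

theorem prodL_coe (f g : L2 d) : prodL σ f g =ᵐ[volume] fun x => phys σ f x * phys σ g x :=
  (memLp_phys_mul σ f g).coeFn_toLp

/-- The Fourier transform of `phys σ f * phys σ g`. -/
def cv : L2 d →L[ℂ] L2 d →L[ℂ] L2 d :=
  ((ContinuousLinearMap.compL ℂ (L2 d) (L2 d) (L2 d))
    ((Lp.fourierTransformₗᵢ (Space d) ℂ).toLinearIsometry.toContinuousLinearMap)).comp (prodL σ)

theorem cv_apply (f g : L2 d) : cv σ f g = 𝓕 (prodL σ f g) := rfl

open scoped Convolution in
theorem cv_coe (f g : L2 d) :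
    cv σ f g =ᵐ[volume] (fun ξ => decay σ ξ * f ξ) ⋆[ContinuousLinearMap.mul ℂ ℂ]
      (fun ξ => decay σ ξ * g ξ) := by
  have hf := integrable_mulL_decay σ f
  have hg := integrable_mulL_decay σ g
  obtain ⟨H, h1, h2⟩ := isFT_mul_convolution hf (Lp.memLp _) hg
  rw [convolution_congr _ (mulL_decay_coe σ f) (mulL_decay_coe σ g)] at h2
  have h3 : prodL σ f g = H := by
    refine Lp.ext ?_
    filter_upwards [prodL_coe σ f g, h1, lp_fourierInv_ae_eq _ hf, lp_fourierInv_ae_eq _ hg]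
      with x h4 h5 h6 h7
    rw [h4, h5, phys, phys, h6, h7]
  rw [cv_apply, h3]
  exact h2

attribute [irreducible] prodL cv

end Weights

/-! ### Replacing the Gevrey weight by exponentials of linear forms -/

section SignVectors

variable {d : ℕ}

/-- The linear form `∑ ± ξ_i` with the signs `ε`. -/
def signDot (ε : Fin d → Bool) (ξ : Space d) : ℝ := ∑ i, (if ε i then ξ i else -ξ i)

theorem signDot_add (ε : Fin d → Bool) (ξ η : Space d) :
    signDot ε (ξ + η) = signDot ε ξ + signDot ε η := by
  simp only [signDot, ← Finset.sum_add_distrib]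
  refine Finset.sum_congr rfl fun i _ => ?_
  split_ifs <;> simp [add_comm]

theorem signDot_neg (ε : Fin d → Bool) (ξ : Space d) :
    signDot ε (-ξ) = signDot (fun i => !ε i) ξ := by
  simp only [signDot]
  refine Finset.sum_congr rfl fun i _ => ?_
  cases ε i <;> simp

theorem continuous_signDot (ε : Fin d → Bool) : Continuous (signDot ε) := by
  unfold signDot
  refine continuous_finsetSum _ fun i _ => ?_
  split_ifs <;> fun_prop

theorem signDot_le_l1 (ε : Fin d → Bool) (ξ : Space d) : signDot ε ξ ≤ l1 ξ := by
  refine Finset.sum_le_sum fun i _ => ?_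
  split_ifs
  · exact le_abs_self _
  · exact neg_le_abs _

theorem exists_signDot_eq_l1 (ξ : Space d) : ∃ ε : Fin d → Bool, signDot ε ξ = l1 ξ := by
  refine ⟨fun i => decide (0 ≤ ξ i), Finset.sum_congr rfl fun i _ => ?_⟩
  by_cases h : 0 ≤ ξ i
  · simp [h, abs_of_nonneg h]
  · simp [h, abs_of_neg (not_le.1 h)]

/-- `e^{σ ε·2πξ}`. -/
def signExp (σ : ℝ) (ε : Fin d → Bool) (ξ : Space d) : ℝ :=
  Real.exp (σ * signDot ε ((2 * Real.pi) • ξ))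

theorem signExp_add (σ : ℝ) (ε : Fin d → Bool) (ξ η : Space d) :
    signExp σ ε (ξ + η) = signExp σ ε ξ * signExp σ ε η := by
  rw [signExp, smul_add, signDot_add, mul_add, Real.exp_add, signExp, signExp]

/-- ‖ξ‖ is the largest of the 2^d linear forms ε·ξ. The exponential of a linear form is
multiplicative, whereas the triangle inequality for ‖ξ‖ would put absolute values inside the
convolution. -/
theorem wt_le_sum_signExp (σ : ℝ) (ξ : Space d) :
    wt σ ξ ≤ ∑ ε : Fin d → Bool, signExp σ ε ξ := by
  obtain ⟨ε, hε⟩ := exists_signDot_eq_l1 ((2 * Real.pi) • ξ)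
  rw [wt, ← hε]
  exact Finset.single_le_sum (f := fun ε => signExp σ ε ξ) (fun _ _ => (Real.exp_pos _).le)
    (Finset.mem_univ ε)

/-- `e^{σ (ε·2πξ - ‖2πξ‖)}`. -/
def tilt (σ : ℝ) (ε : Fin d → Bool) (ξ : Space d) : ℂ := (signExp σ ε ξ : ℂ) * decay σ ξ

theorem measurable_tilt (σ : ℝ) (ε : Fin d → Bool) : Measurable (tilt σ ε) := by
  have h1 : Continuous (signExp σ ε) := Real.continuous_exp.comp
    (continuous_const.mul ((continuous_signDot ε).comp (by fun_prop)))
  exact ((Complex.continuous_ofReal.comp h1).mul (continuous_decay σ)).measurable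

theorem norm_tilt_le {σ : ℝ} (hσ : 0 ≤ σ) (ε : Fin d → Bool) (ξ : Space d) : ‖tilt σ ε ξ‖ ≤ 1 := by
  rw [tilt, norm_mul, norm_decay, Complex.norm_real, signExp, Real.norm_of_nonneg (Real.exp_pos _).le,
    ← Real.exp_add, Real.exp_le_one_iff]
  have := mul_le_mul_of_nonneg_left (signDot_le_l1 ε ((2 * Real.pi) • ξ)) hσ
  linarith

theorem decay_neg (σ : ℝ) (ξ : Space d) : decay σ (-ξ) = decay σ ξ := by
  simp [decay, l1]

theorem conj_tilt_neg (σ : ℝ) (ε : Fin d → Bool) (ξ : Space d) :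
    (starRingEnd ℂ) (tilt σ ε (-ξ)) = tilt σ (fun i => !ε i) ξ := by
  rw [tilt, decay_neg, map_mul, Complex.conj_ofReal, tilt, decay, Complex.conj_ofReal, signExp,
    smul_neg, signDot_neg, signExp]

end SignVectors

/-! ### Algebra of multipliers -/

section Commute

variable {V : Type*} [MeasurableSpace V] {μ : Measure V}

theorem integrable_mulL {m : V → ℂ} (hm : Measurable m) {C : ℝ} (hC : ∀ x, ‖m x‖ ≤ C)
    {f : Lp ℂ 2 μ} (hf : Integrable f μ) : Integrable (mulL m f) μ :=
  (hf.bdd_mul hm.aestronglyMeasurable (Filter.Eventually.of_forall hC)).congr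
    (mulL_coe hm hC f).symm

theorem mulL_comm {m m' : V → ℂ} (hm : Measurable m) {C : ℝ} (hC : ∀ x, ‖m x‖ ≤ C)
    (hm' : Measurable m') {C' : ℝ} (hC' : ∀ x, ‖m' x‖ ≤ C') (f : Lp ℂ 2 μ) :
    mulL m (mulL m' f) = mulL m' (mulL m f) := by
  refine Lp.ext ?_
  filter_upwards [mulL_coe hm hC (mulL m' f), mulL_coe hm hC f, mulL_coe hm' hC' (mulL m f),
    mulL_coe hm' hC' f] with x h1 h2 h3 h4
  rw [h1, h3, h2, h4]; ring

theorem enorm_mulL_le {m : V → ℂ} (hm : Measurable m) (hC : ∀ x, ‖m x‖ ≤ 1)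
    (f : Lp ℂ 2 μ) : ‖mulL m f‖ₑ ≤ ‖f‖ₑ := by
  have := norm_mulL_le hm hC f
  rw [one_mul] at this
  exact enorm_le_iff_norm_le.2 this

theorem mulL_mulL {m m' : V → ℂ} (hm : Measurable m) {C : ℝ} (hC : ∀ x, ‖m x‖ ≤ C)
    (hm' : Measurable m') {C' : ℝ} (hC' : ∀ x, ‖m' x‖ ≤ C') (f : Lp ℂ 2 μ) :
    mulL m (mulL m' f) = mulL (fun x => m x * m' x) f := by
  have hb : ∀ x, ‖m x * m' x‖ ≤ C * C' := fun x => by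
    rw [norm_mul]
    exact mul_le_mul (hC x) (hC' x) (norm_nonneg _) ((norm_nonneg _).trans (hC x))
  refine Lp.ext ?_
  filter_upwards [mulL_coe hm hC (mulL m' f), mulL_coe hm' hC' f, mulL_coe (m := fun x => m x * m' x) (hm.mul hm') hb f]
    with x h1 h2 h3
  rw [h1, h2, h3]; exact (mul_assoc _ _ _).symm

end Commute

/-! ### The weighted product estimate -/

section Key

variable {d : ℕ} (σ : ℝ) [hσ : Fact (0 < σ)]

theorem mulL_tilt_coe (ε : Fin d → Bool) (f : L2 d) :
    mulL (tilt σ ε) f =ᵐ[volume] fun ξ => (signExp σ ε ξ : ℂ) * (decay σ ξ * f ξ) := by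
  filter_upwards [mulL_coe (measurable_tilt σ ε) (norm_tilt_le hσ.out.le ε) f] with ξ h
  rw [h, tilt, mul_assoc]

-- An exact identity, since ε·ξ = ε·η + ε·(ξ - η). The remaining factor e^{σ(ε·ξ - ‖ξ‖)} on each
-- input is a real multiplier bounded by 1, which is harmless for Strichartz.
open scoped Convolution in
theorem signExp_mul_convolution (ε : Fin d → Bool) (f g : L2 d) (ξ : Space d) :
    (signExp σ ε ξ : ℂ) * ((fun ξ => decay σ ξ * f ξ) ⋆[ContinuousLinearMap.mul ℂ ℂ]
      (fun ξ => decay σ ξ * g ξ)) ξ =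
      ((mulL (tilt σ ε) f : L2 d) ⋆[ContinuousLinearMap.mul ℂ ℂ] (mulL (tilt σ ε) g : L2 d)) ξ := by
  rw [convolution_congr _ (mulL_tilt_coe σ ε f) (mulL_tilt_coe σ ε g), convolution, convolution,
    ← integral_const_mul]
  refine integral_congr_ae (Filter.Eventually.of_forall fun η => ?_)
  simp only [ContinuousLinearMap.mul_apply']
  have h1 : signExp σ ε ξ = signExp σ ε η * signExp σ ε (ξ - η) := by
    rw [← signExp_add, add_sub_cancel]
  rw [h1]
  push_cast
  ring

open scoped Convolution in
/-- The weighted product estimate. -/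
theorem enorm_mulL_cv_le {m : Space d → ℂ} (hm : Measurable m) {C : ℝ} (hC : ∀ x, ‖m x‖ ≤ C)
    (hw : ∀ ξ, ‖m ξ‖ ≤ wt σ ξ) {f g : L2 d} (hf : Integrable f) (hg : Integrable g) :
    ‖mulL m (cv σ f g)‖ₑ ≤ ∑ ε : Fin d → Bool,
      normFour (mulL (tilt σ ε) f) * normFour (mulL (tilt σ ε) g) := by
  have hT : ∀ ε (h : L2 d), Integrable h → Integrable (mulL (tilt σ ε) h : L2 d) := fun ε h hh =>
    integrable_mulL (measurable_tilt σ ε) (norm_tilt_le hσ.out.le ε) hh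
  set c : (Fin d → Bool) → Space d → ℂ := fun ε =>
    (mulL (tilt σ ε) f : L2 d) ⋆[ContinuousLinearMap.mul ℂ ℂ] (mulL (tilt σ ε) g : L2 d) with hc
  have h1 : ‖mulL m (cv σ f g)‖ₑ ≤ eLpNorm (∑ ε : Fin d → Bool, fun ξ => ‖c ε ξ‖) 2 volume := by
    rw [Lp.enorm_def]
    refine eLpNorm_mono_ae_real ?_
    filter_upwards [mulL_coe hm hC (cv σ f g), cv_coe σ f g] with ξ h2 h3
    rw [h2, h3, norm_mul, Finset.sum_apply]
    refine (mul_le_mul_of_nonneg_right ((hw ξ).trans (wt_le_sum_signExp σ ξ))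
      (norm_nonneg _)).trans (le_of_eq ?_)
    rw [Finset.sum_mul]
    refine Finset.sum_congr rfl fun ε _ => ?_
    rw [hc]
    simp only
    rw [← signExp_mul_convolution, norm_mul, Complex.norm_real,
      Real.norm_of_nonneg (show 0 ≤ signExp σ ε ξ from (Real.exp_pos _).le)]
  refine h1.trans ((eLpNorm_sum_le (fun ε _ => ?_) (by norm_num)).trans
    (Finset.sum_le_sum fun ε _ => ?_))
  · exact ((hT ε f hf).integrable_convolution (ContinuousLinearMap.mul ℂ ℂ)
      (hT ε g hg)).aestronglyMeasurable.norm
  · rw [eLpNorm_norm]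
    exact eLpNorm_convolution_le (hT ε f hf) (hT ε g hg)

/-- Reflection reverses the sign vector. As all sign vectors obey the same bounds, the conjugate of
u in |u|² is estimated like u itself. -/
theorem mulL_tilt_conjRefl (ε : Fin d → Bool) (f : L2 d) :
    mulL (tilt σ ε) (conjRefl f) = conjRefl (mulL (tilt σ fun i => !ε i) f) := by
  refine Lp.ext ?_
  filter_upwards [mulL_coe (measurable_tilt σ ε) (norm_tilt_le hσ.out.le ε) (conjRefl f),
    conjRefl_coe f, conjRefl_coe (mulL (tilt σ fun i => !ε i) f),
    (Measure.measurePreserving_neg (volume : Measure (Space d))).quasiMeasurePreserving.ae_eq_comp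
      (mulL_coe (measurable_tilt σ fun i => !ε i) (norm_tilt_le hσ.out.le fun i => !ε i) f)]
    with ξ h1 h2 h3 h4
  simp only [Function.comp] at h4
  rw [h1, h2, h3, h4, map_mul, conj_tilt_neg]
  simp

end Key

/-! ### The embedding of H¹ in L⁴ -/

section Sobolev

variable {d : ℕ}

theorem integrable_brk_rpow (hd : d < 4) : Integrable (fun ξ : Space d => (brk ξ) ^ (-4 : ℝ)) := by
  have h1 : Integrable (fun x : Space d => (1 + ‖x‖ ^ 2) ^ (-(4 : ℝ) / 2)) := by
    refine integrable_rpow_neg_one_add_norm_sq ?_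
    simpa using (by exact_mod_cast hd : (d : ℝ) < 4)
  refine h1.mono' ((continuous_brk.rpow_const fun ξ =>
    Or.inl (brk_pos ξ).ne').aestronglyMeasurable) (Filter.Eventually.of_forall fun ξ => ?_)
  rw [Real.norm_of_nonneg (Real.rpow_nonneg (brk_pos ξ).le _), brk, bracket, Real.sqrt_eq_rpow,
    ← Real.rpow_mul (by positivity)]
  rw [show (1 / 2 * (-4) : ℝ) = -(4 : ℝ) / 2 by norm_num]
  refine Real.rpow_le_rpow_of_nonpos (by positivity) ?_ (by norm_num)
  have : ‖ξ‖ ≤ ‖(2 * Real.pi) • ξ‖ := by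
    rw [norm_smul, Real.norm_of_nonneg (by positivity)]
    nlinarith [Real.pi_gt_three, norm_nonneg ξ]
  nlinarith [norm_nonneg ξ]

/-- By Hausdorff–Young it suffices to bound ⟨ξ⟩⁻¹ f in L^{4/3}. Hölder with the exponents 3 and 3/2
reduces this to ⟨ξ⟩⁻¹ ∈ L⁴, that is, d < 4. -/
theorem exists_normFour_brkInv_le (hd : d < 4) :
    ∃ C : ℝ≥0, ∀ f : L2 d, normFour (mulL brkInv f) ≤ C * ‖f‖ₑ := by
  set J : ℝ≥0∞ := ∫⁻ ξ : Space d, ‖brkInv ξ‖ₑ ^ (4 : ℝ) with hJ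
  have hJt : J ≠ ∞ := by
    have h := (integrable_brk_rpow hd).2
    rw [hasFiniteIntegral_iff_enorm] at h
    refine (lt_of_eq_of_lt (lintegral_congr fun ξ => ?_) h).ne
    rw [← ofReal_norm, ← ofReal_norm, norm_brkInv, Real.norm_of_nonneg
      (Real.rpow_nonneg (brk_pos ξ).le _), Real.rpow_neg (brk_pos ξ).le,
      ENNReal.ofReal_rpow_of_nonneg (inv_nonneg.2 (brk_pos ξ).le) (by norm_num),
      Real.inv_rpow (brk_pos ξ).le]
  refine ⟨(J ^ (1 / 4 : ℝ)).toNNReal, fun f => ?_⟩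
  rw [ENNReal.coe_toNNReal (ENNReal.rpow_ne_top_of_nonneg (by norm_num) hJt)]
  have h1 := (isFT_inv_coe (mulL brkInv f)).hausdorff_young
  have h2 : ∫⁻ ξ, ‖(mulL brkInv f : L2 d) ξ‖ₑ ^ (4 / 3 : ℝ) ≤
      J ^ (1 / 3 : ℝ) * (‖f‖ₑ ^ (2 : ℝ)) ^ (2 / 3 : ℝ) := by
    have h3 := ENNReal.lintegral_mul_le_Lp_mul_Lq (volume : Measure (Space d))
      ((Real.holderConjugate_iff (p := 3) (q := 3 / 2)).2 ⟨by norm_num, by norm_num⟩)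
      (f := fun ξ => ‖brkInv ξ‖ₑ ^ (4 / 3 : ℝ)) (g := fun ξ => ‖f ξ‖ₑ ^ (4 / 3 : ℝ))
      (continuous_brkInv.enorm.measurable.pow_const _).aemeasurable
      ((Lp.aestronglyMeasurable f).enorm.pow_const _)
    simp only [← ENNReal.rpow_mul] at h3
    norm_num at h3
    have h4 : ‖f‖ₑ ^ (2 : ℝ) = ∫⁻ ξ, ‖f ξ‖ₑ ^ (2 : ℝ) := by
      rw [Lp.enorm_def, eLpNorm_eq_lintegral_rpow_enorm_toReal (by norm_num) (by norm_num),
        ← ENNReal.rpow_mul]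
      norm_num
    rw [h4]
    have h5 : ∫⁻ ξ, ‖(mulL brkInv f : L2 d) ξ‖ₑ ^ (4 / 3 : ℝ) =
        ∫⁻ ξ, ‖brkInv ξ‖ₑ ^ (4 / 3 : ℝ) * ‖f ξ‖ₑ ^ (4 / 3 : ℝ) := by
      refine lintegral_congr_ae ?_
      filter_upwards [mulL_coe continuous_brkInv.measurable norm_brkInv_le f] with ξ h
      rw [h, enorm_mul, ENNReal.mul_rpow_of_nonneg _ _ (by norm_num)]
    rw [h5, hJ]
    norm_num
    exact h3
  rw [normFour_eq]
  calc _ ≤ ((J ^ (1 / 3 : ℝ) * (‖f‖ₑ ^ (2 : ℝ)) ^ (2 / 3 : ℝ)) ^ (3 : ℝ)) ^ (1 / 4 : ℝ) := by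
        gcongr
        exact h1.trans (ENNReal.rpow_le_rpow h2 (by norm_num))
    _ = J ^ (1 / 4 : ℝ) * ‖f‖ₑ := by
        rw [ENNReal.mul_rpow_of_nonneg _ _ (by norm_num), ENNReal.mul_rpow_of_nonneg _ _ (by norm_num)]
        simp only [← ENNReal.rpow_mul]
        norm_num

end Sobolev

/-! ### Measurability of the L⁴ norm in time -/

section Measurability

variable {V : Type*} [NormedAddCommGroup V] [InnerProductSpace ℝ V] [FiniteDimensional ℝ V]
  [MeasurableSpace V] [BorelSpace V]

/-- The L⁴ norm is not continuous on L², but Fatou along an almost everywhere convergent subsequence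
makes it lower semicontinuous. That suffices for measurability along continuous curves. -/
theorem isClosed_normFour_le (c : ℝ≥0∞) :
    IsClosed {f : Lp ℂ 2 (volume : Measure V) | normFour f ≤ c} := by
  refine IsSeqClosed.isClosed fun f g hf hfg => ?_
  have h1 : Filter.Tendsto (fun n => (𝓕⁻ (f n) : Lp ℂ 2 (volume : Measure V))) Filter.atTop
      (nhds (𝓕⁻ g)) :=
    ((Lp.fourierTransformₗᵢ V ℂ).symm.continuous.tendsto g).comp hfg
  obtain ⟨ns, -, h3⟩ := (tendstoInMeasure_of_tendsto_Lp h1).exists_seq_tendsto_ae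
  refine (Lp.eLpNorm_lim_le_liminf_eLpNorm (fun n => Lp.aestronglyMeasurable _) _ h3).trans ?_
  exact Filter.liminf_le_of_le (by isBoundedDefault) fun b hb => by
    obtain ⟨n, hn⟩ := hb.exists
    exact hn.trans (hf (ns n))

theorem measurable_normFour_comp {G : ℝ → Lp ℂ 2 (volume : Measure V)} (hG : Continuous G) :
    Measurable fun t => normFour (G t) :=
  measurable_of_Iic fun c => ((isClosed_normFour_le c).preimage hG).measurableSet

end Measurability

/-! ### The bilinear estimate in time and space -/

section Bilinear

variable {d : ℕ} (σ : ℝ) [hσ : Fact (0 < σ)]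

theorem continuous_cv {T : Type*} [TopologicalSpace T] {f g : T → L2 d} (hf : Continuous f)
    (hg : Continuous g) : Continuous fun t => cv σ (f t) (g t) :=
  ((cv σ).continuous.comp hf).clm_apply hg

/-- The weighted product estimate at each time, then Cauchy–Schwarz in time for each of the 2^d sign
vectors. -/
theorem lintegral_mulL_cv_le_of_integrable {P Q : ℝ → L2 d} (hP : Continuous P) (hQ : Continuous Q)
    (hPi : ∀ t, Integrable (P t)) (hQi : ∀ t, Integrable (Q t)) {μ : Measure ℝ} {A B : ℝ≥0∞}
    (hPA : ∀ ε, ∫⁻ t, normFour (mulL (tilt σ ε) (P t)) ^ (2 : ℝ) ∂μ ≤ A ^ (2 : ℝ))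
    (hQB : ∀ ε, ∫⁻ t, normFour (mulL (tilt σ ε) (Q t)) ^ (2 : ℝ) ∂μ ≤ B ^ (2 : ℝ))
    {m : Space d → ℂ} (hm : Measurable m) {C : ℝ} (hC : ∀ x, ‖m x‖ ≤ C)
    (hw : ∀ ξ, ‖m ξ‖ ≤ wt σ ξ) :
    ∫⁻ t, ‖mulL m (cv σ (P t) (Q t))‖ₑ ∂μ ≤ 2 ^ d * (A * B) := by
  have hmeas : ∀ ε {R : ℝ → L2 d}, Continuous R →
      Measurable fun t => normFour (mulL (tilt σ ε) (R t)) := fun ε R hR =>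
    measurable_normFour_comp ((mulL (tilt σ ε)).continuous.comp hR)
  calc _ ≤ ∫⁻ t, ∑ ε : Fin d → Bool,
        normFour (mulL (tilt σ ε) (P t)) * normFour (mulL (tilt σ ε) (Q t)) ∂μ :=
        lintegral_mono fun t => enorm_mulL_cv_le σ hm hC hw (hPi t) (hQi t)
    _ = ∑ ε : Fin d → Bool, ∫⁻ t,
        normFour (mulL (tilt σ ε) (P t)) * normFour (mulL (tilt σ ε) (Q t)) ∂μ :=
        lintegral_finsetSum _ fun ε _ => (hmeas ε hP).mul (hmeas ε hQ)
    _ ≤ ∑ _ε : Fin d → Bool, A * B := by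
        refine Finset.sum_le_sum fun ε _ => ?_
        refine (ENNReal.lintegral_mul_le_Lp_mul_Lq μ Real.HolderConjugate.two_two
          (hmeas ε hP).aemeasurable (hmeas ε hQ).aemeasurable).trans ?_
        have h2 : ∀ X : ℝ≥0∞, (X ^ (2 : ℝ)) ^ (1 / 2 : ℝ) = X := fun X => by
          rw [← ENNReal.rpow_mul]; norm_num
        refine mul_le_mul' ?_ ?_
        · exact (ENNReal.rpow_le_rpow (hPA ε) (by norm_num)).trans (h2 A).le
        · exact (ENNReal.rpow_le_rpow (hQB ε) (by norm_num)).trans (h2 B).le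
    _ = _ := by simp

theorem enorm_mulL_cut_le {V : Type*} [NormedAddCommGroup V] [MeasurableSpace V] [BorelSpace V]
    {μ : Measure V} (n : ℕ) (f : Lp ℂ 2 μ) : ‖mulL (cut n) f‖ₑ ≤ ‖f‖ₑ :=
  enorm_mulL_le (measurable_cut n) (norm_cut_le n) f

/-- Truncation supplies integrable approximations. Since m is bounded, the integrand is continuous
in the arguments at each fixed time, and Fatou passes to the limit. The bound does not involve the
size of m, so m may later exhaust the full weight. -/
theorem lintegral_mulL_cv_le {P Q : ℝ → L2 d →L[ℝ] L2 d}
    (hP : ∀ f, Continuous fun t => P t f) (hQ : ∀ f, Continuous fun t => Q t f)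
    (hPi : ∀ t (f : L2 d), Integrable f → Integrable (P t f))
    (hQi : ∀ t (f : L2 d), Integrable f → Integrable (Q t f)) {μ : Measure ℝ} {A : ℝ≥0∞}
    (hPA : ∀ ε (f : L2 d), Integrable f →
      ∫⁻ t, normFour (mulL (tilt σ ε) (P t f)) ^ (2 : ℝ) ∂μ ≤ (A * ‖f‖ₑ) ^ (2 : ℝ))
    (hQA : ∀ ε (f : L2 d), Integrable f →
      ∫⁻ t, normFour (mulL (tilt σ ε) (Q t f)) ^ (2 : ℝ) ∂μ ≤ (A * ‖f‖ₑ) ^ (2 : ℝ))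
    {m : Space d → ℂ} (hm : Measurable m) {C : ℝ} (hC : ∀ x, ‖m x‖ ≤ C)
    (hw : ∀ ξ, ‖m ξ‖ ≤ wt σ ξ) (f g : L2 d) :
    ∫⁻ t, ‖mulL m (cv σ (P t f) (Q t g))‖ₑ ∂μ ≤ 2 ^ d * A ^ 2 * ‖f‖ₑ * ‖g‖ₑ := by
  have hcont : ∀ f g : L2 d, Continuous fun t => mulL m (cv σ (P t f) (Q t g)) := fun f g =>
    (mulL m).continuous.comp (continuous_cv σ (hP f) (hQ g))
  refine lintegral_enorm_limit_le (μ := μ)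
    (s := fun n t => mulL m (cv σ (P t (mulL (cut n) f)) (Q t (mulL (cut n) g))))
    (fun n => hcont _ _) (Filter.Eventually.of_forall fun t => ?_) fun n => ?_
  · have h1 : Continuous fun p : L2 d × L2 d => mulL m (cv σ (P t p.1) (Q t p.2)) :=
      (mulL m).continuous.comp (continuous_cv σ ((P t).continuous.comp continuous_fst)
        ((Q t).continuous.comp continuous_snd))
    have h2 : Filter.Tendsto (fun n => ((mulL (cut n) f, mulL (cut n) g) : L2 d × L2 d))
        Filter.atTop (nhds (f, g)) := (tendsto_mulL_cut f).prodMk_nhds (tendsto_mulL_cut g)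
    have h3 := (h1.tendsto (f, g)).comp h2
    exact h3
  · have hf := integrable_mulL_cut n f
    have hg := integrable_mulL_cut n g
    refine (lintegral_mulL_cv_le_of_integrable σ (hP _) (hQ _) (fun t => hPi t _ hf)
      (fun t => hQi t _ hg) (fun ε => hPA ε _ hf) (fun ε => hQA ε _ hg) hm hC hw).trans ?_
    calc _ ≤ 2 ^ d * ((A * ‖f‖ₑ) * (A * ‖g‖ₑ)) := by
          gcongr <;> exact enorm_mulL_cut_le n _
      _ = _ := by ring

end Bilinear

/-! ### The linear flows in L²_t L⁴_x -/

section Flows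

theorem continuous_family_apply {T Y Z : Type*} [TopologicalSpace T] [NormedAddCommGroup Y]
    [NormedSpace ℝ Y] [NormedAddCommGroup Z] [NormedSpace ℝ Z] {P : ℝ → Y →L[ℝ] Z}
    (hP : Continuous fun p : ℝ × Y => P p.1 p.2) {a : T → ℝ} {f : T → Y} (ha : Continuous a)
    (hf : Continuous f) : Continuous fun t => P (a t) (f t) :=
  hP.comp (ha.prodMk hf)

variable {d : ℕ}

/-- The Schrödinger flow on the Fourier side. -/
def flowS (t : ℝ) : L2 d →L[ℝ] L2 d := (mulL (ph schSymbol t)).restrictScalars ℝ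

/-- The conjugate of the Schrödinger flow on the Fourier side. -/
def flowR (t : ℝ) : L2 d →L[ℝ] L2 d := conjRefl.comp (flowS t)

/-- The flow with the symbol `q`, followed by `⟨D⟩⁻¹`, on the Fourier side. -/
def flowQ (q : Space d → ℝ) (t : ℝ) : L2 d →L[ℝ] L2 d :=
  ((mulL brkInv).comp (mulL (ph q t))).restrictScalars ℝ

theorem flowS_apply (t : ℝ) (f : L2 d) : flowS t f = mulL (ph schSymbol t) f := rfl

theorem flowR_apply (t : ℝ) (f : L2 d) : flowR t f = conjRefl (mulL (ph schSymbol t) f) := rfl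

theorem flowQ_apply (q : Space d → ℝ) (t : ℝ) (f : L2 d) :
    flowQ q t f = mulL brkInv (mulL (ph q t) f) := rfl

theorem continuous_flowS : Continuous fun p : ℝ × L2 d => flowS p.1 p.2 :=
  continuous_mulL_ph measurable_schSymbol

theorem continuous_flowR : Continuous fun p : ℝ × L2 d => flowR p.1 p.2 :=
  conjRefl.continuous.comp (continuous_mulL_ph measurable_schSymbol)

theorem continuous_flowQ {q : Space d → ℝ} (hq : Measurable q) :
    Continuous fun p : ℝ × L2 d => flowQ q p.1 p.2 :=
  (mulL brkInv).continuous.comp (continuous_mulL_ph hq)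

theorem integrable_flowS (t : ℝ) (f : L2 d) (hf : Integrable f) : Integrable (flowS t f) :=
  integrable_mulL (measurable_ph measurable_schSymbol t) (norm_ph_le _ t) hf

theorem integrable_flowR (t : ℝ) (f : L2 d) (hf : Integrable f) : Integrable (flowR t f) :=
  integrable_conjRefl (integrable_flowS t f hf)

theorem integrable_flowQ {q : Space d → ℝ} (hq : Measurable q) (t : ℝ) (f : L2 d)
    (hf : Integrable f) : Integrable (flowQ q t f) :=
  integrable_mulL continuous_brkInv.measurable norm_brkInv_le
    (integrable_mulL (measurable_ph hq t) (norm_ph_le _ t) hf)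

/-- The smoothing exponent `1 - d/4`. -/
def smoothExp (d : ℕ) : ℝ := 1 - (d : ℝ) / 4

theorem smoothExp_pos (hd : d < 4) : 0 < smoothExp d := by
  have : (d : ℝ) < 4 := by exact_mod_cast hd
  rw [smoothExp]; linarith

theorem smoothExp_le_one : smoothExp d ≤ 1 := by
  rw [smoothExp]; linarith [Nat.cast_nonneg (α := ℝ) d]

attribute [irreducible] flowS flowR flowQ

variable (d) in
/-- A constant for the estimates of the flows in `L²_t L⁴_x`. -/
def FlowBound (A : ℝ) : Prop :=
  0 < A ∧ ∀ σ : ℝ, 0 < σ → ∀ (ε : Fin d → Bool) (f : L2 d), Integrable f → ∀ a h : ℝ, 0 ≤ h → h ≤ 1 →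
    (∫⁻ t in Set.Icc a (a + h), normFour (mulL (tilt σ ε) (flowS t f)) ^ (2 : ℝ) ≤
      ENNReal.ofReal (A * h ^ smoothExp d) * ‖f‖ₑ ^ (2 : ℝ)) ∧
    (∫⁻ t in Set.Icc a (a + h), normFour (mulL (tilt σ ε) (flowR t f)) ^ (2 : ℝ) ≤
      ENNReal.ofReal (A * h ^ smoothExp d) * ‖f‖ₑ ^ (2 : ℝ)) ∧
    ∀ q : Space d → ℝ, Measurable q →
    ∫⁻ t in Set.Icc a (a + h), normFour (mulL (tilt σ ε) (flowQ q t f)) ^ (2 : ℝ) ≤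
      ENNReal.ofReal (A * h ^ smoothExp d) * ‖f‖ₑ ^ (2 : ℝ)

/-- Tilts commute with the flows and contract L², so the constant depends neither on σ nor on the
signs. The Schrödinger flow is bounded by Strichartz and its conjugate by reflection. The wave flows
need only Sobolev at each time: their factor h is at most h^{1-d/4} for h ≤ 1. -/
theorem exists_flowBound (hd : d < 4) : ∃ A, FlowBound d A := by
  obtain ⟨C, hC⟩ := exists_normFour_brkInv_le hd
  have hα := smoothExp_pos hd
  refine ⟨2 / smoothExp d + C ^ 2, by positivity, fun σ hσ ε f hf a h hh0 hh1 => ?_⟩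
  have : Fact (0 < σ) := ⟨hσ⟩
  have hfr : Module.finrank ℝ (Space d) = d := by simp
  have hmt := fun ε => measurable_tilt σ (d := d) ε
  have hnt := fun ε => norm_tilt_le hσ.le (d := d) ε
  have hS : ∀ ε, ∫⁻ t in Set.Icc a (a + h), normFour (mulL (tilt σ ε) (flowS t f)) ^ (2 : ℝ) ≤
      ENNReal.ofReal ((2 / smoothExp d + C ^ 2) * h ^ smoothExp d) * ‖f‖ₑ ^ (2 : ℝ) := by
    intro ε
    have h1 := strichartz_normFour (by rw [hfr]; exact hd) (mulL (tilt σ ε) f)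
      (integrable_mulL (hmt ε) (hnt ε) hf) (a := a) hh0
    simp only [flowS_apply, mulL_comm (hmt ε) (hnt ε) (measurable_ph measurable_schSymbol _)
      (norm_ph_le schSymbol _)]
    refine h1.trans (mul_le_mul' (ENNReal.ofReal_le_ofReal ?_)
      (ENNReal.rpow_le_rpow (enorm_mulL_le (hmt ε) (hnt ε) f) (by norm_num)))
    rw [hfr]
    change 2 * (h ^ smoothExp d / smoothExp d) ≤ _
    have : 0 ≤ h ^ smoothExp d := Real.rpow_nonneg hh0 _
    rw [add_mul]
    have h3 : 2 * (h ^ smoothExp d / smoothExp d) = 2 / smoothExp d * h ^ smoothExp d := by ring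
    nlinarith [sq_nonneg (C : ℝ), mul_nonneg (sq_nonneg (C : ℝ)) this]
  refine ⟨hS ε, ?_, fun q hq => ?_⟩
  · refine le_trans (le_of_eq (lintegral_congr fun t => ?_)) (hS fun i => !ε i)
    rw [flowR_apply, mulL_tilt_conjRefl, ← flowS_apply, normFour_conjRefl]
    exact integrable_mulL (hmt _) (hnt _) (integrable_flowS t f hf)
  · have h1 : ∀ t, normFour (mulL (tilt σ ε) (flowQ q t f)) ≤ C * ‖f‖ₑ := by
      intro t
      rw [flowQ_apply, mulL_comm (hmt ε) (hnt ε) continuous_brkInv.measurable norm_brkInv_le]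
      refine (hC _).trans (mul_le_mul' le_rfl ((enorm_mulL_le (hmt ε) (hnt ε) _).trans ?_))
      exact enorm_mulL_le (measurable_ph hq t) (norm_ph_le q t) f
    calc _ ≤ ∫⁻ _t in Set.Icc a (a + h), (C * ‖f‖ₑ) ^ (2 : ℝ) :=
          lintegral_mono fun t => ENNReal.rpow_le_rpow (h1 t) (by norm_num)
      _ = ENNReal.ofReal (C ^ 2 * h) * ‖f‖ₑ ^ (2 : ℝ) := by
          rw [setLIntegral_const, Real.volume_Icc, ENNReal.mul_rpow_of_nonneg _ _ (by norm_num),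
            add_sub_cancel_left, ENNReal.ofReal_mul (by positivity), ENNReal.ofReal_pow (by simp),
            ENNReal.ofReal_coe_nnreal, ENNReal.rpow_ofNat]
          ring
      _ ≤ _ := by
          refine mul_le_mul' (ENNReal.ofReal_le_ofReal ?_) le_rfl
          have h2 : h ≤ h ^ smoothExp d := by
            rcases hh0.eq_or_lt with rfl | h3
            · rw [Real.zero_rpow hα.ne']
            · simpa using Real.rpow_le_rpow_of_exponent_ge h3 hh1 (smoothExp_le_one (d := d))
          have h3 : 0 ≤ h ^ smoothExp d := Real.rpow_nonneg hh0 _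
          have h4 : 0 ≤ 2 / smoothExp d := by positivity
          nlinarith [sq_nonneg (C : ℝ), mul_nonneg h4 h3, mul_le_mul_of_nonneg_left h2 (sq_nonneg (C : ℝ))]

end Flows

/-! ### Bilinear terms and truncated weights -/

section Nonlinearity

variable {d : ℕ} (σ : ℝ) [hσ : Fact (0 < σ)]
  {Y : Type*} [NormedAddCommGroup Y] [NormedSpace ℝ Y]

/-- The bilinear map `c e^{-itq} (P f * Q g)`. -/
def bil (c : ℂ) (q : Space d → ℝ) (P : ℝ → L2 d →L[ℝ] L2 d) (Q : ℝ → Y →L[ℝ] L2 d) (t : ℝ) :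
    L2 d →L[ℝ] Y →L[ℝ] L2 d :=
  (ContinuousLinearMap.compL ℝ Y (L2 d) (L2 d)
    ((c • mulL (ph q (-t)) : L2 d →L[ℂ] L2 d).restrictScalars ℝ)).comp
      (((cv σ).bilinearRestrictScalars ℝ).bilinearComp (P t) (Q t))

theorem bil_apply (c : ℂ) (q : Space d → ℝ) (P : ℝ → L2 d →L[ℝ] L2 d) (Q : ℝ → Y →L[ℝ] L2 d)
    (t : ℝ) (x : L2 d) (y : Y) :
    bil σ c q P Q t x y = c • mulL (ph q (-t)) (cv σ (P t x) (Q t y)) := rfl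

theorem continuous_bil (c : ℂ) {q : Space d → ℝ} (hq : Measurable q) {P : ℝ → L2 d →L[ℝ] L2 d}
    {Q : ℝ → Y →L[ℝ] L2 d} (hP : Continuous fun p : ℝ × L2 d => P p.1 p.2)
    (hQ : Continuous fun p : ℝ × Y => Q p.1 p.2) :
    Continuous fun p : ℝ × L2 d × Y => bil σ c q P Q p.1 p.2.1 p.2.2 := by
  simp only [bil_apply]
  refine Continuous.const_smul ?_ c
  refine (continuous_mulL_ph hq).comp ((continuous_fst.neg).prodMk ?_)
  exact continuous_cv σ (continuous_family_apply hP continuous_fst continuous_snd.fst)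
    (continuous_family_apply hQ continuous_fst continuous_snd.snd)

/-- The truncated weight. -/
def wcut (n : ℕ) (ξ : Space d) : ℂ := cut n ξ * (wt σ ξ : ℂ)

theorem measurable_wcut (n : ℕ) : Measurable (wcut σ n : Space d → ℂ) :=
  (measurable_cut n).mul (Complex.measurable_ofReal.comp (continuous_wt σ).measurable)

theorem norm_wcut_le (n : ℕ) (ξ : Space d) : ‖wcut σ n ξ‖ ≤ wt σ ξ := by
  rw [wcut, norm_mul, Complex.norm_real, Real.norm_of_nonneg (wt_pos σ ξ).le]
  exact mul_le_of_le_one_left (wt_pos σ ξ).le (norm_cut_le n ξ)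

variable (d) in
theorem exists_norm_wcut_le (n : ℕ) : ∃ C : ℝ, ∀ ξ : Space d, ‖wcut σ n ξ‖ ≤ C := by
  obtain ⟨C, hC⟩ := (isCompact_closedBall (0 : Space d) n).exists_bound_of_continuousOn
    (continuous_wt σ).continuousOn
  refine ⟨max C 0, fun ξ => ?_⟩
  rcases le_or_gt ‖ξ‖ n with h | h
  · refine (norm_wcut_le σ n ξ).trans (le_trans ?_ (le_max_left _ _))
    exact (le_abs_self _).trans (hC ξ (by simpa using h))
  · rw [wcut, cut_of_lt h, zero_mul, norm_zero]; exact le_max_right _ _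

theorem mulL_wcut_coe (n : ℕ) (f : L2 d) :
    mulL (wcut σ n) f =ᵐ[volume] fun ξ => wcut σ n ξ * f ξ := by
  obtain ⟨C, hC⟩ := exists_norm_wcut_le d σ n
  exact mulL_coe (measurable_wcut σ n) hC f

/-- The outer phase commutes with the weight and is isometric, so it does not affect the size of the
term. -/
theorem enorm_mulL_wcut_bil (n : ℕ) (c : ℂ) {q : Space d → ℝ} (hq : Measurable q)
    (P : ℝ → L2 d →L[ℝ] L2 d) (Q : ℝ → Y →L[ℝ] L2 d) (t : ℝ) (x : L2 d) (y : Y) :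
    ‖mulL (wcut σ n) (bil σ c q P Q t x y)‖ₑ =
      ‖c‖ₑ * ‖mulL (wcut σ n) (cv σ (P t x) (Q t y))‖ₑ := by
  obtain ⟨C, hC⟩ := exists_norm_wcut_le d σ n
  rw [bil_apply, map_smul, enorm_smul, mulL_comm (measurable_wcut σ n) hC (measurable_ph hq _)
    (norm_ph_le q _)]
  congr 1
  rw [enorm_eq_iff_norm_eq, norm_mulL_ph hq]

theorem mulL_wcut_eq_mulL_cut {n m : ℕ} (h : n ≤ m) (f : L2 d) :
    mulL (wcut σ n) f = mulL (cut n) (mulL (wcut σ m) f) := by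
  refine Lp.ext ?_
  filter_upwards [mulL_wcut_coe σ n f, mulL_wcut_coe σ m f,
    mulL_coe (measurable_cut n) (norm_cut_le n) (mulL (wcut σ m) f)] with ξ h1 h2 h3
  rw [h1, h3, h2, wcut, wcut, ← mul_assoc, ← mul_assoc, cut_mul_cut h]

theorem monotone_enorm_mulL_wcut (f : L2 d) : Monotone fun n => ‖mulL (wcut σ n) f‖ₑ := by
  intro n m h
  simp only
  rw [mulL_wcut_eq_mulL_cut σ h]
  exact enorm_mulL_cut_le n _

theorem tendsto_wcut_coe {f F : L2 d} (h : (fun ξ => (wt σ ξ : ℂ) * f ξ) =ᵐ[volume] F) :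
    Filter.Tendsto (fun n => mulL (wcut σ n) f) Filter.atTop (nhds F) := by
  refine (tendsto_mulL_cut F).congr fun n => Lp.ext ?_
  filter_upwards [mulL_coe (measurable_cut n) (norm_cut_le n) F, mulL_wcut_coe σ n f, h]
    with ξ h1 h2 h3
  rw [h1, h2, ← h3, wcut, mul_assoc]

/-- If the truncations are bounded in L², Fatou puts the fully weighted function in L², and the
truncations of an L² function converge to it. -/
theorem exists_tendsto_mulL_wcut (f : L2 d) (hb : ∃ C : ℝ, ∀ n, ‖mulL (wcut σ n) f‖ ≤ C) :
    ∃ z, Filter.Tendsto (fun n => mulL (wcut σ n) f) Filter.atTop (nhds z) := by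
  obtain ⟨C, hC⟩ := hb
  have hmeas : AEStronglyMeasurable (fun ξ => (wt σ ξ : ℂ) * f ξ) volume :=
    (Complex.continuous_ofReal.comp (continuous_wt σ)).aestronglyMeasurable.mul
      (Lp.aestronglyMeasurable f)
  have h1 : eLpNorm (fun ξ => (wt σ ξ : ℂ) * f ξ) 2 volume ≤ ENNReal.ofReal C := by
    have h2 : ∀ᵐ ξ, Filter.Tendsto (fun n => (mulL (wcut σ n) f : L2 d) ξ) Filter.atTop
        (nhds ((wt σ ξ : ℂ) * f ξ)) := by
      filter_upwards [ae_all_iff.2 fun n => mulL_wcut_coe σ n f] with ξ h3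
      refine tendsto_const_nhds.congr' ?_
      filter_upwards [eventually_cut_eq_one ξ] with n hn
      rw [h3 n, wcut, hn, one_mul]
    refine (Lp.eLpNorm_lim_le_liminf_eLpNorm (fun n => Lp.aestronglyMeasurable _) _ h2).trans ?_
    refine Filter.liminf_le_of_le (by isBoundedDefault) fun b hb => ?_
    obtain ⟨n, hn⟩ := hb.exists
    refine hn.trans ?_
    rw [← Lp.enorm_def, ← ofReal_norm]
    exact ENNReal.ofReal_le_ofReal (hC n)
  have h2 : MemLp (fun ξ => (wt σ ξ : ℂ) * f ξ) 2 := ⟨hmeas, h1.trans_lt ENNReal.ofReal_lt_top⟩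
  exact ⟨h2.toLp _, tendsto_wcut_coe σ h2.coeFn_toLp.symm⟩

/-- If the truncations converge, the limit is the weighted function. -/
theorem eq_decay_of_tendsto {f F : L2 d}
    (h : Filter.Tendsto (fun n => mulL (wcut σ n) f) Filter.atTop (nhds F)) :
    f = mulL (decay σ) F := by
  have h1 := ((mulL (decay σ)).continuous.tendsto F).comp h
  refine tendsto_nhds_unique (tendsto_mulL_cut f) (h1.congr fun n => Lp.ext ?_)
  simp only [Function.comp]
  filter_upwards [mulL_decay_coe σ (mulL (wcut σ n) f), mulL_wcut_coe σ n f,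
    mulL_coe (measurable_cut n) (norm_cut_le n) f] with ξ h2 h3 h4
  rw [h2, h3, h4, wcut]
  linear_combination (cut n ξ * f ξ) * wt_mul_decay σ ξ

end Nonlinearity

/-! ### The system for the profiles -/

section System

variable {d : ℕ} (σ : ℝ) [hσ : Fact (0 < σ)]

/-- The phase function `-⟨2πξ⟩` of `n₊`. -/
def brkNeg (ξ : Space d) : ℝ := -brk ξ

theorem measurable_brk : Measurable (brk : Space d → ℝ) := continuous_brk.measurable

theorem measurable_brkNeg : Measurable (brkNeg : Space d → ℝ) := continuous_brk.neg.measurable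

/-- The linear flow of `n₊ + n₋`. -/
def flowN (t : ℝ) : L2 d × L2 d →L[ℝ] L2 d :=
  (flowQ brkNeg t).comp (ContinuousLinearMap.fst ℝ _ _) +
    (flowQ brk t).comp (ContinuousLinearMap.snd ℝ _ _)

theorem flowN_apply (t : ℝ) (y : L2 d × L2 d) :
    flowN t y = flowQ brkNeg t y.1 + flowQ brk t y.2 := rfl

theorem continuous_flowN : Continuous fun p : ℝ × L2 d × L2 d => flowN p.1 p.2 := by
  simp only [flowN_apply]
  exact (continuous_family_apply (continuous_flowQ measurable_brkNeg) continuous_fst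
    continuous_snd.fst).add
    (continuous_family_apply (continuous_flowQ measurable_brk) continuous_fst continuous_snd.snd)

/-- The nonlinearity of the equation for `u`, for profiles. -/
def nlU (t : ℝ) : L2 d →L[ℝ] L2 d × L2 d →L[ℝ] L2 d :=
  bil σ (Complex.I / 2) schSymbol flowS flowN t

/-- The nonlinearity of the equation for `n₊`, for profiles. -/
def nlP (t : ℝ) : L2 d →L[ℝ] L2 d →L[ℝ] L2 d := bil σ Complex.I brkNeg flowS flowR t

/-- The nonlinearity of the equation for `n₋`, for profiles. -/
def nlM (t : ℝ) : L2 d →L[ℝ] L2 d →L[ℝ] L2 d := bil σ (-Complex.I) brk flowS flowR t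

theorem continuous_nlU :
    Continuous fun p : ℝ × L2 d × (L2 d × L2 d) => nlU σ p.1 p.2.1 p.2.2 :=
  continuous_bil σ _ measurable_schSymbol continuous_flowS continuous_flowN

theorem continuous_nlP : Continuous fun p : ℝ × L2 d × L2 d => nlP σ p.1 p.2.1 p.2.2 :=
  continuous_bil σ _ measurable_brkNeg continuous_flowS continuous_flowR

theorem continuous_nlM : Continuous fun p : ℝ × L2 d × L2 d => nlM σ p.1 p.2.1 p.2.2 :=
  continuous_bil σ _ measurable_brk continuous_flowS continuous_flowR

theorem lintegral_flow_le {A : ℝ} (hA : FlowBound d A) {Q : ℝ → L2 d →L[ℝ] L2 d}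
    (hQ : Continuous fun p : ℝ × L2 d => Q p.1 p.2)
    (hQi : ∀ t (f : L2 d), Integrable f → Integrable (Q t f)) {a h : ℝ} (hh0 : 0 ≤ h) (hh1 : h ≤ 1)
    (hQA : ∀ ε (f : L2 d), Integrable f →
      ∫⁻ t in Set.Icc a (a + h), normFour (mulL (tilt σ ε) (Q t f)) ^ (2 : ℝ) ≤
        ENNReal.ofReal (A * h ^ smoothExp d) * ‖f‖ₑ ^ (2 : ℝ)) (n : ℕ) (f g : L2 d) :
    ∫⁻ t in Set.Icc a (a + h), ‖mulL (wcut σ n) (cv σ (flowS t f) (Q t g))‖ₑ ≤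
      ENNReal.ofReal (2 ^ d * A * h ^ smoothExp d) * ‖f‖ₑ * ‖g‖ₑ := by
  obtain ⟨C, hC⟩ := exists_norm_wcut_le d σ n
  have hpos : 0 ≤ A * h ^ smoothExp d := mul_nonneg hA.1.le (Real.rpow_nonneg hh0 _)
  have hsq : ∀ X : ℝ≥0∞, (ENNReal.ofReal (Real.sqrt (A * h ^ smoothExp d)) * X) ^ (2 : ℝ) =
      ENNReal.ofReal (A * h ^ smoothExp d) * X ^ (2 : ℝ) := fun X => by
    rw [ENNReal.mul_rpow_of_nonneg _ _ (by norm_num), ENNReal.ofReal_rpow_of_nonneg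
      (Real.sqrt_nonneg _) (by norm_num), Real.rpow_ofNat, Real.sq_sqrt hpos]
  have h1 := lintegral_mulL_cv_le σ (P := flowS) (Q := Q)
    (μ := volume.restrict (Set.Icc a (a + h)))
    (A := ENNReal.ofReal (Real.sqrt (A * h ^ smoothExp d)))
    (fun f => continuous_family_apply continuous_flowS continuous_id continuous_const)
    (fun f => continuous_family_apply hQ continuous_id continuous_const)
    integrable_flowS hQi
    (fun ε f hf => ((hA.2 σ hσ.out ε f hf a h hh0 hh1).1).trans (hsq _).ge)
    (fun ε f hf => (hQA ε f hf).trans (hsq _).ge)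
    (measurable_wcut σ n) hC (norm_wcut_le σ n) f g
  refine h1.trans (le_of_eq ?_)
  rw [← ENNReal.ofReal_pow (Real.sqrt_nonneg _), Real.sq_sqrt hpos, mul_assoc (2 ^ d : ℝ),
    ENNReal.ofReal_mul (p := 2 ^ d) (by positivity), ENNReal.ofReal_pow (p := 2) (by norm_num),
    ENNReal.ofReal_ofNat]

variable {σ}

theorem lintegral_nlU_le {A : ℝ} (hA : FlowBound d A) {a h : ℝ} (hh0 : 0 ≤ h) (hh1 : h ≤ 1)
    (n : ℕ) (f : L2 d) (g : L2 d × L2 d) :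
    ∫⁻ t in Set.Icc a (a + h), ‖mulL (wcut σ n) (nlU σ t f g)‖ₑ ≤
      ENNReal.ofReal (2 ^ d * A * h ^ smoothExp d) * ‖f‖ₑ * ‖g‖ₑ := by
  have hQ : ∀ {q : Space d → ℝ}, Measurable q → ∀ g : L2 d, ∫⁻ t in Set.Icc a (a + h),
      ‖mulL (wcut σ n) (cv σ (flowS t f) (flowQ q t g))‖ₑ ≤
      ENNReal.ofReal (2 ^ d * A * h ^ smoothExp d) * ‖f‖ₑ * ‖g‖ₑ := fun {q} hq g =>
    lintegral_flow_le σ hA (continuous_flowQ hq) (integrable_flowQ hq) hh0 hh1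
      (fun ε f hf => (hA.2 σ hσ.out ε f hf a h hh0 hh1).2.2 q hq) n f g
  have hc : ‖Complex.I / 2‖ₑ = 2⁻¹ := by
    rw [← ofReal_norm, norm_div, Complex.norm_I, Complex.norm_ofNat, one_div,
      ENNReal.ofReal_inv_of_pos (by norm_num), ENNReal.ofReal_ofNat]
  calc ∫⁻ t in Set.Icc a (a + h), ‖mulL (wcut σ n) (nlU σ t f g)‖ₑ
      ≤ ∫⁻ t in Set.Icc a (a + h), 2⁻¹ * (‖mulL (wcut σ n) (cv σ (flowS t f) (flowQ brkNeg t g.1))‖ₑ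
        + ‖mulL (wcut σ n) (cv σ (flowS t f) (flowQ brk t g.2))‖ₑ) := by
        refine lintegral_mono fun t => ?_
        simp only [nlU]
        rw [enorm_mulL_wcut_bil σ n _ measurable_schSymbol, hc, flowN_apply, map_add, map_add]
        exact mul_le_mul_right (enorm_add_le _ _) _
    _ = 2⁻¹ * ((∫⁻ t in Set.Icc a (a + h),
          ‖mulL (wcut σ n) (cv σ (flowS t f) (flowQ brkNeg t g.1))‖ₑ) +
        ∫⁻ t in Set.Icc a (a + h), ‖mulL (wcut σ n) (cv σ (flowS t f) (flowQ brk t g.2))‖ₑ) := by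
        rw [lintegral_const_mul' _ _ (by simp), lintegral_add_left]
        refine Continuous.measurable (Continuous.enorm ((mulL (wcut σ n)).continuous.comp
          (continuous_cv σ (continuous_family_apply continuous_flowS continuous_id continuous_const)
          (continuous_family_apply (continuous_flowQ measurable_brkNeg) continuous_id
            continuous_const))))
    _ ≤ 2⁻¹ * (ENNReal.ofReal (2 ^ d * A * h ^ smoothExp d) * ‖f‖ₑ * ‖g‖ₑ +
          ENNReal.ofReal (2 ^ d * A * h ^ smoothExp d) * ‖f‖ₑ * ‖g‖ₑ) := by
        refine mul_le_mul_right (add_le_add ((hQ measurable_brkNeg g.1).trans ?_)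
          ((hQ measurable_brk g.2).trans ?_)) _
        · exact mul_le_mul_right (enorm_le_iff_norm_le.2 (norm_fst_le g)) _
        · exact mul_le_mul_right (enorm_le_iff_norm_le.2 (norm_snd_le g)) _
    _ = _ := by
        rw [← two_mul, ← mul_assoc, ENNReal.inv_mul_cancel (by norm_num) (by norm_num), one_mul]

theorem lintegral_bil_flowR_le {A : ℝ} (hA : FlowBound d A) {a h : ℝ} (hh0 : 0 ≤ h) (hh1 : h ≤ 1)
    {c : ℂ} (hc : ‖c‖ = 1) {q : Space d → ℝ} (hq : Measurable q)
    (n : ℕ) (f : L2 d) (g : L2 d) :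
    ∫⁻ t in Set.Icc a (a + h), ‖mulL (wcut σ n) (bil σ c q flowS flowR t f g)‖ₑ ≤
      ENNReal.ofReal (2 ^ d * A * h ^ smoothExp d) * ‖f‖ₑ * ‖g‖ₑ := by
  have hc' : ‖c‖ₑ = 1 := by rw [← ofReal_norm, hc, ENNReal.ofReal_one]
  simp only [enorm_mulL_wcut_bil σ n c hq, hc', one_mul]
  exact lintegral_flow_le σ hA continuous_flowR integrable_flowR hh0 hh1
      (fun ε f hf => (hA.2 σ hσ.out ε f hf a h hh0 hh1).2.1) n f g

variable (σ)

theorem lintegral_nlP_le {A : ℝ} (hA : FlowBound d A) {a h : ℝ} (hh0 : 0 ≤ h) (hh1 : h ≤ 1)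
    (n : ℕ) (f : L2 d) (g : L2 d) :
    ∫⁻ t in Set.Icc a (a + h), ‖mulL (wcut σ n) (nlP σ t f g)‖ₑ ≤
      ENNReal.ofReal (2 ^ d * A * h ^ smoothExp d) * ‖f‖ₑ * ‖g‖ₑ :=
  lintegral_bil_flowR_le hA hh0 hh1 (by simp) measurable_brkNeg n f g

theorem lintegral_nlM_le {A : ℝ} (hA : FlowBound d A) {a h : ℝ} (hh0 : 0 ≤ h) (hh1 : h ≤ 1)
    (n : ℕ) (f : L2 d) (g : L2 d) :
    ∫⁻ t in Set.Icc a (a + h), ‖mulL (wcut σ n) (nlM σ t f g)‖ₑ ≤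
      ENNReal.ofReal (2 ^ d * A * h ^ smoothExp d) * ‖f‖ₑ * ‖g‖ₑ :=
  lintegral_bil_flowR_le hA hh0 hh1 (by simp) measurable_brk n f g

attribute [irreducible] nlU nlP nlM

/-- The space of the profiles of `(u, n₊, n₋)`. -/
abbrev L2Triple (d : ℕ) : Type := L2 d × L2 d × L2 d

/-- The truncated nonlinearity of the system for the profiles. -/
def sys (n : ℕ) (t : ℝ) : L2Triple d →L[ℝ] L2Triple d →L[ℝ] L2Triple d :=
  (ContinuousLinearMap.compL ℝ (L2Triple d) (L2 d) (L2Triple d)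
    ((ContinuousLinearMap.inl ℝ (L2 d) (L2 d × L2 d)).comp
      ((mulL (wcut σ n)).restrictScalars ℝ))).comp
    ((nlU σ t).bilinearComp (ContinuousLinearMap.fst ℝ _ _) (ContinuousLinearMap.snd ℝ _ _)) +
  ((ContinuousLinearMap.compL ℝ (L2Triple d) (L2 d) (L2Triple d)
    ((ContinuousLinearMap.inr ℝ (L2 d) (L2 d × L2 d)).comp
      ((ContinuousLinearMap.inl ℝ (L2 d) (L2 d)).comp
      ((mulL (wcut σ n)).restrictScalars ℝ)))).comp
    ((nlP σ t).bilinearComp (ContinuousLinearMap.fst ℝ _ _) (ContinuousLinearMap.fst ℝ _ _)) +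
  (ContinuousLinearMap.compL ℝ (L2Triple d) (L2 d) (L2Triple d)
    ((ContinuousLinearMap.inr ℝ (L2 d) (L2 d × L2 d)).comp
      ((ContinuousLinearMap.inr ℝ (L2 d) (L2 d)).comp
      ((mulL (wcut σ n)).restrictScalars ℝ)))).comp
    ((nlM σ t).bilinearComp (ContinuousLinearMap.fst ℝ _ _) (ContinuousLinearMap.fst ℝ _ _)))

theorem sys_apply (n : ℕ) (t : ℝ) (x y : L2Triple d) :
    sys σ n t x y = (mulL (wcut σ n) (nlU σ t x.1 y.2), mulL (wcut σ n) (nlP σ t x.1 y.1),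
      mulL (wcut σ n) (nlM σ t x.1 y.1)) := by
  have h : sys σ n t x y = (mulL (wcut σ n) (nlU σ t x.1 y.2), (0 : L2 d × L2 d)) +
    (((0 : L2 d), (mulL (wcut σ n) (nlP σ t x.1 y.1), (0 : L2 d))) +
      ((0 : L2 d), ((0 : L2 d), mulL (wcut σ n) (nlM σ t x.1 y.1)))) := rfl
  rw [h]
  ext1
  · simp
  · ext1 <;> simp

end System

/-! ### Existence of a profile -/

section Existence

theorem continuous_bilin_family_apply {T X Y Z : Type*} [TopologicalSpace T] [NormedAddCommGroup X]
    [NormedSpace ℝ X] [NormedAddCommGroup Y] [NormedSpace ℝ Y] [NormedAddCommGroup Z]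
    [NormedSpace ℝ Z] {N : ℝ → X →L[ℝ] Y →L[ℝ] Z}
    (hN : Continuous fun p : ℝ × X × Y => N p.1 p.2.1 p.2.2) (L : Z → Z) (hL : Continuous L)
    {a : T → ℝ} {f : T → X} {g : T → Y} (ha : Continuous a) (hf : Continuous f)
    (hg : Continuous g) : Continuous fun t => L (N (a t) (f t) (g t)) :=
  hL.comp (hN.comp (ha.prodMk (hf.prodMk hg)))

variable {d : ℕ}

theorem enorm_triple_le (x : L2Triple d) : ‖x‖ₑ ≤ ‖x.1‖ₑ + (‖x.2.1‖ₑ + ‖x.2.2‖ₑ) := by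
  simp only [← ofReal_norm]
  rw [← ENNReal.ofReal_add (norm_nonneg _) (norm_nonneg _),
    ← ENNReal.ofReal_add (norm_nonneg _) (by positivity)]
  refine ENNReal.ofReal_le_ofReal ?_
  rw [Prod.norm_def, Prod.norm_def]
  exact (max_le_add_of_nonneg (norm_nonneg _) (by positivity)).trans
    (add_le_add le_rfl (max_le_add_of_nonneg (norm_nonneg _) (norm_nonneg _)))

theorem curve_clm {X Y : Type*} [NormedAddCommGroup X] [NormedSpace ℝ X] [CompleteSpace X]
    [NormedAddCommGroup Y] [NormedSpace ℝ Y] [CompleteSpace Y] (L : X →L[ℝ] Y) {ν : Measure ℝ}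
    (x₀ : X) {F : ℝ → X} (hF : Integrable F ν) (t : ℝ) :
    L (curve ν x₀ F t) = curve ν (L x₀) (fun s => L (F s)) t := by
  rw [curve, curve, map_add, ← ContinuousLinearMap.intervalIntegral_comp_comm _
    hF.intervalIntegrable]

variable (σ : ℝ) [hσ : Fact (0 < σ)]

/-- `t ↦ x₀ + ∫₀ᵗ F` is a mild solution of the system for the profiles, with a bound for `F`. -/
structure IsProfile (δ B : ℝ) (x₀ : L2Triple d) (F : ℝ → L2Triple d) : Prop where
  integrable : Integrable F (volume.restrict (Set.Icc 0 δ))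
  eqU : ∀ᵐ t ∂(volume.restrict (Set.Icc 0 δ)),
    nlU σ t (curve (volume.restrict (Set.Icc 0 δ)) x₀ F t).1
      (curve (volume.restrict (Set.Icc 0 δ)) x₀ F t).2 = mulL (decay σ) (F t).1
  eqP : ∀ᵐ t ∂(volume.restrict (Set.Icc 0 δ)),
    nlP σ t (curve (volume.restrict (Set.Icc 0 δ)) x₀ F t).1
      (curve (volume.restrict (Set.Icc 0 δ)) x₀ F t).1 = mulL (decay σ) (F t).2.1
  eqM : ∀ᵐ t ∂(volume.restrict (Set.Icc 0 δ)),
    nlM σ t (curve (volume.restrict (Set.Icc 0 δ)) x₀ F t).1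
      (curve (volume.restrict (Set.Icc 0 δ)) x₀ F t).1 = mulL (decay σ) (F t).2.2
  -- Windows of every length are needed for the Bourgain norms. The factor is the size of the
  -- Schrödinger datum alone, because every nonlinear term contains u.
  bound : ∀ s h : ℝ, 0 ≤ h → h ≤ 1 →
    ∫⁻ t in Set.Icc s (s + h), ‖F t‖ₑ ∂(volume.restrict (Set.Icc 0 δ)) ≤
      ENNReal.ofReal (B * h ^ smoothExp d) * ‖x₀.1‖ₑ

theorem continuous_sys (n : ℕ) :
    Continuous fun p : ℝ × L2Triple d × L2Triple d => sys σ n p.1 p.2.1 p.2.2 := by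
  simp only [sys_apply]
  refine Continuous.prodMk ?_ (Continuous.prodMk ?_ ?_)
  · exact continuous_bilin_family_apply (continuous_nlU σ) _ (mulL (wcut σ n)).continuous
      continuous_fst continuous_snd.fst.fst continuous_snd.snd.snd
  · exact continuous_bilin_family_apply (continuous_nlP σ) _ (mulL (wcut σ n)).continuous
      continuous_fst continuous_snd.fst.fst continuous_snd.snd.fst
  · exact continuous_bilin_family_apply (continuous_nlM σ) _ (mulL (wcut σ n)).continuous
      continuous_fst continuous_snd.fst.fst continuous_snd.snd.fst

theorem monotone_enorm_sys (t : ℝ) (x y : L2Triple d) : Monotone fun n => ‖sys σ n t x y‖ₑ := by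
  intro n m h
  have key : ∀ f : L2 d, ‖mulL (wcut σ n) f‖ ≤ ‖mulL (wcut σ m) f‖ := fun f =>
    enorm_le_iff_norm_le.1 (monotone_enorm_mulL_wcut σ f h)
  refine enorm_le_iff_norm_le.2 ?_
  rw [sys_apply, sys_apply]
  exact max_le_max (key _) (max_le_max (key _) (key _))

theorem exists_tendsto_sys (t : ℝ) (x y : L2Triple d) (h : ∃ C : ℝ, ∀ n, ‖sys σ n t x y‖ ≤ C) :
    ∃ z, Filter.Tendsto (fun n => sys σ n t x y) Filter.atTop (nhds z) := by
  obtain ⟨C, hC⟩ := h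
  simp only [sys_apply] at hC ⊢
  obtain ⟨z1, h1⟩ := exists_tendsto_mulL_wcut σ (nlU σ t x.1 y.2)
    ⟨C, fun n => (norm_fst_le _).trans (hC n)⟩
  obtain ⟨z2, h2⟩ := exists_tendsto_mulL_wcut σ (nlP σ t x.1 y.1)
    ⟨C, fun n => (norm_fst_le _).trans ((norm_snd_le _).trans (hC n))⟩
  obtain ⟨z3, h3⟩ := exists_tendsto_mulL_wcut σ (nlM σ t x.1 y.1)
    ⟨C, fun n => (norm_snd_le _).trans ((norm_snd_le _).trans (hC n))⟩
  exact ⟨(z1, z2, z3), h1.prodMk_nhds (h2.prodMk_nhds h3)⟩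

theorem lintegral_sys_le {A : ℝ} (hA : FlowBound d A) {a h : ℝ} (hh0 : 0 ≤ h) (hh1 : h ≤ 1)
    (n : ℕ) (x y : L2Triple d) :
    ∫⁻ t in Set.Icc a (a + h), ‖sys σ n t x y‖ₑ ≤
      ENNReal.ofReal (3 * (2 ^ d * A * h ^ smoothExp d)) * ‖x‖ₑ * ‖y‖ₑ := by
  set R := ENNReal.ofReal (2 ^ d * A * h ^ smoothExp d) with hR
  have hx1 : ‖x.1‖ₑ ≤ ‖x‖ₑ := enorm_le_iff_norm_le.2 (norm_fst_le x)
  have hy1 : ‖y.1‖ₑ ≤ ‖y‖ₑ := enorm_le_iff_norm_le.2 (norm_fst_le y)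
  have hy2 : ‖y.2‖ₑ ≤ ‖y‖ₑ := enorm_le_iff_norm_le.2 (norm_snd_le y)
  have hc := fun n => (continuous_sys σ (d := d) n).comp
    (continuous_id.prodMk (continuous_const (y := (x, y))))
  simp only [Function.comp_def, id, sys_apply] at hc
  calc _ ≤ ∫⁻ t in Set.Icc a (a + h), (‖mulL (wcut σ n) (nlU σ t x.1 y.2)‖ₑ +
        (‖mulL (wcut σ n) (nlP σ t x.1 y.1)‖ₑ + ‖mulL (wcut σ n) (nlM σ t x.1 y.1)‖ₑ)) := by
        refine lintegral_mono fun t => ?_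
        rw [sys_apply]
        exact enorm_triple_le _
    _ = (∫⁻ t in Set.Icc a (a + h), ‖mulL (wcut σ n) (nlU σ t x.1 y.2)‖ₑ) +
        ((∫⁻ t in Set.Icc a (a + h), ‖mulL (wcut σ n) (nlP σ t x.1 y.1)‖ₑ) +
        ∫⁻ t in Set.Icc a (a + h), ‖mulL (wcut σ n) (nlM σ t x.1 y.1)‖ₑ) := by
        rw [lintegral_add_left (hc n).fst.enorm.measurable,
          lintegral_add_left (hc n).snd.fst.enorm.measurable]
    _ ≤ R * ‖x‖ₑ * ‖y‖ₑ + (R * ‖x‖ₑ * ‖y‖ₑ + R * ‖x‖ₑ * ‖y‖ₑ) := by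
        refine add_le_add ((lintegral_nlU_le hA hh0 hh1 n _ _).trans ?_)
          (add_le_add ((lintegral_nlP_le σ hA hh0 hh1 n _ _).trans ?_)
            ((lintegral_nlM_le σ hA hh0 hh1 n _ _).trans ?_)) <;> gcongr
    _ = _ := by
        rw [ENNReal.ofReal_mul (by norm_num), ENNReal.ofReal_ofNat, ← hR]; ring

-- The constant 24 is 8 · 3: the abstract smallness condition with three components in the bilinear
-- bound. The window bounds come afterwards, by applying the bilinear estimates again to the curve
-- already found.
set_option maxHeartbeats 1000000 in
theorem exists_isProfile {A : ℝ} (hA : FlowBound d A) {δ : ℝ} (hδ0 : 0 ≤ δ) (hδ1 : δ ≤ 1)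
    (x₀ : L2Triple d) (hsmall : 24 * (2 ^ d * A * δ ^ smoothExp d) * ‖x₀‖ ≤ 1) :
    ∃ F, IsProfile σ δ (12 * (2 ^ d * A) * ‖x₀‖) x₀ F := by
  set ν := volume.restrict (Set.Icc (0 : ℝ) δ) with hν
  have hAp := hA.1
  have hδα : 0 ≤ δ ^ smoothExp d := Real.rpow_nonneg hδ0 _
  obtain ⟨F, hF, hFn, hlim⟩ := exists_quadratic_solution (ν := ν) (continuous_sys σ (d := d))
    (monotone_enorm_sys σ) (exists_tendsto_sys σ) (M := 3 * (2 ^ d * A * δ ^ smoothExp d))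
    (by positivity) (fun n x y => by
      have := lintegral_sys_le σ hA (a := 0) hδ0 hδ1 n x y
      rwa [zero_add] at this) x₀ (by linarith)
  set X := curve ν x₀ F with hX
  have e1 : ∀ t, (X t).1 = curve ν x₀.1 (fun s => (F s).1) t := fun t =>
    curve_clm (ContinuousLinearMap.fst ℝ (L2 d) (L2 d × L2 d)) x₀ hF t
  have e2 : ∀ t, (X t).2 = curve ν x₀.2 (fun s => (F s).2) t := fun t =>
    curve_clm (ContinuousLinearMap.snd ℝ (L2 d) (L2 d × L2 d)) x₀ hF t
  have hF1 : Integrable (fun s => (F s).1) ν := hF.fst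
  have hF2 : Integrable (fun s => (F s).2) ν := hF.snd
  have hXc : Continuous X := continuous_curve x₀ hF
  simp only [sys_apply] at hlim
  have hl1 : ∀ᵐ t ∂ν, Filter.Tendsto (fun n => mulL (wcut σ n) (nlU σ t (X t).1 (X t).2))
      Filter.atTop (nhds (F t).1) := by
    filter_upwards [hlim] with t ht using ht.fst_nhds
  have hl2 : ∀ᵐ t ∂ν, Filter.Tendsto (fun n => mulL (wcut σ n) (nlP σ t (X t).1 (X t).1))
      Filter.atTop (nhds (F t).2.1) := by
    filter_upwards [hlim] with t ht using ht.snd_nhds.fst_nhds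
  have hl3 : ∀ᵐ t ∂ν, Filter.Tendsto (fun n => mulL (wcut σ n) (nlM σ t (X t).1 (X t).1))
      Filter.atTop (nhds (F t).2.2) := by
    filter_upwards [hlim] with t ht using ht.snd_nhds.snd_nhds
  have hwc : ∀ n, Continuous fun f : L2 d => mulL (wcut σ n) f := fun n => (mulL _).continuous
  have hc1 : ∀ n, Continuous fun t => mulL (wcut σ n) (nlU σ t (X t).1 (X t).2) := fun n =>
    continuous_bilin_family_apply (continuous_nlU σ) _ (hwc n) continuous_id hXc.fst hXc.snd
  have hres : ∀ (s h : ℝ) (g : ℝ → ℝ≥0∞), ∫⁻ t in Set.Icc s (s + h), g t ∂ν ≤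
      ∫⁻ t in Set.Icc s (s + h), g t := fun s h g =>
    lintegral_mono' (Measure.restrict_mono_measure Measure.restrict_le_self _) le_rfl
  set Φ := ∫⁻ s, ‖(F s).1‖ₑ ∂ν with hΦ
  have hΨ : ∫⁻ s, ‖(F s).2‖ₑ ∂ν ≤ ‖x₀‖ₑ :=
    (lintegral_mono fun s => enorm_le_iff_norm_le.2 (norm_snd_le _)).trans hFn
  have hΦt : Φ ≠ ∞ := hF1.2.ne
  have hx2 : ‖x₀.2‖ₑ ≤ ‖x₀‖ₑ := enorm_le_iff_norm_le.2 (norm_snd_le x₀)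
  have hx1 : ‖x₀.1‖ₑ ≤ ‖x₀‖ₑ := enorm_le_iff_norm_le.2 (norm_fst_le x₀)
  -- The estimate is integrated over the window only, while the curve keeps its full density on [0,
  -- δ].
  have B1 : ∀ s h : ℝ, 0 ≤ h → h ≤ 1 → ∫⁻ t in Set.Icc s (s + h), ‖(F t).1‖ₑ ∂ν ≤
      ENNReal.ofReal (2 ^ d * A * h ^ smoothExp d) * (‖x₀.1‖ₑ + Φ) * (2 * ‖x₀‖ₑ) := by
    intro s h h0 h1
    refine lintegral_enorm_limit_le hc1 (ae_restrict_of_ae hl1) fun n => ?_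
    have := lintegral_bilin_curve_le (ν := ν) (μ := ν.restrict (Set.Icc s (s + h)))
      (B := fun t => (ContinuousLinearMap.compL ℝ (L2 d × L2 d) (L2 d) (L2 d)
        ((mulL (wcut σ n)).restrictScalars ℝ)).comp (nlU σ t)) ((hwc n).comp (continuous_nlU σ))
      (fun x y => (hres s h _).trans (lintegral_nlU_le hA h0 h1 n x y)) x₀.1 hF1 x₀.2 hF2
    simp only [e1, e2]
    refine this.trans (mul_le_mul_right ?_ _)
    rw [two_mul]
    exact add_le_add hx2 hΨ
  -- On the whole interval the bound reads Φ ≤ 2(2^d A δ^α)‖x₀‖(‖x₀.1‖ + Φ), and smallness makes the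
  -- factor at most 1/12. Since Φ is finite it can be absorbed, which leaves a bound linear in
  -- ‖x₀.1‖.
  have hΦb : Φ ≤ ‖x₀.1‖ₑ := by
    have h1 := B1 0 δ hδ0 hδ1
    rw [zero_add, Measure.restrict_restrict measurableSet_Icc, Set.inter_self, ← hν, ← hΦ] at h1
    have h2 := ENNReal.toReal_mono (by finiteness) h1
    rw [ENNReal.toReal_mul, ENNReal.toReal_mul, ENNReal.toReal_mul, ENNReal.toReal_add (by simp) hΦt,
      ENNReal.toReal_ofReal (by positivity), toReal_enorm, toReal_enorm, ENNReal.toReal_ofNat] at h2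
    rw [← ENNReal.toReal_le_toReal hΦt (by simp), toReal_enorm]
    have h3 : 0 ≤ ‖x₀.1‖ + Φ.toReal := by positivity
    nlinarith [norm_nonneg x₀.1, mul_le_mul_of_nonneg_right hsmall h3]
  have hsum : ‖x₀.1‖ₑ + Φ ≤ 2 * ‖x₀.1‖ₑ := by rw [two_mul]; exact add_le_add le_rfl hΦb
  have B2 : ∀ (N : ℝ → L2 d →L[ℝ] L2 d →L[ℝ] L2 d),
      (Continuous fun p : ℝ × L2 d × L2 d => N p.1 p.2.1 p.2.2) →
      (∀ s h : ℝ, 0 ≤ h → h ≤ 1 → ∀ n x y, ∫⁻ t in Set.Icc s (s + h), ‖mulL (wcut σ n) (N t x y)‖ₑ ≤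
        ENNReal.ofReal (2 ^ d * A * h ^ smoothExp d) * ‖x‖ₑ * ‖y‖ₑ) →
      ∀ G : ℝ → L2 d, (∀ᵐ t ∂ν, Filter.Tendsto (fun n => mulL (wcut σ n) (N t (X t).1 (X t).1))
        Filter.atTop (nhds (G t))) →
      ∀ s h : ℝ, 0 ≤ h → h ≤ 1 → ∫⁻ t in Set.Icc s (s + h), ‖G t‖ₑ ∂ν ≤
      ENNReal.ofReal (2 ^ d * A * h ^ smoothExp d) * (2 * ‖x₀.1‖ₑ) * (2 * ‖x₀‖ₑ) := by
    intro N hN hNb G hG s h h0 h1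
    refine lintegral_enorm_limit_le (fun n => continuous_bilin_family_apply hN _ (hwc n)
      continuous_id hXc.fst hXc.fst) (ae_restrict_of_ae hG) fun n => ?_
    have := lintegral_bilin_curve_le (ν := ν) (μ := ν.restrict (Set.Icc s (s + h)))
      (B := fun t => (ContinuousLinearMap.compL ℝ (L2 d) (L2 d) (L2 d)
        ((mulL (wcut σ n)).restrictScalars ℝ)).comp (N t)) ((hwc n).comp hN)
      (fun x y => (hres s h _).trans (hNb s h h0 h1 n x y)) x₀.1 hF1 x₀.1 hF1
    simp only [e1]
    refine this.trans (mul_le_mul' (mul_le_mul' le_rfl hsum) (hsum.trans ?_))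
    exact mul_le_mul' le_rfl hx1
  refine ⟨F, hF, ?_, ?_, ?_, fun s h h0 h1 => ?_⟩
  · filter_upwards [hl1] with t ht using eq_decay_of_tendsto σ ht
  · filter_upwards [hl2] with t ht using eq_decay_of_tendsto σ ht
  · filter_upwards [hl3] with t ht using eq_decay_of_tendsto σ ht
  · have hm1 : AEMeasurable (fun t => ‖(F t).1‖ₑ) (ν.restrict (Set.Icc s (s + h))) :=
      hF1.1.enorm.mono_measure Measure.restrict_le_self
    have hm2 : AEMeasurable (fun t => ‖(F t).2.1‖ₑ) (ν.restrict (Set.Icc s (s + h))) :=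
      hF2.fst.1.enorm.mono_measure Measure.restrict_le_self
    calc _ ≤ ∫⁻ t in Set.Icc s (s + h), (‖(F t).1‖ₑ + (‖(F t).2.1‖ₑ + ‖(F t).2.2‖ₑ)) ∂ν :=
          lintegral_mono fun t => enorm_triple_le _
      _ = (∫⁻ t in Set.Icc s (s + h), ‖(F t).1‖ₑ ∂ν) +
          ((∫⁻ t in Set.Icc s (s + h), ‖(F t).2.1‖ₑ ∂ν) +
          ∫⁻ t in Set.Icc s (s + h), ‖(F t).2.2‖ₑ ∂ν) := by
          rw [lintegral_add_left' hm1, lintegral_add_left' hm2]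
      _ ≤ ENNReal.ofReal (2 ^ d * A * h ^ smoothExp d) * (2 * ‖x₀.1‖ₑ) * (2 * ‖x₀‖ₑ) +
          (ENNReal.ofReal (2 ^ d * A * h ^ smoothExp d) * (2 * ‖x₀.1‖ₑ) * (2 * ‖x₀‖ₑ) +
          ENNReal.ofReal (2 ^ d * A * h ^ smoothExp d) * (2 * ‖x₀.1‖ₑ) * (2 * ‖x₀‖ₑ)) := by
          refine add_le_add ((B1 s h h0 h1).trans (by gcongr)) (add_le_add ?_ ?_)
          · exact B2 (nlP σ) (continuous_nlP σ)
              (fun s h h0 h1 n x y => lintegral_nlP_le σ hA h0 h1 n x y) _ hl2 s h h0 h1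
          · exact B2 (nlM σ) (continuous_nlM σ)
              (fun s h h0 h1 n x y => lintegral_nlM_le σ hA h0 h1 n x y) _ hl3 s h h0 h1
      -- Three components, each with a factor 2 from either argument.
      _ = ENNReal.ofReal (12 * (2 ^ d * A) * ‖x₀‖ * h ^ smoothExp d) * ‖x₀.1‖ₑ := by
          have e : 12 * (2 ^ d * A) * ‖x₀‖ * h ^ smoothExp d =
            12 * (2 ^ d * A * h ^ smoothExp d * ‖x₀‖) := by ring
          have hp : 0 ≤ 2 ^ d * A * h ^ smoothExp d :=
            mul_nonneg (by positivity) (Real.rpow_nonneg h0 _)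
          rw [e, ENNReal.ofReal_mul (p := 12) (by norm_num),
            ENNReal.ofReal_mul (q := ‖x₀‖) hp, ofReal_norm,
            ENNReal.ofReal_ofNat]
          ring

end Existence

/-! ### Differentiating the phases -/

section PhaseDerivative

variable {V : Type*} [MeasurableSpace V] {μ : Measure V}

theorem norm_exp_sub_one_sub_le (θ : ℝ) :
    ‖Complex.exp ((θ : ℝ) * Complex.I) - 1 - θ * Complex.I‖ ≤ 2 * |θ| := by
  have h1 : ‖Complex.exp ((θ : ℝ) * Complex.I) - 1‖ ≤ |θ| := by
    have := Real.norm_exp_I_mul_ofReal_sub_one_le (x := θ)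
    rwa [mul_comm Complex.I] at this
  refine (norm_sub_le _ _).trans ?_
  rw [norm_mul, Complex.norm_I, Complex.norm_real, mul_one, Real.norm_eq_abs]
  linarith

theorem norm_ph_sub_sub (m : V → ℝ) (s t : ℝ) (x : V) :
    ‖ph m s x - ph m t x - ((s - t : ℝ) : ℂ) * (Complex.I * (ph m t x * (m x : ℂ)))‖ ≤
      2 * |(s - t) * m x| := by
  have h1 : ph m s x - ph m t x - ((s - t : ℝ) : ℂ) * (Complex.I * (ph m t x * (m x : ℂ))) =
      ph m t x * (Complex.exp (((s - t) * m x : ℝ) * Complex.I) - 1 -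
        ((s - t) * m x : ℝ) * Complex.I) := by
    have : ph m s x = ph m t x * ph m (s - t) x := by rw [← ph_add]; congr 1; ring
    rw [this]
    simp only [ph]
    push_cast
    ring
  rw [h1, norm_mul, norm_ph, one_mul]
  exact norm_exp_sub_one_sub_le _

theorem hasDerivAt_ph (m : V → ℝ) (t : ℝ) (x : V) :
    HasDerivAt (fun s => ph m s x) (Complex.I * (ph m t x * (m x : ℂ))) t := by
  have h1 : HasDerivAt (fun s : ℝ => ((s * m x : ℝ) : ℂ) * Complex.I)
      (((m x : ℝ) : ℂ) * Complex.I) t := by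
    have h2 : HasDerivAt (fun s : ℝ => s * m x) (m x) t := by
      simpa using (hasDerivAt_id t).mul_const (m x)
    exact h2.ofReal_comp.mul_const Complex.I
  refine h1.cexp.congr_deriv ?_
  unfold ph
  ring

/-- Stone's theorem for multiplication operators. -/
theorem hasDerivAt_mulL_ph {m : V → ℝ} (hm : Measurable m) {f g : Lp ℂ 2 μ}
    (hg : g =ᵐ[μ] fun x => (m x : ℂ) * f x) (t : ℝ) :
    HasDerivAt (fun s => mulL (ph m s) f) (Complex.I • mulL (ph m t) g) t := by
  rw [hasDerivAt_iff_tendsto]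
  have key : ∀ s, ‖mulL (ph m s) f - mulL (ph m t) f - (s - t) • (Complex.I • mulL (ph m t) g)‖ ^ 2 =
      ∫ x, ‖(ph m s x - ph m t x - ((s - t : ℝ) : ℂ) * (Complex.I * (ph m t x * (m x : ℂ)))) * f x‖ ^ 2
        ∂μ := by
    intro s
    rw [norm_sq_eq_integral]
    refine integral_congr_ae ?_
    filter_upwards [Lp.coeFn_sub (mulL (ph m s) f - mulL (ph m t) f)
      ((s - t) • (Complex.I • mulL (ph m t) g)), Lp.coeFn_sub (mulL (ph m s) f) (mulL (ph m t) f),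
      Lp.coeFn_smul (s - t) (Complex.I • mulL (ph m t) g), Lp.coeFn_smul Complex.I (mulL (ph m t) g),
      mulL_ph_coe hm s f, mulL_ph_coe hm t f, mulL_ph_coe hm t g, hg] with x h1 h2 h3 h4 h5 h6 h7 h8
    rw [h1, Pi.sub_apply, h2, Pi.sub_apply, h3, Pi.smul_apply, h4, Pi.smul_apply, h5, h6, h7, h8,
      Complex.real_smul, smul_eq_mul]
    congr 2
    ring
  have h0 : Filter.Tendsto (fun s => ∫ x, (‖s - t‖⁻¹ * ‖(ph m s x - ph m t x -
      ((s - t : ℝ) : ℂ) * (Complex.I * (ph m t x * (m x : ℂ)))) * f x‖) ^ 2 ∂μ) (nhds t)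
      (nhds (∫ _, (0 : ℝ) ∂μ)) := by
    refine tendsto_integral_filter_of_dominated_convergence (fun x => 4 * ‖g x‖ ^ 2) ?_ ?_ ?_ ?_
    · refine Filter.Eventually.of_forall fun s => ?_
      have h1 : Measurable fun x => ph m s x - ph m t x -
          ((s - t : ℝ) : ℂ) * (Complex.I * (ph m t x * (m x : ℂ))) :=
        ((measurable_ph hm s).sub (measurable_ph hm t)).sub (((Measurable.mul (measurable_ph hm t)
          (Complex.measurable_ofReal.comp hm)).const_mul _).const_mul _)
      exact (((h1.aestronglyMeasurable.mul (Lp.aestronglyMeasurable f)).norm.const_mul _).pow 2)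
    · refine Filter.Eventually.of_forall fun s => ?_
      filter_upwards [hg] with x hx
      have h1 := norm_ph_sub_sub m s t x
      rw [abs_mul] at h1
      have h2 : ‖s - t‖⁻¹ * ‖ph m s x - ph m t x -
          ((s - t : ℝ) : ℂ) * (Complex.I * (ph m t x * (m x : ℂ)))‖ ≤ 2 * ‖m x‖ := by
        rcases eq_or_ne s t with rfl | hst
        · simp
        · have h3 : 0 < ‖s - t‖ := norm_pos_iff.2 (sub_ne_zero.2 hst)
          rw [inv_mul_le_iff₀ h3]
          refine h1.trans (le_of_eq ?_)
          rw [Real.norm_eq_abs, Real.norm_eq_abs]; ring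
      rw [Real.norm_of_nonneg (sq_nonneg _), hx, norm_mul, norm_mul, Complex.norm_real, ← mul_assoc]
      calc _ ≤ (2 * ‖m x‖ * ‖f x‖) ^ 2 :=
            pow_le_pow_left₀ (by positivity) (mul_le_mul_of_nonneg_right h2 (norm_nonneg _)) 2
        _ = _ := by ring
    · exact ((memLp_two_iff_integrable_sq_norm (Lp.aestronglyMeasurable g)).1
        (Lp.memLp g)).const_mul 4
    · refine Filter.Eventually.of_forall fun x => ?_
      have h1 := hasDerivAt_iff_tendsto.1 (hasDerivAt_ph m t x)
      have h2 := (h1.mul_const ‖f x‖).pow 2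
      simp only [zero_mul, ne_eq, OfNat.ofNat_ne_zero, not_false_eq_true, zero_pow] at h2
      refine h2.congr fun s => ?_
      rw [norm_mul, Complex.real_smul, mul_assoc]
  simp only [integral_zero, mul_pow, integral_const_mul, ← key] at h0
  have := h0.sqrt
  simp only [← mul_pow, Real.sqrt_zero] at this
  refine this.congr fun s => Real.sqrt_sq (by positivity)

/-- A product rule for an unbounded generator. The curve is split as (v(r) - v(t)) + v(t): the first
part needs only strong continuity of the phases, so v(t) alone has to lie in the domain of m. -/
theorem HasDerivWithinAt.mulL_ph {m : V → ℝ} (hm : Measurable m) {v : ℝ → Lp ℂ 2 μ}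
    {v' g : Lp ℂ 2 μ} {s : Set ℝ} {t : ℝ} (hv : HasDerivWithinAt v v' s t)
    (hg : g =ᵐ[μ] fun x => (m x : ℂ) * v t x) :
    HasDerivWithinAt (fun r => mulL (ph m r) (v r))
      (mulL (ph m t) v' + Complex.I • mulL (ph m t) g) s t := by
  have h1 : HasDerivWithinAt (fun r => mulL (ph m r) (v r - v t)) (mulL (ph m t) v') s t := by
    rw [hasDerivWithinAt_iff_tendsto_slope] at hv ⊢
    have h2 := ((continuous_mulL_ph (μ := μ) hm).tendsto (t, v')).comp
      ((tendsto_nhdsWithin_of_tendsto_nhds (s := s \ {t}) Filter.tendsto_id).prodMk_nhds hv)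
    refine h2.congr fun r => ?_
    simp only [Function.comp, slope_def_module, sub_self, map_zero, sub_zero, id]
    exact ((mulL (ph m r) : Lp ℂ 2 μ →L[ℂ] Lp ℂ 2 μ).restrictScalars ℝ).map_smul _ _
  have h3 := (h1.add (hasDerivAt_mulL_ph hm hg t).hasDerivWithinAt (s := s))
  refine h3.congr (fun r _ => ?_) ?_
  · simp [map_sub]
  · simp

end PhaseDerivative

/-! ### From mild to differentiable curves -/

section MildDerivative

variable {d : ℕ}

theorem curve_eq_of_mem {X : Type*} [NormedAddCommGroup X] [NormedSpace ℝ X] [CompleteSpace X]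
    {δ t : ℝ} (ht : t ∈ Set.Icc 0 δ) (x₀ : X) (F : ℝ → X) :
    curve (volume.restrict (Set.Icc 0 δ)) x₀ F t = x₀ + ∫ s in (0 : ℝ)..t, F s := by
  rw [curve, intervalIntegral.integral_of_le ht.1, intervalIntegral.integral_of_le ht.1,
    Measure.restrict_restrict measurableSet_Ioc]
  congr 3
  exact Set.inter_eq_left.2 fun s hs => ⟨hs.1.le, hs.2.trans ht.2⟩

/-- F is merely integrable, but L ∘ F agrees almost everywhere with a continuous function, so the
fundamental theorem of calculus holds at every time. Here L removes the Gevrey weight and N is the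
nonlinearity along the continuous curve. -/
theorem hasDerivWithinAt_curve {X Y : Type*} [NormedAddCommGroup X] [NormedSpace ℝ X]
    [CompleteSpace X] [NormedAddCommGroup Y] [NormedSpace ℝ Y] [CompleteSpace Y] (L : X →L[ℝ] Y)
    {δ t : ℝ} (ht : t ∈ Set.Icc 0 δ) (x₀ : X) {F : ℝ → X}
    (hF : Integrable F (volume.restrict (Set.Icc 0 δ))) {N : ℝ → Y} (hN : Continuous N)
    (h : ∀ᵐ s ∂(volume.restrict (Set.Icc 0 δ)), N s = L (F s)) :
    HasDerivWithinAt (fun s => L (curve (volume.restrict (Set.Icc 0 δ)) x₀ F s)) (N t)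
      (Set.Icc 0 δ) t := by
  have h1 : ∀ s ∈ Set.Icc 0 δ, L (curve (volume.restrict (Set.Icc 0 δ)) x₀ F s) =
      L x₀ + ∫ r in (0 : ℝ)..s, N r := by
    intro s hs
    rw [curve_clm L x₀ hF, ← curve_eq_of_mem hs, curve, curve,
      intervalIntegral.integral_congr_ae_restrict]
    exact ae_restrict_of_ae (h.mono fun _ h => h.symm)
  refine HasDerivWithinAt.congr ?_ h1 (h1 t ht)
  exact ((intervalIntegral.integral_hasDerivAt_right (hN.intervalIntegrable _ _)
    (hN.stronglyMeasurableAtFilter _ _) hN.continuousAt).const_add _).hasDerivWithinAt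

end MildDerivative

/-! ### Gevrey spaces as isometric images of L² -/

section Gevrey

variable {d : ℕ} (σ : ℝ) [hσ : Fact (0 < σ)]

theorem fourier_inj {f g : L2 d} (h : (𝓕 f : L2 d) = 𝓕 g) : f = g :=
  (Lp.fourierTransformₗᵢ (Space d) ℂ).injective h

theorem fourier_phys (f : L2 d) : 𝓕 (phys σ f) = mulL (decay σ) f := by
  rw [phys, fourier_fourierInv_eq]

theorem phys_sub (f g : L2 d) : phys σ (f - g) = phys σ f - phys σ g := by
  rw [sub_eq_add_neg, phys_add, ← neg_one_smul ℂ g, phys_smul, neg_one_smul, ← sub_eq_add_neg]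

theorem gevreySymbol_zero (ξ : Space d) : gevreySymbol σ 0 ((2 * Real.pi) • ξ) = wt σ ξ := by
  rw [gevreySymbol, Real.rpow_zero, mul_one, wt]

theorem gevreySymbol_one (ξ : Space d) :
    gevreySymbol σ 1 ((2 * Real.pi) • ξ) = wt σ ξ * brk ξ := by
  rw [gevreySymbol, Real.rpow_one, wt, brk]

theorem gevreyNorm_phys_zero (f : L2 d) : gevreyNorm σ 0 (phys σ f) = ‖f‖ₑ := by
  rw [gevreyNorm, fourier_phys, Lp.enorm_def]
  refine eLpNorm_congr_ae ?_
  filter_upwards [mulL_decay_coe σ f] with ξ h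
  rw [h, gevreySymbol_zero, ← mul_assoc, wt_mul_decay, one_mul]

theorem mulL_brkInv_coe (f : L2 d) : mulL brkInv f =ᵐ[volume] fun ξ => brkInv ξ * f ξ :=
  mulL_coe continuous_brkInv.measurable norm_brkInv_le f

theorem gevreyNorm_phys_one (f : L2 d) : gevreyNorm σ 1 (phys σ (mulL brkInv f)) = ‖f‖ₑ := by
  rw [gevreyNorm, fourier_phys, Lp.enorm_def]
  refine eLpNorm_congr_ae ?_
  filter_upwards [mulL_decay_coe σ (mulL brkInv f), mulL_brkInv_coe f] with ξ h h2
  rw [h, h2, gevreySymbol_one]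
  have h3 := wt_mul_decay σ ξ
  have h4 := brk_mul_brkInv ξ
  push_cast
  linear_combination (brk ξ * brkInv ξ * f ξ) * h3 + f ξ * h4

theorem exists_eq_phys {v : L2 d} (h : MemGevrey σ 0 v) : ∃ f : L2 d, v = phys σ f := by
  have h1 : MemLp (fun ξ => ((gevreySymbol σ 0 ((2 * Real.pi) • ξ) : ℝ) : ℂ) * (𝓕 v : L2 d) ξ) 2 := by
    refine ⟨?_, h⟩
    simp only [gevreySymbol_zero]
    exact (Complex.continuous_ofReal.comp (continuous_wt σ)).aestronglyMeasurable.mul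
      (Lp.aestronglyMeasurable _)
  refine ⟨h1.toLp _, ?_⟩
  refine fourier_inj ?_
  rw [fourier_phys]
  refine Lp.ext ?_
  filter_upwards [mulL_decay_coe σ (h1.toLp _), h1.coeFn_toLp] with ξ h2 h3
  rw [h2, h3, gevreySymbol_zero]
  linear_combination -((𝓕 v : L2 d) ξ) * wt_mul_decay σ ξ

theorem exists_eq_phys_brkInv {v : L2 d} (h : MemGevrey σ 1 v) :
    ∃ f : L2 d, v = phys σ (mulL brkInv f) := by
  have h1 : MemLp (fun ξ => ((gevreySymbol σ 1 ((2 * Real.pi) • ξ) : ℝ) : ℂ) * (𝓕 v : L2 d) ξ) 2 := by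
    refine ⟨?_, h⟩
    simp only [gevreySymbol_one]
    exact (Complex.continuous_ofReal.comp
      ((continuous_wt σ).mul continuous_brk)).aestronglyMeasurable.mul (Lp.aestronglyMeasurable _)
  refine ⟨h1.toLp _, ?_⟩
  refine fourier_inj ?_
  rw [fourier_phys]
  refine Lp.ext ?_
  filter_upwards [mulL_decay_coe σ (mulL brkInv (h1.toLp _)), mulL_brkInv_coe (h1.toLp _),
    h1.coeFn_toLp] with ξ h2 h4 h3
  rw [h2, h4, h3, gevreySymbol_one]
  have h5 := wt_mul_decay σ ξ
  have h6 := brk_mul_brkInv ξ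
  push_cast
  linear_combination -((𝓕 v : L2 d) ξ * brk ξ * brkInv ξ) * h5 - (𝓕 v : L2 d) ξ * h6

theorem gevreyContinuous_phys {δ : ℝ} {f : ℝ → L2 d} (hf : Continuous f) :
    GevreyContinuous σ 0 δ fun t => phys σ (f t) := by
  intro t _
  refine ⟨?_, ?_⟩
  · rw [MemGevrey, gevreyNorm_phys_zero]; exact enorm_lt_top
  · simp only [← phys_sub, gevreyNorm_phys_zero]
    have h : Continuous fun t' => ‖f t' - f t‖ₑ := (hf.sub continuous_const).enorm
    have h2 := (h.tendsto t).mono_left (nhdsWithin_le_nhds (s := Set.Icc 0 δ))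
    simpa using h2

theorem gevreyContinuous_phys_brkInv {δ : ℝ} {f : ℝ → L2 d} (hf : Continuous f) :
    GevreyContinuous σ 1 δ fun t => phys σ (mulL brkInv (f t)) := by
  intro t _
  refine ⟨?_, ?_⟩
  · rw [MemGevrey, gevreyNorm_phys_one]; exact enorm_lt_top
  · simp only [← phys_sub, ← map_sub, gevreyNorm_phys_one]
    have h : Continuous fun t' => ‖f t' - f t‖ₑ := (hf.sub continuous_const).enorm
    have h2 := (h.tendsto t).mono_left (nhdsWithin_le_nhds (s := Set.Icc 0 δ))
    simpa using h2

theorem phys_conjRefl (f : L2 d) :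
    phys σ (conjRefl f) =ᵐ[volume] fun x => (starRingEnd ℂ) (phys σ f x) := by
  have h1 : mulL (decay σ) (conjRefl f) = conjRefl (mulL (decay σ) f) := by
    refine Lp.ext ?_
    filter_upwards [mulL_decay_coe σ (conjRefl f), conjRefl_coe f,
      conjRefl_coe (mulL (decay σ) f),
      (Measure.measurePreserving_neg (volume : Measure (Space d))).quasiMeasurePreserving.ae_eq_comp
      (mulL_decay_coe σ f)] with ξ h1 h2 h3 h4
    simp only [Function.comp] at h4
    rw [h1, h2, h3, h4, map_mul, decay_neg, decay, Complex.conj_ofReal]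
  rw [phys, h1]
  exact fourierInv_conjRefl (integrable_mulL_decay σ f)

end Gevrey

/-! ### Time derivatives of the solution -/

section Solution

variable {d : ℕ} (σ : ℝ) [hσ : Fact (0 < σ)]

/-- The inverse Fourier transform as a real-linear map. -/
def invFourierL (d : ℕ) : L2 d →L[ℝ] L2 d :=
  ((Lp.fourierTransformₗᵢ (Space d) ℂ).symm.toLinearIsometry.toContinuousLinearMap).restrictScalars ℝ

theorem invFourierL_apply (f : L2 d) : invFourierL d f = 𝓕⁻ f := rfl

/-- For σ > 0 the exponential absorbs |ξ|². Hence Δu is in L² at every time and the Schrödinger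
equation holds there, although the profile is only in L². -/
theorem exists_schSymbol_mul_decay_bound :
    ∃ C : ℝ, ∀ ξ : Space d, ‖(schSymbol ξ : ℂ) * decay σ ξ‖ ≤ C := by
  refine ⟨2 / σ ^ 2, fun ξ => ?_⟩
  have hσ' := hσ.out
  rw [norm_mul, norm_decay, Complex.norm_real, schSymbol, norm_neg, Real.norm_of_nonneg (by positivity)]
  set r := ‖(2 * Real.pi) • ξ‖
  have h1 : Real.exp (-(σ * l1 ((2 * Real.pi) • ξ))) ≤ Real.exp (-(σ * r)) := by
    rw [Real.exp_le_exp, neg_le_neg_iff]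
    exact mul_le_mul_of_nonneg_left (norm_le_l1 _) hσ'.le
  have h2 : (σ * r) ^ 2 / 2 ≤ Real.exp (σ * r) := by
    have := Real.pow_div_factorial_le_exp (σ * r) (by positivity) 2
    simpa using this
  rw [le_div_iff₀ (by positivity)]
  calc r ^ 2 * Real.exp (-(σ * l1 ((2 * Real.pi) • ξ))) * σ ^ 2
      ≤ r ^ 2 * Real.exp (-(σ * r)) * σ ^ 2 := by gcongr
    _ = 2 * ((σ * r) ^ 2 / 2) * Real.exp (-(σ * r)) := by ring
    _ ≤ 2 * Real.exp (σ * r) * Real.exp (-(σ * r)) := by gcongr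
    _ = 2 := by rw [mul_assoc, ← Real.exp_add, add_neg_cancel, Real.exp_zero, mul_one]

theorem measurable_schSymbol_mul_decay :
    Measurable fun ξ : Space d => (schSymbol ξ : ℂ) * decay σ ξ :=
  (Complex.measurable_ofReal.comp measurable_schSymbol).mul (continuous_decay σ).measurable

theorem mulL_ph_neg_cancel {q : Space d → ℝ} (hq : Measurable q) (t : ℝ) (f : L2 d) :
    mulL (ph q t) (mulL (ph q (-t)) f) = f := by
  rw [← mulL_ph_add hq, add_neg_cancel, mulL_ph_zero hq]

theorem nlU_apply (t : ℝ) (x : L2 d) (y : L2 d × L2 d) : nlU σ t x y =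
    (Complex.I / 2) • mulL (ph schSymbol (-t)) (cv σ (flowS t x) (flowN t y)) := by
  unfold nlU; rfl

theorem nlP_apply (t : ℝ) (x y : L2 d) : nlP σ t x y =
    Complex.I • mulL (ph brkNeg (-t)) (cv σ (flowS t x) (flowR t y)) := by
  unfold nlP; rfl

theorem nlM_apply (t : ℝ) (x y : L2 d) : nlM σ t x y =
    (-Complex.I) • mulL (ph brk (-t)) (cv σ (flowS t x) (flowR t y)) := by
  unfold nlM; rfl

/-- The first component of the solution with the profile `X`. -/
def solU (X : ℝ → L2Triple d) (t : ℝ) : L2 d := phys σ (flowS t (X t).1)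

/-- The second component of the solution with the profile `X`. -/
def solP (X : ℝ → L2Triple d) (t : ℝ) : L2 d := phys σ (flowQ brkNeg t (X t).2.1)

/-- The third component of the solution with the profile `X`. -/
def solM (X : ℝ → L2Triple d) (t : ℝ) : L2 d := phys σ (flowQ brk t (X t).2.2)

variable {σ}

theorem IsProfile.hasDerivWithinAt_solU {δ B : ℝ} {x₀ : L2Triple d} {F : ℝ → L2Triple d}
    (h : IsProfile σ δ B x₀ F) {t : ℝ} (ht : t ∈ Set.Icc 0 δ) (Y : L2Triple d)
    (hY : Y = curve (volume.restrict (Set.Icc 0 δ)) x₀ F t) :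
    HasDerivWithinAt (solU σ (curve (volume.restrict (Set.Icc 0 δ)) x₀ F))
      (𝓕⁻ ((Complex.I / 2) • cv σ (flowS t Y.1) (flowN t Y.2) +
        Complex.I • mulL (fun ξ => (schSymbol ξ : ℂ) * decay σ ξ) (flowS t Y.1))) (Set.Icc 0 δ) t := by
  set X := curve (volume.restrict (Set.Icc 0 δ)) x₀ F with hX
  have hXc : Continuous X := continuous_curve x₀ h.integrable
  obtain ⟨C, hC⟩ := exists_schSymbol_mul_decay_bound (d := d) σ
  have hmd := measurable_schSymbol_mul_decay (d := d) σ
  have h1 := hasDerivWithinAt_curve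
    (((mulL (decay σ)).restrictScalars ℝ).comp (ContinuousLinearMap.fst ℝ (L2 d) (L2 d × L2 d)))
    ht x₀ h.integrable (N := fun t => nlU σ t (X t).1 (X t).2)
    (continuous_bilin_family_apply (continuous_nlU σ) id continuous_id continuous_id hXc.fst hXc.snd)
    h.eqU
  rw [← hX] at h1
  have hg : (mulL (fun ξ => (schSymbol ξ : ℂ) * decay σ ξ) (X t).1 : L2 d) =ᵐ[volume]
      fun ξ => (schSymbol ξ : ℂ) * (mulL (decay σ) (X t).1 : L2 d) ξ := by
    filter_upwards [mulL_coe hmd hC (X t).1, mulL_decay_coe σ (X t).1] with ξ h2 h3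
    rw [h2, h3, mul_assoc]
  have h2 := HasDerivWithinAt.mulL_ph measurable_schSymbol h1 hg
  have h3 := (invFourierL d).hasFDerivAt.comp_hasDerivWithinAt t h2
  have e1 : solU σ X = (invFourierL d) ∘ fun r => mulL (ph schSymbol r)
      ((((mulL (decay σ)).restrictScalars ℝ).comp
        (ContinuousLinearMap.fst ℝ (L2 d) (L2 d × L2 d))) (X r)) := by
    funext r
    change phys σ (flowS r (X r).1) = 𝓕⁻ (mulL (ph schSymbol r) (mulL (decay σ) (X r).1))
    rw [phys, flowS_apply, mulL_comm (continuous_decay σ).measurable (norm_decay_le hσ.out.le)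
      (measurable_ph measurable_schSymbol r) (norm_ph_le schSymbol r)]
  rw [e1]
  refine h3.congr_deriv ?_
  rw [hY, invFourierL_apply, nlU_apply]
  congr 1
  rw [map_smul, mulL_ph_neg_cancel measurable_schSymbol, flowS_apply,
    mulL_comm hmd hC (measurable_ph measurable_schSymbol t) (norm_ph_le schSymbol t)]

/-- The generator q = c⟨ξ⟩ cancels the factor ⟨ξ⟩⁻¹ in the definition of n₊ and n₋, so the curve is
in its domain at every time. -/
theorem hasDerivWithinAt_phys_flowQ {δ : ℝ} {q : Space d → ℝ} (hq : Measurable q) {c : ℂ}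
    (hqc : ∀ ξ, (q ξ : ℂ) = c * brk ξ) {x₀ : L2Triple d} {F : ℝ → L2Triple d}
    (hF : Integrable F (volume.restrict (Set.Icc 0 δ))) (π : L2Triple d →L[ℝ] L2 d)
    {N : ℝ → L2 d} (hN : Continuous N)
    (h : ∀ᵐ s ∂(volume.restrict (Set.Icc 0 δ)), N s = mulL (decay σ) (π (F s)))
    {t : ℝ} (ht : t ∈ Set.Icc 0 δ) :
    HasDerivWithinAt
      (fun r => phys σ (flowQ q r (π (curve (volume.restrict (Set.Icc 0 δ)) x₀ F r))))
      (𝓕⁻ (mulL brkInv (mulL (ph q t) (N t)) + (Complex.I * c) • mulL (decay σ)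
        (mulL (ph q t) (π (curve (volume.restrict (Set.Icc 0 δ)) x₀ F t))))) (Set.Icc 0 δ) t := by
  set X := curve (volume.restrict (Set.Icc 0 δ)) x₀ F with hX
  have hbm := (continuous_brkInv (d := d)).measurable
  have hbn := norm_brkInv_le (d := d)
  have hdm := (continuous_decay (d := d) σ).measurable
  have hdn := norm_decay_le (d := d) hσ.out.le
  have h1 := hasDerivWithinAt_curve
    (((mulL brkInv).restrictScalars ℝ).comp (((mulL (decay σ)).restrictScalars ℝ).comp π))
    ht x₀ hF (N := fun t => mulL brkInv (N t))
    ((mulL brkInv).continuous.comp hN) (h.mono fun s hs => congrArg (mulL brkInv) hs)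
  rw [← hX] at h1
  have hg : (c • mulL (decay σ) (π (X t)) : L2 d) =ᵐ[volume]
      fun ξ => (q ξ : ℂ) * (mulL brkInv (mulL (decay σ) (π (X t))) : L2 d) ξ := by
    filter_upwards [Lp.coeFn_smul c (mulL (decay σ) (π (X t))),
      mulL_brkInv_coe (mulL (decay σ) (π (X t)))] with ξ h2 h3
    rw [h2, h3, hqc, Pi.smul_apply, smul_eq_mul]
    linear_combination -(c * (mulL (decay σ) (π (X t)) : L2 d) ξ) * brk_mul_brkInv ξ
  have h2 := HasDerivWithinAt.mulL_ph hq h1 hg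
  have h3 := (invFourierL d).hasFDerivAt.comp_hasDerivWithinAt t h2
  have e1 : (fun r => phys σ (flowQ q r (π (X r)))) = (invFourierL d) ∘ fun r => mulL (ph q r)
      ((((mulL brkInv).restrictScalars ℝ).comp (((mulL (decay σ)).restrictScalars ℝ).comp π))
        (X r)) := by
    funext r
    change phys σ (flowQ q r (π (X r))) = 𝓕⁻ (mulL (ph q r) (mulL brkInv (mulL (decay σ) (π (X r)))))
    rw [phys, flowQ_apply, mulL_comm hdm hdn hbm hbn,
      mulL_comm hdm hdn (measurable_ph hq r) (norm_ph_le q r),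
      mulL_comm hbm hbn (measurable_ph hq r) (norm_ph_le q r)]
  rw [e1]
  refine h3.congr_deriv ?_
  rw [invFourierL_apply]
  congr 2
  · rw [mulL_comm hbm hbn (measurable_ph hq t) (norm_ph_le q t)]
  · rw [map_smul, smul_smul, mulL_comm hdm hdn (measurable_ph hq t) (norm_ph_le q t)]

end Solution

/-! ### The equations and the initial data -/

section Assemble

variable {d : ℕ} {σ : ℝ} [hσ : Fact (0 < σ)]

theorem isFourierMultiplier_iff {m : Space d → ℝ} {f g : L2 d} :
    IsFourierMultiplier m f g ↔ (𝓕 g : L2 d) =ᵐ[volume]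
      fun ξ => ((m ((2 * Real.pi) • ξ) : ℝ) : ℂ) * (𝓕 f : L2 d) ξ := Iff.rfl

theorem fourier_invFourier (f : L2 d) : (𝓕 (𝓕⁻ f : L2 d) : L2 d) = f := fourier_fourierInv_eq f

theorem fourier_cv (f g : L2 d) : (𝓕 (prodL σ f g) : L2 d) = cv σ f g := (cv_apply σ f g).symm

theorem isFourierMultiplier_brk_phys (f : L2 d) :
    IsFourierMultiplier (fun ξ => bracket ‖ξ‖) (phys σ (mulL brkInv f)) (phys σ f) := by
  rw [isFourierMultiplier_iff, fourier_phys, fourier_phys]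
  filter_upwards [mulL_decay_coe σ f, mulL_decay_coe σ (mulL brkInv f), mulL_brkInv_coe f]
    with ξ h1 h2 h3
  rw [h1, h2, h3]
  change _ = (brk ξ : ℂ) * _
  linear_combination -(decay σ ξ * f ξ) * brk_mul_brkInv ξ

theorem fourier_lin (c : ℂ) (f g : L2 d) :
    (𝓕 (c • f + g) : L2 d) = c • (𝓕 f : L2 d) + 𝓕 g := by
  rw [FourierTransform.fourier_add, FourierTransform.fourier_smul]

theorem fourier_neg (f : L2 d) : (𝓕 (-f) : L2 d) = -𝓕 f :=
  (Lp.fourierTransformₗᵢ (Space d) ℂ).map_neg f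

theorem flowS_zero (f : L2 d) : flowS 0 f = f := by
  rw [flowS_apply, mulL_ph_zero measurable_schSymbol]

theorem flowQ_zero {q : Space d → ℝ} (hq : Measurable q) (f : L2 d) :
    flowQ q 0 f = mulL brkInv f := by
  rw [flowQ_apply, mulL_ph_zero hq]

theorem IsProfile.satisfiesEquationsAt {δ B : ℝ} {x₀ : L2Triple d} {F : ℝ → L2Triple d}
    (h : IsProfile σ δ B x₀ F) {t : ℝ} (ht : t ∈ Set.Icc 0 δ) :
    SatisfiesEquationsAt δ (solU σ (curve (volume.restrict (Set.Icc 0 δ)) x₀ F))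
      (solP σ (curve (volume.restrict (Set.Icc 0 δ)) x₀ F))
      (solM σ (curve (volume.restrict (Set.Icc 0 δ)) x₀ F)) t := by
  set X := curve (volume.restrict (Set.Icc 0 δ)) x₀ F with hX
  have hXc : Continuous X := continuous_curve x₀ h.integrable
  have hU := h.hasDerivWithinAt_solU ht (X t) (by rw [hX])
  have hP : HasDerivWithinAt (solP σ X) (𝓕⁻ (mulL brkInv (mulL (ph brkNeg t)
      (nlP σ t (X t).1 (X t).1)) + (Complex.I * -1) • mulL (decay σ)
        (mulL (ph brkNeg t) (X t).2.1)) : L2 d) (Set.Icc 0 δ) t := hasDerivWithinAt_phys_flowQ measurable_brkNeg (c := -1)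
    (fun ξ => by simp [brkNeg]) h.integrable (σ := σ) (x₀ := x₀)
    ((ContinuousLinearMap.fst ℝ (L2 d) (L2 d)).comp (ContinuousLinearMap.snd ℝ (L2 d) (L2 d × L2 d)))
    (continuous_bilin_family_apply (continuous_nlP σ) id continuous_id continuous_id hXc.fst hXc.fst)
    h.eqP ht
  have hM : HasDerivWithinAt (solM σ X) (𝓕⁻ (mulL brkInv (mulL (ph brk t)
      (nlM σ t (X t).1 (X t).1)) + (Complex.I * 1) • mulL (decay σ)
        (mulL (ph brk t) (X t).2.2)) : L2 d) (Set.Icc 0 δ) t := hasDerivWithinAt_phys_flowQ measurable_brk (c := 1)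
    (fun ξ => by simp) h.integrable (σ := σ) (x₀ := x₀)
    ((ContinuousLinearMap.snd ℝ (L2 d) (L2 d)).comp (ContinuousLinearMap.snd ℝ (L2 d) (L2 d × L2 d)))
    (continuous_bilin_family_apply (continuous_nlM σ) id continuous_id continuous_id hXc.fst hXc.fst)
    h.eqM ht
  obtain ⟨C, hC⟩ := exists_schSymbol_mul_decay_bound (d := d) σ
  refine ⟨_, _, _, 𝓕⁻ (mulL (fun ξ => (schSymbol ξ : ℂ) * decay σ ξ) (flowS t (X t).1)),
    phys σ (mulL (ph brkNeg t) (X t).2.1), phys σ (mulL (ph brk t) (X t).2.2),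
    (1 / 2 : ℂ) • prodL σ (flowS t (X t).1) (flowN t (X t).2),
    prodL σ (flowS t (X t).1) (flowR t (X t).1),
    𝓕⁻ (mulL brkInv (cv σ (flowS t (X t).1) (flowR t (X t).1))), hU, hP, hM,
    ?_, ?_, ?_, ?_, ?_, ?_, ?_, ?_, ?_⟩
  · rw [isFourierMultiplier_iff, solU, fourier_phys, fourier_invFourier]
    filter_upwards [mulL_coe (measurable_schSymbol_mul_decay σ) hC (flowS t (X t).1),
      mulL_decay_coe σ (flowS t (X t).1)] with ξ h1 h2
    rw [h1, h2, schSymbol, mul_assoc]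
  · rw [solP, flowQ_apply]
    exact isFourierMultiplier_brk_phys _
  · rw [solM, flowQ_apply]
    exact isFourierMultiplier_brk_phys _
  · have e : phys σ (flowN t (X t).2) = solP σ X t + solM σ X t := by
      rw [flowN_apply, phys_add, solP, solM]
    filter_upwards [Lp.coeFn_smul (1 / 2 : ℂ) (prodL σ (flowS t (X t).1) (flowN t (X t).2)),
      prodL_coe σ (flowS t (X t).1) (flowN t (X t).2), Lp.coeFn_add (solP σ X t) (solM σ X t)]
      with x h1 h2 h3
    rw [h1, Pi.smul_apply, h2, e, h3, Pi.add_apply, solU, smul_eq_mul]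
    ring
  · have h1 := phys_conjRefl σ (flowS t (X t).1)
    filter_upwards [prodL_coe σ (flowS t (X t).1) (flowR t (X t).1), h1] with x h2 h3
    rw [h2, flowR_apply, ← flowS_apply, h3, Complex.mul_conj, solU, Complex.normSq_eq_norm_sq]
  · rw [isFourierMultiplier_iff, fourier_cv, fourier_invFourier]
    exact mulL_brkInv_coe _
  · refine fourier_inj ?_
    rw [fourier_lin, fourier_neg, fourier_invFourier, fourier_invFourier,
      FourierTransform.fourier_smul, fourier_cv, smul_add, smul_smul, smul_smul,
      show Complex.I * (Complex.I / 2) = -(1 / 2) by linear_combination Complex.I_mul_I / 2,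
      Complex.I_mul_I]
    module
  · refine fourier_inj ?_
    rw [sub_eq_add_neg, fourier_lin, fourier_neg, fourier_neg, fourier_invFourier, fourier_phys,
      fourier_invFourier, nlP_apply, map_smul, map_smul, mulL_ph_neg_cancel measurable_brkNeg,
      smul_add, smul_smul, smul_smul, Complex.I_mul_I, ← mul_assoc, Complex.I_mul_I]
    module
  · refine fourier_inj ?_
    rw [fourier_lin, fourier_invFourier, fourier_phys, fourier_invFourier, nlM_apply, map_smul,
      map_smul, mulL_ph_neg_cancel measurable_brk, smul_add, smul_smul,
      smul_smul, mul_neg, Complex.I_mul_I, ← mul_assoc, Complex.I_mul_I]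
    module

theorem IsProfile.isSolution {δ B : ℝ} {x₀ : L2Triple d} {F : ℝ → L2Triple d}
    (h : IsProfile σ δ B x₀ F) :
    IsSolution σ δ (phys σ x₀.1) (phys σ (mulL brkInv x₀.2.1)) (phys σ (mulL brkInv x₀.2.2))
      (solU σ (curve (volume.restrict (Set.Icc 0 δ)) x₀ F))
      (solP σ (curve (volume.restrict (Set.Icc 0 δ)) x₀ F))
      (solM σ (curve (volume.restrict (Set.Icc 0 δ)) x₀ F)) := by
  have hXc : Continuous (curve (volume.restrict (Set.Icc 0 δ)) x₀ F) :=
    continuous_curve x₀ h.integrable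
  have h0 : curve (volume.restrict (Set.Icc 0 δ)) x₀ F 0 = x₀ := by simp [curve]
  refine ⟨?_, ?_, ?_, ?_, ?_, ?_, fun t ht => h.satisfiesEquationsAt ht⟩
  · exact gevreyContinuous_phys σ (continuous_family_apply continuous_flowS continuous_id hXc.fst)
  · have := gevreyContinuous_phys_brkInv (δ := δ) σ ((continuous_mulL_ph measurable_brkNeg).comp
      (continuous_id.prodMk hXc.snd.fst))
    simp only [Function.comp_def, id, ← flowQ_apply] at this
    exact this
  · have := gevreyContinuous_phys_brkInv (δ := δ) σ ((continuous_mulL_ph measurable_brk).comp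
      (continuous_id.prodMk hXc.snd.snd))
    simp only [Function.comp_def, id, ← flowQ_apply] at this
    exact this
  · rw [solU, h0, flowS_zero]
  · rw [solP, h0, flowQ_zero measurable_brkNeg]
  · rw [solM, h0, flowQ_zero measurable_brk]

end Assemble

/-! ### Uniqueness by Gronwall's inequality -/

section Uniqueness

variable {d : ℕ} {σ : ℝ} [hσ : Fact (0 < σ)]

theorem norm_le_of_ae_le_add {V : Type*} [MeasurableSpace V] {μ : Measure V} {F a b c : Lp ℂ 2 μ}
    {M : ℝ} (hM : 0 ≤ M)
    (h : ∀ᵐ x ∂μ, ‖F x‖ ≤ M * (‖a x‖ + ‖b x‖ + ‖c x‖)) : ‖F‖ ≤ M * (‖a‖ + ‖b‖ + ‖c‖) := by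
  have hn : ∀ f : Lp ℂ 2 μ, AEStronglyMeasurable (fun x => ‖f x‖) μ := fun f =>
    (Lp.aestronglyMeasurable f).norm
  have h1 : ‖F‖ₑ ≤ ENNReal.ofReal M * (‖a‖ₑ + ‖b‖ₑ + ‖c‖ₑ) := by
    rw [Lp.enorm_def]
    calc _ ≤ eLpNorm (M • ((fun x => ‖a x‖) + (fun x => ‖b x‖) + fun x => ‖c x‖)) 2 μ :=
          eLpNorm_mono_ae_real h
      _ = ENNReal.ofReal M * eLpNorm ((fun x => ‖a x‖) + (fun x => ‖b x‖) + fun x => ‖c x‖) 2 μ := by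
          rw [eLpNorm_const_smul, ← ofReal_norm, Real.norm_of_nonneg hM]
      _ ≤ _ := by
          refine mul_le_mul' le_rfl ((eLpNorm_add_le ((hn a).add (hn b)) (hn c) (by norm_num)).trans ?_)
          refine add_le_add ((eLpNorm_add_le (hn a) (hn b) (by norm_num)).trans ?_) ?_
          · rw [eLpNorm_norm, eLpNorm_norm, Lp.enorm_def, Lp.enorm_def]
          · rw [eLpNorm_norm, Lp.enorm_def]
  have h2 := ENNReal.toReal_mono (by finiteness) h1
  rwa [toReal_enorm, ENNReal.toReal_mul, ENNReal.toReal_ofReal hM, ENNReal.toReal_add (by finiteness)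
    (by finiteness), ENNReal.toReal_add (by finiteness) (by finiteness), toReal_enorm, toReal_enorm,
    toReal_enorm] at h2

theorem exists_continuousOn_of_enorm {δ : ℝ} {g : ℝ → L2 d}
    (h : ∀ t ∈ Set.Icc 0 δ, Filter.Tendsto (fun t' => ‖g t' - g t‖ₑ)
      (nhdsWithin t (Set.Icc 0 δ)) (nhds 0)) : ∃ C : ℝ, ∀ t ∈ Set.Icc 0 δ, ‖g t‖ ≤ C := by
  have hc : ContinuousOn g (Set.Icc 0 δ) := fun t ht => by
    rw [ContinuousWithinAt, tendsto_iff_norm_sub_tendsto_zero]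
    have := (ENNReal.tendsto_toReal ENNReal.zero_ne_top).comp (h t ht)
    simpa [Function.comp_def] using this
  exact isCompact_Icc.exists_bound_of_continuousOn hc

/-- Continuity on a compact interval bounds the Gevrey norm, and for σ > 0 that norm controls the
supremum with the constant `decayNorm`. -/
theorem GevreyContinuous.exists_ae_bound_zero {δ : ℝ} {f : ℝ → L2 d}
    (h : GevreyContinuous σ 0 δ f) :
    ∃ M : ℝ, ∀ t ∈ Set.Icc 0 δ, ∀ᵐ x, ‖f t x‖ ≤ M := by
  have h1 : ∀ t, ∃ g : L2 d, t ∈ Set.Icc 0 δ → f t = phys σ g := fun t => by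
    by_cases ht : t ∈ Set.Icc 0 δ
    · obtain ⟨g, hg⟩ := exists_eq_phys σ (h t ht).1
      exact ⟨g, fun _ => hg⟩
    · exact ⟨0, fun h => absurd h ht⟩
  choose g hg using h1
  obtain ⟨C, hC⟩ := exists_continuousOn_of_enorm (g := g) fun t ht => by
    refine (h t ht).2.congr' ?_
    filter_upwards [self_mem_nhdsWithin] with t' ht'
    rw [hg t' ht', hg t ht, ← phys_sub, gevreyNorm_phys_zero]
  refine ⟨decayNorm σ d * C, fun t ht => ?_⟩
  filter_upwards [ae_norm_phys_le σ (g t)] with x hx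
  rw [hg t ht]
  exact hx.trans (mul_le_mul_of_nonneg_left (hC t ht) ENNReal.toReal_nonneg)

theorem GevreyContinuous.exists_ae_bound_one {δ : ℝ} {f : ℝ → L2 d}
    (h : GevreyContinuous σ 1 δ f) :
    ∃ M : ℝ, ∀ t ∈ Set.Icc 0 δ, ∀ᵐ x, ‖f t x‖ ≤ M := by
  have h1 : ∀ t, ∃ g : L2 d, t ∈ Set.Icc 0 δ → f t = phys σ (mulL brkInv g) := fun t => by
    by_cases ht : t ∈ Set.Icc 0 δ
    · obtain ⟨g, hg⟩ := exists_eq_phys_brkInv σ (h t ht).1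
      exact ⟨g, fun _ => hg⟩
    · exact ⟨0, fun h => absurd h ht⟩
  choose g hg using h1
  obtain ⟨C, hC⟩ := exists_continuousOn_of_enorm (g := g) fun t ht => by
    refine (h t ht).2.congr' ?_
    filter_upwards [self_mem_nhdsWithin] with t' ht'
    rw [hg t' ht', hg t ht, ← phys_sub, ← map_sub, gevreyNorm_phys_one]
  refine ⟨decayNorm σ d * C, fun t ht => ?_⟩
  filter_upwards [ae_norm_phys_le σ (mulL brkInv (g t))] with x hx
  rw [hg t ht]
  refine hx.trans (mul_le_mul_of_nonneg_left ?_ ENNReal.toReal_nonneg)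
  have := norm_mulL_le continuous_brkInv.measurable norm_brkInv_le (g t)
  rw [one_mul] at this
  exact this.trans (hC t ht)

theorem IsSolution.exists_ae_bound {δ : ℝ} {u₀ φp φm : L2 d} {u np nm : ℝ → L2 d}
    (h : IsSolution σ δ u₀ φp φm u np nm) :
    ∃ M : ℝ, 0 ≤ M ∧ ∀ t ∈ Set.Icc 0 δ, ∀ᵐ x, ‖u t x‖ ≤ M ∧ ‖np t x‖ ≤ M ∧ ‖nm t x‖ ≤ M := by
  obtain ⟨M1, h1⟩ := h.cont_u.exists_ae_bound_zero
  obtain ⟨M2, h2⟩ := h.cont_np.exists_ae_bound_one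
  obtain ⟨M3, h3⟩ := h.cont_nm.exists_ae_bound_one
  refine ⟨max 0 (max M1 (max M2 M3)), le_max_left _ _, fun t ht => ?_⟩
  filter_upwards [h1 t ht, h2 t ht, h3 t ht] with x e1 e2 e3
  exact ⟨e1.trans (by simp), e2.trans (by simp), e3.trans (by simp)⟩

/-- The Fourier transform as a real-linear map. -/
def fourierL (d : ℕ) : L2 d →L[ℝ] L2 d :=
  ((Lp.fourierTransformₗᵢ (Space d) ℂ).toLinearIsometry.toContinuousLinearMap).restrictScalars ℝ

theorem fourierL_apply (f : L2 d) : fourierL d f = 𝓕 f := rfl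

/-- The profile `e^{itm} f̂(t)` of a function of time. -/
def prof (m : Space d → ℝ) (f : ℝ → L2 d) (t : ℝ) : L2 d := mulL (ph m t) (𝓕 (f t))

theorem norm_prof_sub {m : Space d → ℝ} (hm : Measurable m) (f g : ℝ → L2 d) (t : ℝ) :
    ‖prof m f t - prof m g t‖ = ‖f t - g t‖ := by
  rw [prof, prof, ← map_sub, norm_mulL_ph hm]
  have : (𝓕 (f t) - 𝓕 (g t) : L2 d) = 𝓕 (f t - g t) :=
    ((Lp.fourierTransformₗᵢ (Space d) ℂ).map_sub _ _).symm
  rw [this, Lp.norm_fourier_eq]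

theorem hasDerivWithinAt_prof {m : Space d → ℝ} (hm : Measurable m) {f : ℝ → L2 d} {f' g : L2 d}
    {s : Set ℝ} {t : ℝ} (hf : HasDerivWithinAt f f' s t)
    (hg : (𝓕 g : L2 d) =ᵐ[volume] fun ξ => (m ξ : ℂ) * (𝓕 (f t) : L2 d) ξ) :
    HasDerivWithinAt (prof m f) (mulL (ph m t) (𝓕 (f' + Complex.I • g))) s t := by
  have h1 := (fourierL d).hasFDerivAt.comp_hasDerivWithinAt t hf
  have h2 := HasDerivWithinAt.mulL_ph hm h1 hg
  refine h2.congr_deriv ?_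
  rw [FourierTransform.fourier_add, FourierTransform.fourier_smul, map_add, map_smul,
    fourierL_apply]

/-- Minus the Schrödinger symbol. -/
def schNeg (ξ : Space d) : ℝ := -schSymbol ξ

theorem measurable_schNeg : Measurable (schNeg : Space d → ℝ) := measurable_schSymbol.neg

/-- Multiplying by the inverse flow cancels the unbounded linear terms. The derivative of each
profile is an isometric image of the nonlinearity. -/
theorem SatisfiesEquationsAt.exists_deriv {δ : ℝ} {u np nm : ℝ → L2 d} {t : ℝ}
    (h : SatisfiesEquationsAt δ u np nm t) :
    ∃ P Q R : L2 d,
      HasDerivWithinAt (prof schNeg u) (mulL (ph schNeg t) (𝓕 (Complex.I • P))) (Set.Icc 0 δ) t ∧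
      HasDerivWithinAt (prof brk np) (mulL (ph brk t) (𝓕 (Complex.I • R))) (Set.Icc 0 δ) t ∧
      HasDerivWithinAt (prof brkNeg nm) (mulL (ph brkNeg t) (𝓕 (-Complex.I • R))) (Set.Icc 0 δ) t ∧
      (P =ᵐ[volume] fun x => u t x * ((np t x + nm t x) / 2)) ∧
      (Q =ᵐ[volume] fun x => ((‖u t x‖ ^ 2 : ℝ) : ℂ)) ∧
      (𝓕 R : L2 d) = mulL brkInv (𝓕 Q : L2 d) := by
  obtain ⟨ut, npt, nmt, Lu, Dnp, Dnm, P, Q, R, h1, h2, h3, h4, h5, h6, h7, h8, h9, e1, e2, e3⟩ := h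
  refine ⟨P, Q, R, ?_, ?_, ?_, h7, h8, ?_⟩
  · have := hasDerivWithinAt_prof (g := -Lu) measurable_schNeg h1 (by
      rw [fourier_neg]
      filter_upwards [Lp.coeFn_neg (𝓕 Lu : L2 d), h4] with ξ e1 e2
      rw [e1, Pi.neg_apply, e2]
      simp [schNeg, schSymbol])
    refine this.congr_deriv ?_
    congr 2
    have e := congrArg (fun z => -Complex.I • z) e1
    simp only [smul_add, smul_smul, neg_mul, Complex.I_mul_I, neg_neg, one_smul, smul_neg,
      neg_smul] at e ⊢
    rw [← e]
  · have := hasDerivWithinAt_prof (g := Dnp) measurable_brk h2 h5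
    refine this.congr_deriv ?_
    congr 2
    have e := congrArg (fun z => -Complex.I • z) e2
    simp only [smul_sub, smul_smul, neg_mul, Complex.I_mul_I, neg_neg, one_smul, smul_neg,
      neg_smul] at e ⊢
    rw [← e]; abel
  · have := hasDerivWithinAt_prof (g := -Dnm) measurable_brkNeg h3 (by
      rw [fourier_neg]
      filter_upwards [Lp.coeFn_neg (𝓕 Dnm : L2 d), h6] with ξ e1 e2
      rw [e1, Pi.neg_apply, e2]
      simp [brkNeg, brk])
    refine this.congr_deriv ?_
    congr 2
    have e := congrArg (fun z => -Complex.I • z) e3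
    simp only [smul_add, smul_smul, neg_mul, Complex.I_mul_I, neg_neg, one_smul, smul_neg,
      neg_smul] at e ⊢
    rw [← e]
  · refine Lp.ext ?_
    filter_upwards [mulL_brkInv_coe (𝓕 Q : L2 d), h9] with ξ e1 e2
    rw [e1, e2]
    rfl

theorem norm_deriv_sub_le {m : Space d → ℝ} (hm : Measurable m) (t : ℝ) {c : ℂ} (hc : ‖c‖ = 1)
    (P P' : L2 d) :
    ‖mulL (ph m t) (𝓕 (c • P) : L2 d) - mulL (ph m t) (𝓕 (c • P') : L2 d)‖ = ‖P - P'‖ := by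
  have : (𝓕 (c • P) - 𝓕 (c • P') : L2 d) = 𝓕 (c • P - c • P') :=
    ((Lp.fourierTransformₗᵢ (Space d) ℂ).map_sub _ _).symm
  rw [← map_sub, norm_mulL_ph hm, this, Lp.norm_fourier_eq, ← smul_sub, norm_smul, hc, one_mul]

theorem norm_fourier_sub (f g : L2 d) : ‖(𝓕 f : L2 d) - 𝓕 g‖ = ‖f - g‖ := by
  rw [← dist_eq_norm, ← dist_eq_norm]
  exact (Lp.fourierTransformₗᵢ (Space d) ℂ).dist_map f g

theorem norm_sub_brkInv_le {Q Q' R R' : L2 d} (h : (𝓕 R : L2 d) = mulL brkInv (𝓕 Q : L2 d))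
    (h' : (𝓕 R' : L2 d) = mulL brkInv (𝓕 Q' : L2 d)) : ‖R - R'‖ ≤ ‖Q - Q'‖ := by
  have h1 := norm_mulL_le continuous_brkInv.measurable norm_brkInv_le ((𝓕 Q : L2 d) - 𝓕 Q')
  rwa [map_sub, ← h, ← h', norm_fourier_sub, norm_fourier_sub, one_mul] at h1

theorem norm_sq_sub_le (a b : ℂ) {M : ℝ} (ha : ‖a‖ ≤ M) (hb : ‖b‖ ≤ M) :
    ‖((‖a‖ ^ 2 : ℝ) : ℂ) - ((‖b‖ ^ 2 : ℝ) : ℂ)‖ ≤ 2 * M * ‖a - b‖ := by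
  rw [← Complex.ofReal_sub, Complex.norm_real, Real.norm_eq_abs, sq_sub_sq, abs_mul,
    abs_of_nonneg (by positivity)]
  exact mul_le_mul (by linarith) (abs_norm_sub_norm_le a b) (abs_nonneg _)
    (by linarith [norm_nonneg a])

theorem norm_prod_sub_le (a b c a' b' c' : ℂ) {M : ℝ} (hb : ‖b‖ ≤ M) (hc : ‖c‖ ≤ M)
    (ha : ‖a'‖ ≤ M) :
    ‖a * ((b + c) / 2) - a' * ((b' + c') / 2)‖ ≤ M * (‖a - a'‖ + ‖b - b'‖ + ‖c - c'‖) := by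
  have e : a * ((b + c) / 2) - a' * ((b' + c') / 2) =
      (a - a') * ((b + c) / 2) + a' * ((b - b') / 2) + a' * ((c - c') / 2) := by ring
  have h2 : ∀ z : ℂ, ‖z / 2‖ = ‖z‖ / 2 := fun z => by simp
  rw [e]
  refine (norm_add₃_le).trans ?_
  rw [norm_mul, norm_mul, norm_mul, h2, h2, h2]
  have h3 : ‖b + c‖ / 2 ≤ M := by have := norm_add_le b c; linarith
  have hM : 0 ≤ M := (norm_nonneg _).trans hb
  have i1 := mul_le_mul_of_nonneg_left h3 (norm_nonneg (a - a'))
  have i2 := mul_le_mul_of_nonneg_right ha (norm_nonneg (b - b'))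
  have i3 := mul_le_mul_of_nonneg_right ha (norm_nonneg (c - c'))
  nlinarith [norm_nonneg (b - b'), norm_nonneg (c - c'), mul_nonneg hM (norm_nonneg (b - b')),
    mul_nonneg hM (norm_nonneg (c - c'))]

/-- The pointwise bounds make the nonlinearities Lipschitz in L² along the two solutions, with one
constant for all times. Gronwall's inequality for the difference of the profiles needs nothing from
the construction of a solution. -/
theorem IsSolution.unique {δ : ℝ} {u₀ φp φm : L2 d} {u np nm v mp mm : ℝ → L2 d}
    (h : IsSolution σ δ u₀ φp φm u np nm) (h' : IsSolution σ δ u₀ φp φm v mp mm) :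
    ∀ t ∈ Set.Icc 0 δ, v t = u t ∧ mp t = np t ∧ mm t = nm t := by
  obtain ⟨M, hM0, hM⟩ := h.exists_ae_bound
  obtain ⟨M', hM0', hM'⟩ := h'.exists_ae_bound
  set K := max M M' with hK
  have hK0 : 0 ≤ K := hM0.trans (le_max_left _ _)
  set E : ℝ → L2Triple d := fun t => (prof schNeg u t - prof schNeg v t,
    prof brk np t - prof brk mp t, prof brkNeg nm t - prof brkNeg mm t) with hE
  have hd : ∀ t ∈ Set.Icc 0 δ, ∃ E' : L2Triple d, HasDerivWithinAt E E' (Set.Icc 0 δ) t ∧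
      ‖E'‖ ≤ 3 * K * ‖E t‖ := by
    intro t ht
    obtain ⟨P, Q, R, a1, a2, a3, a4, a5, a6⟩ := (h.eqs t ht).exists_deriv
    obtain ⟨P', Q', R', b1, b2, b3, b4, b5, b6⟩ := (h'.eqs t ht).exists_deriv
    refine ⟨_, (a1.sub b1).prodMk ((a2.sub b2).prodMk (a3.sub b3)), ?_⟩
    have n1 : ‖u t - v t‖ ≤ ‖E t‖ := by
      rw [← norm_prof_sub measurable_schNeg]; exact norm_fst_le (E t)
    have n2 : ‖np t - mp t‖ ≤ ‖E t‖ := by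
      rw [← norm_prof_sub measurable_brk]; exact (norm_fst_le (E t).2).trans (norm_snd_le (E t))
    have n3 : ‖nm t - mm t‖ ≤ ‖E t‖ := by
      rw [← norm_prof_sub measurable_brkNeg]; exact (norm_snd_le (E t).2).trans (norm_snd_le (E t))
    have hP : ‖P - P'‖ ≤ 3 * K * ‖E t‖ := by
      have := norm_le_of_ae_le_add (F := P - P') (a := u t - v t) (b := np t - mp t)
        (c := nm t - mm t) hK0 (by
          filter_upwards [hM t ht, hM' t ht, a4, b4, Lp.coeFn_sub P P', Lp.coeFn_sub (u t) (v t),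
            Lp.coeFn_sub (np t) (mp t), Lp.coeFn_sub (nm t) (mm t)] with x m1 m2 e1 e2 e3 e4 e5 e6
          rw [e3, e4, e5, e6, Pi.sub_apply, Pi.sub_apply, Pi.sub_apply, Pi.sub_apply, e1, e2]
          exact norm_prod_sub_le _ _ _ _ _ _ (m1.2.1.trans (le_max_left _ _))
            (m1.2.2.trans (le_max_left _ _)) (m2.1.trans (le_max_right _ _)))
      nlinarith
    have hQ : ‖Q - Q'‖ ≤ 3 * K * ‖E t‖ := by
      have : ‖Q - Q'‖ ≤ 2 * K * ‖u t - v t‖ := by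
        refine Lp.norm_le_mul_norm_of_ae_le_mul ?_
        filter_upwards [hM t ht, hM' t ht, a5, b5, Lp.coeFn_sub Q Q', Lp.coeFn_sub (u t) (v t)]
          with x m1 m2 e1 e2 e3 e4
        rw [e3, e4, Pi.sub_apply, Pi.sub_apply, e1, e2]
        exact norm_sq_sub_le _ _ (m1.1.trans (le_max_left _ _)) (m2.1.trans (le_max_right _ _))
      nlinarith [norm_nonneg (E t), mul_nonneg hK0 (norm_nonneg (E t))]
    have hR := (norm_sub_brkInv_le a6 b6).trans hQ
    refine max_le ?_ (max_le ?_ ?_)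
    · exact (norm_deriv_sub_le measurable_schNeg t (by simp) P P').le.trans hP
    · exact (norm_deriv_sub_le measurable_brk t (by simp) R R').le.trans hR
    · exact (norm_deriv_sub_le measurable_brkNeg t (by simp) R R').le.trans hR
  have hd' : ∀ t, ∃ E' : L2Triple d, t ∈ Set.Icc 0 δ → HasDerivWithinAt E E' (Set.Icc 0 δ) t ∧
      ‖E'‖ ≤ 3 * K * ‖E t‖ := fun t => by
    by_cases ht : t ∈ Set.Icc 0 δ
    · obtain ⟨E', h1⟩ := hd t ht
      exact ⟨E', fun _ => h1⟩
    · exact ⟨0, fun h => absurd h ht⟩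
  choose E' hE' using hd'
  have hzero : ∀ t ∈ Set.Icc 0 δ, ‖E t‖ ≤ 0 := by
    intro t ht
    -- The named argument `δ := 0` is the initial difference; the lifespan enters as `b`.
    have := norm_le_gronwallBound_of_norm_deriv_right_le (f := E) (f' := E') (δ := 0) (K := 3 * K)
      (ε := 0) (a := 0) (b := δ) (fun t ht => (hE' t ht).1.continuousWithinAt)
      (fun t ht => ((hE' t ⟨ht.1, ht.2.le⟩).1).mono_of_mem_nhdsWithin
        (Icc_mem_nhdsGE_of_mem ht)) (by
        rw [hE]
        simp only [prof, h.init_u, h'.init_u, h.init_np, h'.init_np, h.init_nm, h'.init_nm, sub_self]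
        simp)
      (fun t ht => by rw [add_zero]; exact (hE' t ⟨ht.1, ht.2.le⟩).2) t ht
    simpa [gronwallBound] using this
  intro t ht
  have hz : E t = 0 := norm_le_zero_iff.1 (hzero t ht)
  have z1 : prof schNeg u t - prof schNeg v t = 0 := congrArg Prod.fst hz
  have z2 : prof brk np t - prof brk mp t = 0 := congrArg (fun z => z.2.1) hz
  have z3 : prof brkNeg nm t - prof brkNeg mm t = 0 := congrArg (fun z => z.2.2) hz
  have key : ∀ {m : Space d → ℝ}, Measurable m → ∀ f g : ℝ → L2 d, prof m f t - prof m g t = 0 →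
      g t = f t := fun {m} hm f g hfg => by
    have := norm_prof_sub hm f g t
    rw [hfg, norm_zero] at this
    exact (sub_eq_zero.1 (norm_eq_zero.1 this.symm)).symm
  exact ⟨key measurable_schNeg _ _ z1, key measurable_brk _ _ z2, key measurable_brkNeg _ _ z3⟩

end Uniqueness

/-! ### Space-time functions and functions of time with values in L² -/

section Slices

variable {d : ℕ}

theorem measurePreserving_toLp (d : ℕ) :
    MeasurePreserving (fun z : ℝ × Space d => (WithLp.toLp 2 z : SpaceTime d)) :=
  WithLp.volume_preserving_toLp ℝ (Space d)

theorem ae_ae_of_ae_spaceTime {p : SpaceTime d → Prop} (h : ∀ᵐ z, p z) :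
    ∀ᵐ t : ℝ, ∀ᵐ x : Space d, p (WithLp.toLp 2 (t, x)) :=
  Measure.ae_ae_of_ae_prod ((measurePreserving_toLp d).quasiMeasurePreserving.ae h)

theorem lintegral_spaceTime {f : SpaceTime d → ℝ≥0∞} (hf : AEMeasurable f) :
    ∫⁻ z, f z = ∫⁻ t : ℝ, ∫⁻ x : Space d, f (WithLp.toLp 2 (t, x)) := by
  have h := (measurePreserving_toLp d).lintegral_comp_emb
    (MeasurableEquiv.toLp 2 (ℝ × Space d)).measurableEmbedding f
  rw [← h, Measure.volume_eq_prod]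
  exact lintegral_prod _
    (hf.comp_quasiMeasurePreserving (measurePreserving_toLp d).quasiMeasurePreserving)

/-- The function `g` on space-time has the time slices `k t`. -/
def Slices (k : ℝ → L2 d) (g : SpaceTime d → ℂ) : Prop :=
  ∀ᵐ t : ℝ, ∀ᵐ x : Space d, g (WithLp.toLp 2 (t, x)) = k t x

theorem eLpNorm_two_eq {V F : Type*} [MeasurableSpace V] {μ : Measure V} [NormedAddCommGroup F]
    (f : V → F) : eLpNorm f 2 μ = (∫⁻ x, ‖f x‖ₑ ^ (2 : ℝ) ∂μ) ^ (1 / 2 : ℝ) := by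
  rw [eLpNorm_eq_lintegral_rpow_enorm_toReal (by norm_num) (by norm_num)]
  norm_num

theorem enorm_rpow_two_eq {V F : Type*} [MeasurableSpace V] {μ : Measure V} [NormedAddCommGroup F]
    (f : Lp F 2 μ) : ‖f‖ₑ ^ (2 : ℝ) = ∫⁻ x, ‖f x‖ₑ ^ (2 : ℝ) ∂μ := by
  rw [Lp.enorm_def, eLpNorm_two_eq, ← ENNReal.rpow_mul]
  norm_num

theorem Slices.enorm_eq {k : Lp (L2 d) 2 (volume : Measure ℝ)} {g : L2ST d} (h : Slices k g) :
    ‖g‖ₑ = ‖k‖ₑ := by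
  have h1 : ‖g‖ₑ ^ (2 : ℝ) = ‖k‖ₑ ^ (2 : ℝ) := by
    rw [enorm_rpow_two_eq, enorm_rpow_two_eq,
      lintegral_spaceTime ((Lp.aestronglyMeasurable g).enorm.pow_const _)]
    refine lintegral_congr_ae ?_
    filter_upwards [h] with t ht
    rw [enorm_rpow_two_eq]
    refine lintegral_congr_ae ?_
    filter_upwards [ht] with x hx
    rw [hx]
  exact (ENNReal.rpow_left_injective (by norm_num)) h1

theorem Slices.sub {k k' : Lp (L2 d) 2 (volume : Measure ℝ)} {g g' : L2ST d} (h : Slices k g)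
    (h' : Slices k' g') : Slices (k - k' : Lp (L2 d) 2 (volume : Measure ℝ)) (g - g' : L2ST d) := by
  filter_upwards [h, h', ae_ae_of_ae_spaceTime (Lp.coeFn_sub g g'), Lp.coeFn_sub k k']
    with t h1 h2 h3 h4
  filter_upwards [h1, h2, h3, Lp.coeFn_sub (k t) (k' t)] with x e1 e2 e3 e4
  rw [h4, Pi.sub_apply, e4, e3, Pi.sub_apply, Pi.sub_apply, e1, e2]

theorem Slices.add {k k' : Lp (L2 d) 2 (volume : Measure ℝ)} {g g' : L2ST d} (h : Slices k g)
    (h' : Slices k' g') : Slices (k + k' : Lp (L2 d) 2 (volume : Measure ℝ)) (g + g' : L2ST d) := by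
  filter_upwards [h, h', ae_ae_of_ae_spaceTime (Lp.coeFn_add g g'), Lp.coeFn_add k k']
    with t h1 h2 h3 h4
  filter_upwards [h1, h2, h3, Lp.coeFn_add (k t) (k' t)] with x e1 e2 e3 e4
  rw [h4, Pi.add_apply, e4, e3, Pi.add_apply, Pi.add_apply, e1, e2]

theorem Slices.congr {k k' : ℝ → L2 d} {g g' : SpaceTime d → ℂ} (h : Slices k g)
    (hk : k =ᵐ[volume] k') (hg : g =ᵐ[volume] g') : Slices k' g' := by
  filter_upwards [h, hk, ae_ae_of_ae_spaceTime hg] with t h1 h2 h3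
  filter_upwards [h1, h3] with x e1 e2
  rw [← e2, e1, h2]

theorem ae_eq_of_tendsto_Lp {V : Type*} [MeasurableSpace V] {μ : Measure V}
    {f : ℕ → Lp ℂ 2 μ} {g : Lp ℂ 2 μ} (h : Filter.Tendsto f Filter.atTop (nhds g)) {g' : V → ℂ}
    (h' : ∀ᵐ x ∂μ, Filter.Tendsto (fun n => f n x) Filter.atTop (nhds (g' x))) : g' =ᵐ[μ] g := by
  obtain ⟨ns, hns, h3⟩ := (tendstoInMeasure_of_tendsto_Lp h).exists_seq_tendsto_ae
  filter_upwards [h3, h'] with x e1 e2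
  exact tendsto_nhds_unique (e2.comp hns.tendsto_atTop) e1

theorem Slices.of_tendsto {k : ℕ → Lp (L2 d) 2 (volume : Measure ℝ)}
    {k₀ : Lp (L2 d) 2 (volume : Measure ℝ)} {g : ℕ → L2ST d} {g₀ : L2ST d}
    (h : ∀ n, Slices (k n) (g n)) (hk : Filter.Tendsto k Filter.atTop (nhds k₀))
    (hg : Filter.Tendsto g Filter.atTop (nhds g₀)) : Slices k₀ g₀ := by
  obtain ⟨ns, hns, h1⟩ := (tendstoInMeasure_of_tendsto_Lp hk).exists_seq_tendsto_ae
  obtain ⟨ms, hms, h2⟩ := (tendstoInMeasure_of_tendsto_Lp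
    (hg.comp hns.tendsto_atTop)).exists_seq_tendsto_ae
  filter_upwards [h1, ae_ae_of_ae_spaceTime h2, ae_all_iff.2 h] with t e1 e2 e3
  refine ae_eq_of_tendsto_Lp (e1.comp hms.tendsto_atTop) ?_
  filter_upwards [e2, ae_all_iff.2 fun n => e3 (ns (ms n))] with x e4 e5
  refine e4.congr fun n => ?_
  exact e5 n

/-- The Fourier transform in the space variable of a function with values in `L²`. -/
def spaceFourier : Lp (L2 d) 2 (volume : Measure ℝ) →L[ℂ] Lp (L2 d) 2 (volume : Measure ℝ) :=
  ((Lp.fourierTransformₗᵢ (Space d) ℂ).toLinearIsometry.toContinuousLinearMap).compLpL 2 volume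

theorem spaceFourier_coe (k : Lp (L2 d) 2 (volume : Measure ℝ)) :
    spaceFourier k =ᵐ[volume] fun t => (𝓕 (k t) : L2 d) :=
  ContinuousLinearMap.coeFn_compLp _ k

/-- `k` comes from a function on space-time with the corresponding Fourier transform. -/
def HasST (k : Lp (L2 d) 2 (volume : Measure ℝ)) : Prop :=
  ∃ g : L2ST d, Slices k g ∧
    Slices (spaceFourier (𝓕 k : Lp (L2 d) 2 (volume : Measure ℝ))) (𝓕 g : L2ST d)

theorem HasST.add {k k' : Lp (L2 d) 2 (volume : Measure ℝ)} (h : HasST k) (h' : HasST k') :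
    HasST (k + k') := by
  obtain ⟨g, h1, h2⟩ := h
  obtain ⟨g', h1', h2'⟩ := h'
  refine ⟨g + g', h1.add h1', ?_⟩
  rw [FourierTransform.fourier_add, FourierTransform.fourier_add, map_add]
  exact h2.add h2'

/-- Taking slices is isometric, so a Cauchy sequence of vector-valued functions gives a Cauchy
sequence on space-time, and both relations of slices pass to the limit. -/
theorem isClosed_hasST : IsClosed {k : Lp (L2 d) 2 (volume : Measure ℝ) | HasST k} := by
  refine IsSeqClosed.isClosed fun k k₀ hk hlim => ?_
  choose g h1 h2 using hk
  have hiso : ∀ n m, dist (g n) (g m) = dist (k n) (k m) := fun n m => by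
    rw [dist_eq_norm, dist_eq_norm]
    exact enorm_eq_iff_norm_eq.1 ((h1 n).sub (h1 m)).enorm_eq
  have hc : CauchySeq g := by
    have := hlim.cauchySeq
    rw [Metric.cauchySeq_iff] at this ⊢
    simpa only [hiso] using this
  obtain ⟨g₀, hg⟩ := cauchySeq_tendsto_of_complete hc
  refine ⟨g₀, Slices.of_tendsto h1 hlim hg, Slices.of_tendsto h2 ?_ ?_⟩
  · exact (spaceFourier.continuous.tendsto _).comp
      (((Lp.fourierTransformₗᵢ ℝ (L2 d)).continuous.tendsto _).comp hlim)
  · exact ((Lp.fourierTransformₗᵢ (SpaceTime d) ℂ).continuous.tendsto _).comp hg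

theorem fourier_tensor (φ : ℝ → ℂ) (ψ : Space d → ℂ) (τ : ℝ) (ξ : Space d) :
    𝓕 (fun z : SpaceTime d => φ z.fst * ψ z.snd) (WithLp.toLp 2 (τ, ξ)) = 𝓕 φ τ * 𝓕 ψ ξ := by
  rw [Real.fourier_eq, Real.fourier_eq, Real.fourier_eq, ← integral_prod_mul,
    ← Measure.volume_eq_prod, ← (measurePreserving_toLp d).integral_comp
      (MeasurableEquiv.toLp 2 (ℝ × Space d)).measurableEmbedding]
  refine integral_congr_ae (Filter.Eventually.of_forall fun z => ?_)
  simp only [WithLp.prod_inner_apply, Circle.smul_def, smul_eq_mul, neg_add, AddChar.map_add_eq_mul,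
    Circle.coe_mul]
  change _ * (φ z.1 * ψ z.2) = _
  ring

theorem integrable_tensor {φ : ℝ → ℂ} {ψ : Space d → ℂ} (hφ : Integrable φ) (hψ : Integrable ψ) :
    Integrable fun z : SpaceTime d => φ z.fst * ψ z.snd := by
  rw [← (measurePreserving_toLp d).integrable_comp_emb
    (MeasurableEquiv.toLp 2 (ℝ × Space d)).measurableEmbedding, Measure.volume_eq_prod]
  exact hφ.mul_prod hψ

theorem memLp_tensor {φ : ℝ → ℂ} {ψ : Space d → ℂ} (hφ : Integrable φ) (hψ : Integrable ψ)
    (hφ2 : MemLp φ 2) (hψ2 : MemLp ψ 2) :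
    MemLp (fun z : SpaceTime d => φ z.fst * ψ z.snd) 2 := by
  rw [memLp_two_iff_integrable_sq_norm (integrable_tensor hφ hψ).1,
    ← (measurePreserving_toLp d).integrable_comp_emb
    (MeasurableEquiv.toLp 2 (ℝ × Space d)).measurableEmbedding, Measure.volume_eq_prod]
  have h := ((memLp_two_iff_integrable_sq_norm hφ.1).1 hφ2).mul_prod
    ((memLp_two_iff_integrable_sq_norm hψ.1).1 hψ2)
  refine h.congr (Filter.Eventually.of_forall fun z => ?_)
  simp [mul_pow]

theorem hasST_indicator_of_integrable {s : Set ℝ} (hs : MeasurableSet s) (hμ : volume s ≠ ∞)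
    {c : L2 d} (hc : Integrable c) : HasST (indicatorConstLp 2 hs hμ c) := by
  set φ : ℝ → ℂ := s.indicator fun _ => 1 with hφ
  have hφi : Integrable φ := (integrable_indicator_iff hs).2 (integrableOn_const hμ)
  have hφ2 : MemLp φ 2 := memLp_indicator_const 2 hs 1 (Or.inr hμ)
  have hm := memLp_tensor hφi hc hφ2 (Lp.memLp c)
  have hk : (indicatorConstLp 2 hs hμ c : Lp (L2 d) 2 (volume : Measure ℝ)) =ᵐ[volume]
      fun t => φ t • c := by
    filter_upwards [indicatorConstLp_coeFn (p := 2) (hs := hs) (hμs := hμ) (c := c)] with t ht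
    rw [ht, hφ]
    by_cases h : t ∈ s <;> simp [h]
  have hki : Integrable (fun t => φ t • c) := hφi.smul_const c
  refine ⟨hm.toLp _, ?_, ?_⟩
  · refine Slices.congr (k := fun t => φ t • c) ?_ hk.symm hm.coeFn_toLp.symm
    refine Filter.Eventually.of_forall fun t => ?_
    filter_upwards [Lp.coeFn_smul (φ t) c] with x hx
    rw [hx]; rfl
  · have h1 : (𝓕 (indicatorConstLp 2 hs hμ c) : Lp (L2 d) 2 (volume : Measure ℝ)) =ᵐ[volume]
        fun τ => 𝓕 φ τ • c := by
      refine (lp_fourier_ae_eq _ (hki.congr hk.symm)).trans ?_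
      refine Filter.Eventually.of_forall fun τ => ?_
      simp only
      rw [Real.fourier_congr_ae hk τ, Real.fourier_eq, Real.fourier_eq, ← integral_smul_const]
      refine integral_congr_ae (Filter.Eventually.of_forall fun t => ?_)
      simp only [smul_assoc]
    have h2 : (spaceFourier (𝓕 (indicatorConstLp 2 hs hμ c) : Lp (L2 d) 2 (volume : Measure ℝ)) :
        Lp (L2 d) 2 (volume : Measure ℝ)) =ᵐ[volume] fun τ => 𝓕 φ τ • (𝓕 c : L2 d) := by
      refine (spaceFourier_coe _).trans ?_
      filter_upwards [h1] with τ hτ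
      rw [hτ, FourierTransform.fourier_smul]
    refine Slices.congr (k := fun τ => 𝓕 φ τ • (𝓕 c : L2 d)) ?_ h2.symm
      (fourier_toLp_ae_eq (integrable_tensor hφi hc) hm).symm
    refine Filter.Eventually.of_forall fun τ => ?_
    filter_upwards [Lp.coeFn_smul (𝓕 φ τ) (𝓕 c : L2 d), lp_fourier_ae_eq c hc] with ξ e1 e2
    rw [e1, Pi.smul_apply, e2, fourier_tensor, smul_eq_mul]

/-- The property is closed under sums and limits. On products of an indicator in time and an
integrable function in space it holds because the transform factors. Truncating the spatial factor
and density of simple functions give the general case. -/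
theorem hasST (k : Lp (L2 d) 2 (volume : Measure ℝ)) : HasST k := by
  refine Lp.induction (by norm_num) HasST (fun c s hs hμ => ?_) (fun f g hf hg _ h1 h2 => h1.add h2)
    isClosed_hasST k
  rw [Lp.simpleFunc.coe_indicatorConst]
  change _ ∈ {k : Lp (L2 d) 2 (volume : Measure ℝ) | HasST k}
  refine isClosed_hasST.mem_of_tendsto (f := fun n : ℕ => indicatorConstLp 2 hs hμ.ne (mulL (cut n) c))
    (b := Filter.atTop) ?_ (Filter.Eventually.of_forall fun n =>
      hasST_indicator_of_integrable hs hμ.ne (integrable_mulL_cut n c))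
  rw [tendsto_iff_norm_sub_tendsto_zero]
  have h1 : ∀ n, ‖indicatorConstLp 2 hs hμ.ne (mulL (cut n) c) - indicatorConstLp 2 hs hμ.ne c‖ =
      ‖mulL (cut n) c - c‖ * volume.real s ^ (1 / (2 : ℝ≥0∞).toReal) := fun n => by
    rw [indicatorConstLp_sub, norm_indicatorConstLp (by norm_num) (by norm_num)]
  simp only [h1]
  have h2 := (tendsto_iff_norm_sub_tendsto_zero.1 (tendsto_mulL_cut c)).mul_const
    (volume.real s ^ (1 / (2 : ℝ≥0∞).toReal))
  rwa [zero_mul] at h2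

end Slices

/-! ### A dyadic bound for powers of the bracket -/

section Dyadic

theorem quarter_le_norm_exp_sub_one_sq {y : ℝ} (h1 : 1 ≤ |y|) (h2 : |y| ≤ 2) :
    1 / 4 ≤ ‖Complex.exp ((y : ℝ) * Complex.I) - 1‖ ^ 2 := by
  have h3 : ‖Complex.exp ((y : ℝ) * Complex.I) - 1‖ ^ 2 = 2 - 2 * Real.cos y := by
    rw [Complex.sq_norm, Complex.normSq_apply]
    simp only [Complex.sub_re, Complex.sub_im, Complex.exp_ofReal_mul_I_re,
      Complex.exp_ofReal_mul_I_im, Complex.one_re, Complex.one_im]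
    nlinarith [Real.sin_sq_add_cos_sq y]
  have h4 : Real.cos y ≤ 5 / 9 := by
    rw [← Real.cos_abs]
    exact (Real.cos_le_cos_of_nonneg_of_le_pi (by norm_num) (by linarith [Real.pi_gt_three]) h1).trans
      Real.cos_one_le
  rw [h3]; linarith

/-- A Littlewood-Paley type bound for a power of the bracket. -/
theorem bracket_rpow_le_tsum {b : ℝ} (hb0 : 0 ≤ b) (hb1 : b ≤ 1) (x : ℝ) :
    ENNReal.ofReal (bracket x ^ (2 * b)) ≤ 32 * (1 + ∑' k : ℕ, ENNReal.ofReal (2 ^ (2 * b * k)) *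
      ‖Complex.exp (((2⁻¹ ^ k * x : ℝ) : ℂ) * Complex.I) - 1‖ₑ ^ (2 : ℝ)) := by
  have hbr : bracket x ^ (2 * b) = (1 + x ^ 2) ^ b := by
    rw [bracket, Real.sqrt_eq_rpow, ← Real.rpow_mul (by positivity)]
    congr 1; ring
  rw [hbr]
  rcases le_or_gt |x| 1 with hx | hx
  · have h1 : (1 + x ^ 2) ^ b ≤ 2 := by
      have h2 : x ^ 2 ≤ 1 := by rw [← sq_abs]; nlinarith [abs_nonneg x]
      calc (1 + x ^ 2) ^ b ≤ 2 ^ b := Real.rpow_le_rpow (by positivity) (by linarith) hb0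
        _ ≤ 2 ^ (1 : ℝ) := Real.rpow_le_rpow_of_exponent_le (by norm_num) hb1
        _ = 2 := Real.rpow_one _
    calc _ ≤ ENNReal.ofReal 2 := ENNReal.ofReal_le_ofReal h1
      _ ≤ 32 * 1 := by rw [ENNReal.ofReal_ofNat, mul_one]; norm_num
      _ ≤ _ := mul_le_mul_right le_self_add _
  -- With 2^k ≤ |x| < 2^{k+1} the angle 2^{-k}x has modulus between 1 and 2, so the exponential
  -- stays away from 1 and this single term of the sum suffices.
  · obtain ⟨k, hk1, hk2⟩ := exists_nat_pow_near hx.le (one_lt_two (α := ℝ))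
    have hpos : (0 : ℝ) < 2 ^ k := by positivity
    have habs : |2⁻¹ ^ k * x| = |x| / 2 ^ k := by
      rw [abs_mul, abs_of_nonneg (by positivity), inv_pow]; field_simp
    have h1 : 1 / 4 ≤ ‖Complex.exp (((2⁻¹ ^ k * x : ℝ) : ℂ) * Complex.I) - 1‖ ^ 2 := by
      refine quarter_le_norm_exp_sub_one_sq ?_ ?_
      · rw [habs, le_div_iff₀ hpos]; linarith
      · rw [habs, div_le_iff₀ hpos]; rw [pow_succ] at hk2; linarith
    have h2 : (1 + x ^ 2) ^ b ≤ 8 * 2 ^ (2 * b * k) := by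
      have h3 : 1 + x ^ 2 ≤ 8 * (2 ^ k) ^ 2 := by
        have : x ^ 2 ≤ (2 ^ (k + 1)) ^ 2 := by rw [← sq_abs]; gcongr
        have h1x : 1 ≤ x ^ 2 := by rw [← sq_abs]; nlinarith
        rw [pow_succ (2 : ℝ) k] at this
        nlinarith
      calc (1 + x ^ 2) ^ b ≤ (8 * (2 ^ k) ^ 2) ^ b := Real.rpow_le_rpow (by positivity) h3 hb0
        _ = 8 ^ b * 2 ^ (2 * b * k) := by
          rw [Real.mul_rpow (by norm_num) (by positivity), ← pow_mul, ← Real.rpow_natCast,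
            ← Real.rpow_mul (by norm_num)]
          congr 2; push_cast; ring
        _ ≤ 8 ^ (1 : ℝ) * 2 ^ (2 * b * k) := by
          gcongr
          · norm_num
        _ = _ := by rw [Real.rpow_one]
    calc _ ≤ ENNReal.ofReal (32 * (2 ^ (2 * b * k) *
          ‖Complex.exp (((2⁻¹ ^ k * x : ℝ) : ℂ) * Complex.I) - 1‖ ^ 2)) := by
          refine ENNReal.ofReal_le_ofReal (h2.trans ?_)
          have : (0 : ℝ) < 2 ^ (2 * b * k) := by positivity
          nlinarith
      _ = 32 * (ENNReal.ofReal (2 ^ (2 * b * k)) *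
          ‖Complex.exp (((2⁻¹ ^ k * x : ℝ) : ℂ) * Complex.I) - 1‖ₑ ^ (2 : ℝ)) := by
          rw [ENNReal.ofReal_mul (by norm_num), ENNReal.ofReal_mul (by positivity),
            ENNReal.ofReal_pow (norm_nonneg _), ofReal_norm, ENNReal.ofReal_ofNat, ENNReal.rpow_ofNat]
      _ ≤ _ := by
          refine mul_le_mul_right (le_trans ?_ le_add_self) _
          exact ENNReal.le_tsum (f := fun k : ℕ => ENNReal.ofReal (2 ^ (2 * b * k)) *
            ‖Complex.exp (((2⁻¹ ^ k * x : ℝ) : ℂ) * Complex.I) - 1‖ₑ ^ (2 : ℝ)) k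

theorem bracket_le_of_abs_sub_le {x y : ℝ} (h : |x - y| ≤ 1) : bracket x ≤ 2 * bracket y := by
  have h1 : (2 : ℝ) * bracket y = Real.sqrt (4 * (1 + y ^ 2)) := by
    rw [Real.sqrt_mul (by norm_num), bracket, show (4 : ℝ) = 2 ^ 2 by norm_num,
      Real.sqrt_sq (by norm_num)]
  rw [h1, bracket]
  refine Real.sqrt_le_sqrt ?_
  obtain ⟨h2, h3⟩ := abs_le.1 h
  nlinarith [sq_nonneg (x - 2 * y), sq_nonneg (x - y)]

end Dyadic

/-! ### The modulation weight in terms of increments in time -/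

section VectorFourier

variable {d : ℕ}

theorem eLpNorm_fourier {F : Type*} [NormedAddCommGroup F] [InnerProductSpace ℂ F] [CompleteSpace F]
    {f : ℝ → F} (hf : Integrable f) (h2 : MemLp f 2) :
    eLpNorm (𝓕 f) 2 volume = eLpNorm f 2 volume := by
  rw [← eLpNorm_congr_ae (fourier_toLp_ae_eq hf h2), ← Lp.enorm_def]
  have : ‖(𝓕 (h2.toLp f) : Lp F 2 (volume : Measure ℝ))‖ₑ = ‖h2.toLp f‖ₑ :=
    (Lp.fourierTransformₗᵢ ℝ F).enorm_map _
  rw [this, Lp.enorm_def, eLpNorm_congr_ae h2.coeFn_toLp]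

theorem lintegral_fourier_sq {F : Type*} [NormedAddCommGroup F] [InnerProductSpace ℂ F]
    [CompleteSpace F] {f : ℝ → F} (hf : Integrable f) (h2 : MemLp f 2) :
    ∫⁻ τ, ‖𝓕 f τ‖ₑ ^ (2 : ℝ) = ∫⁻ t, ‖f t‖ₑ ^ (2 : ℝ) := by
  have h := eLpNorm_fourier hf h2
  rw [eLpNorm_two_eq, eLpNorm_two_eq] at h
  exact ENNReal.rpow_left_injective (by norm_num) h

theorem continuous_fourier_vector {F : Type*} [NormedAddCommGroup F] [InnerProductSpace ℂ F]
    [CompleteSpace F] {f : ℝ → F} (hf : Integrable f) : Continuous (𝓕 f) :=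
  VectorFourier.fourierIntegral_continuous Real.continuous_fourierChar
    (by exact continuous_inner) hf

theorem fourier_clm {F G : Type*} [NormedAddCommGroup F] [InnerProductSpace ℂ F] [CompleteSpace F]
    [NormedAddCommGroup G] [InnerProductSpace ℂ G] [CompleteSpace G] (L : F →L[ℂ] G) {f : ℝ → F}
    (hf : Integrable f) (τ : ℝ) : 𝓕 (fun t => L (f t)) τ = L (𝓕 f τ) := by
  rw [Real.fourier_eq, Real.fourier_eq, ← ContinuousLinearMap.integral_comp_comm]
  · simp only [Circle.smul_def, map_smul]
  · exact (Real.fourierIntegral_convergent_iff τ).2 hf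

theorem fourier_shift {F : Type*} [NormedAddCommGroup F] [InnerProductSpace ℂ F] (f : ℝ → F)
    (θ τ : ℝ) : 𝓕 (fun t => f (t + θ)) τ =
      Complex.exp (((2 * Real.pi * (θ * τ) : ℝ) : ℂ) * Complex.I) • 𝓕 f τ := by
  have h := congrFun (VectorFourier.fourierIntegral_comp_add_right Real.fourierChar
    (volume : Measure ℝ) (innerₗ ℝ) f θ) τ
  have h2 : 𝓕 (fun t => f (t + θ)) τ = Real.fourierChar (innerₗ ℝ θ τ) • 𝓕 f τ := h
  rw [h2, Circle.smul_def, Real.fourierChar_apply]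
  congr 4
  simp [mul_comm]

/-- Shifting by θ and undoing the free flow multiplies the transform by e^{iθ(2πτ - q(ξ))} - 1 after
subtraction, which detects exactly the modulation 2πτ - q(ξ). -/
theorem fourier_twisted_shift {Ψ : ℝ → L2 d} (hΨ : Integrable Ψ) (q : Space d → ℝ) (θ τ : ℝ) :
    𝓕 (fun t => mulL (ph q (-θ)) (Ψ (t + θ)) - Ψ t) τ =
      Complex.exp (((2 * Real.pi * (θ * τ) : ℝ) : ℂ) * Complex.I) • mulL (ph q (-θ)) (𝓕 Ψ τ) -
        𝓕 Ψ τ := by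
  have h1 : Integrable fun t => Ψ (t + θ) := hΨ.comp_add_right θ
  have h2 : Integrable fun t => mulL (ph q (-θ)) (Ψ (t + θ)) :=
    (mulL (ph q (-θ))).integrable_comp h1
  have h3 : 𝓕 (fun t => mulL (ph q (-θ)) (Ψ (t + θ)) - Ψ t) τ =
      𝓕 (fun t => mulL (ph q (-θ)) (Ψ (t + θ))) τ - 𝓕 Ψ τ := by
    rw [Real.fourier_eq, Real.fourier_eq, Real.fourier_eq, ← integral_sub]
    · simp only [smul_sub]
    · exact (Real.fourierIntegral_convergent_iff τ).2 h2
    · exact (Real.fourierIntegral_convergent_iff τ).2 hΨ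
  rw [h3, fourier_clm _ h1, fourier_shift, map_smul]

/-- The dyadic bound is applied with x = 2πτ - q(ξ), and Plancherel in time for L²-valued functions
turns each term into a mean square increment along the free flow. -/
theorem lintegral_bracket_fourier_le {Ψ : ℝ → L2 d} (hΨ : Integrable Ψ) (hΨ2 : MemLp Ψ 2)
    {q : Space d → ℝ} (hq : Measurable q) {b : ℝ} (hb0 : 0 ≤ b) (hb1 : b ≤ 1) :
    ∫⁻ τ, ∫⁻ ξ, ENNReal.ofReal (bracket (2 * Real.pi * τ - q ξ) ^ (2 * b)) *
        ‖(𝓕 Ψ τ) ξ‖ₑ ^ (2 : ℝ) ≤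
      32 * ((∫⁻ t, ‖Ψ t‖ₑ ^ (2 : ℝ)) + ∑' k : ℕ, ENNReal.ofReal (2 ^ (2 * b * k)) *
        ∫⁻ t, ‖mulL (ph q (-(2⁻¹ ^ k))) (Ψ (t + 2⁻¹ ^ k)) - Ψ t‖ₑ ^ (2 : ℝ)) := by
  have hsh : ∀ θ : ℝ, ∫⁻ τ, ‖Complex.exp (((2 * Real.pi * (θ * τ) : ℝ) : ℂ) * Complex.I) •
      mulL (ph q (-θ)) (𝓕 Ψ τ) - 𝓕 Ψ τ‖ₑ ^ (2 : ℝ) =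
      ∫⁻ t, ‖mulL (ph q (-θ)) (Ψ (t + θ)) - Ψ t‖ₑ ^ (2 : ℝ) := by
    intro θ
    have h1 : Integrable fun t => mulL (ph q (-θ)) (Ψ (t + θ)) - Ψ t :=
      ((mulL (ph q (-θ))).integrable_comp (hΨ.comp_add_right θ)).sub hΨ
    have h2 : MemLp (fun t => Ψ (t + θ)) 2 :=
      hΨ2.comp_measurePreserving (measurePreserving_add_right volume θ)
    have h3 : MemLp (fun t => mulL (ph q (-θ)) (Ψ (t + θ)) - Ψ t) 2 :=
      ((mulL (ph q (-θ))).comp_memLp' h2).sub hΨ2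
    rw [← lintegral_fourier_sq h1 h3]
    simp only [fourier_twisted_shift hΨ]
  have hpt : ∀ τ : ℝ, ∫⁻ ξ, ENNReal.ofReal (bracket (2 * Real.pi * τ - q ξ) ^ (2 * b)) *
        ‖(𝓕 Ψ τ) ξ‖ₑ ^ (2 : ℝ) ≤ 32 * (‖𝓕 Ψ τ‖ₑ ^ (2 : ℝ) +
        ∑' k : ℕ, ENNReal.ofReal (2 ^ (2 * b * k)) *
          ‖Complex.exp (((2 * Real.pi * (2⁻¹ ^ k * τ) : ℝ) : ℂ) * Complex.I) •
            mulL (ph q (-(2⁻¹ ^ k))) (𝓕 Ψ τ) - 𝓕 Ψ τ‖ₑ ^ (2 : ℝ)) := by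
    intro τ
    have hm0 : AEMeasurable (fun ξ => ‖(𝓕 Ψ τ) ξ‖ₑ ^ (2 : ℝ)) :=
      (Lp.aestronglyMeasurable _).enorm.pow_const _
    have hmk : ∀ k : ℕ, AEMeasurable (fun ξ => ENNReal.ofReal (2 ^ (2 * b * k)) *
        (‖Complex.exp (((2⁻¹ ^ k * (2 * Real.pi * τ - q ξ) : ℝ) : ℂ) * Complex.I) - 1‖ₑ ^ (2 : ℝ) *
          ‖(𝓕 Ψ τ) ξ‖ₑ ^ (2 : ℝ))) := fun k => by
      refine AEMeasurable.const_mul (AEMeasurable.mul (Measurable.aemeasurable ?_) hm0) _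
      fun_prop
    have hterm : ∀ k : ℕ, ∫⁻ ξ, ENNReal.ofReal (2 ^ (2 * b * k)) *
        (‖Complex.exp (((2⁻¹ ^ k * (2 * Real.pi * τ - q ξ) : ℝ) : ℂ) * Complex.I) - 1‖ₑ ^ (2 : ℝ) *
          ‖(𝓕 Ψ τ) ξ‖ₑ ^ (2 : ℝ)) = ENNReal.ofReal (2 ^ (2 * b * k)) *
          ‖Complex.exp (((2 * Real.pi * (2⁻¹ ^ k * τ) : ℝ) : ℂ) * Complex.I) •
            mulL (ph q (-(2⁻¹ ^ k))) (𝓕 Ψ τ) - 𝓕 Ψ τ‖ₑ ^ (2 : ℝ) := by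
      intro k
      rw [lintegral_const_mul' _ _ ENNReal.ofReal_ne_top, enorm_rpow_two_eq]
      congr 1
      refine lintegral_congr_ae ?_
      filter_upwards [Lp.coeFn_sub (Complex.exp (((2 * Real.pi * (2⁻¹ ^ k * τ) : ℝ) : ℂ) *
          Complex.I) • mulL (ph q (-(2⁻¹ ^ k))) (𝓕 Ψ τ)) (𝓕 Ψ τ),
        Lp.coeFn_smul (Complex.exp (((2 * Real.pi * (2⁻¹ ^ k * τ) : ℝ) : ℂ) * Complex.I))
          (mulL (ph q (-(2⁻¹ ^ k))) (𝓕 Ψ τ)), mulL_ph_coe hq (-(2⁻¹ ^ k)) (𝓕 Ψ τ)] with ξ e1 e2 e3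
      rw [e1, Pi.sub_apply, e2, Pi.smul_apply, e3, smul_eq_mul, ← mul_assoc,
        ← ENNReal.mul_rpow_of_nonneg _ _ (by norm_num), ← enorm_mul, sub_mul, one_mul, ph,
        ← Complex.exp_add, ← add_mul, ← Complex.ofReal_add]
      congr 6
      ring_nf
    calc _ ≤ ∫⁻ ξ, 32 * (‖(𝓕 Ψ τ) ξ‖ₑ ^ (2 : ℝ) + ∑' k : ℕ, ENNReal.ofReal (2 ^ (2 * b * k)) *
        (‖Complex.exp (((2⁻¹ ^ k * (2 * Real.pi * τ - q ξ) : ℝ) : ℂ) * Complex.I) - 1‖ₑ ^ (2 : ℝ) *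
          ‖(𝓕 Ψ τ) ξ‖ₑ ^ (2 : ℝ))) := by
          refine lintegral_mono fun ξ => ?_
          refine (mul_le_mul_left (bracket_rpow_le_tsum hb0 hb1 _) _).trans (le_of_eq ?_)
          rw [mul_assoc, add_mul, one_mul, ← ENNReal.tsum_mul_right]
          simp only [mul_assoc]
      _ = _ := by
          rw [lintegral_const_mul' _ _ (by norm_num), lintegral_add_left' hm0, lintegral_tsum hmk,
            ← enorm_rpow_two_eq]
          simp only [hterm]
  have hmc : ∀ k : ℕ, Measurable fun τ : ℝ => ENNReal.ofReal (2 ^ (2 * b * k)) *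
          ‖Complex.exp (((2 * Real.pi * (2⁻¹ ^ k * τ) : ℝ) : ℂ) * Complex.I) •
            mulL (ph q (-(2⁻¹ ^ k))) (𝓕 Ψ τ) - 𝓕 Ψ τ‖ₑ ^ (2 : ℝ) := fun k => by
    have hc := continuous_fourier_vector hΨ
    have hc2 : Continuous fun τ : ℝ =>
        Complex.exp (((2 * Real.pi * (2⁻¹ ^ k * τ) : ℝ) : ℂ) * Complex.I) := by fun_prop
    have hc3 := (hc2.smul ((mulL (ph q (-(2⁻¹ ^ k)))).continuous.comp hc)).sub hc
    exact (hc3.enorm.measurable.pow_const _).const_mul _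
  calc _ ≤ ∫⁻ τ, 32 * (‖𝓕 Ψ τ‖ₑ ^ (2 : ℝ) +
        ∑' k : ℕ, ENNReal.ofReal (2 ^ (2 * b * k)) *
          ‖Complex.exp (((2 * Real.pi * (2⁻¹ ^ k * τ) : ℝ) : ℂ) * Complex.I) •
            mulL (ph q (-(2⁻¹ ^ k))) (𝓕 Ψ τ) - 𝓕 Ψ τ‖ₑ ^ (2 : ℝ)) := lintegral_mono hpt
    _ = _ := by
      rw [lintegral_const_mul' _ _ (by norm_num), lintegral_add_left
        ((continuous_fourier_vector hΨ).enorm.measurable.pow_const _),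
        lintegral_tsum fun k => (hmc k).aemeasurable, lintegral_fourier_sq hΨ hΨ2]
      congr 3
      ext k
      rw [lintegral_const_mul' _ _ ENNReal.ofReal_ne_top, hsh]

end VectorFourier

/-! ### Space-time extensions and their Bourgain norms -/

section Extension

variable {d : ℕ}

theorem measurable_gevreySymbol (σ s : ℝ) : Measurable (gevreySymbol σ s : Space d → ℝ) := by
  unfold gevreySymbol
  have h1 := (continuous_l1 (d := d)).measurable
  have h2 := continuous_bracket.measurable
  fun_prop

/-- The Gevrey weight cancels against m. Moving the argument of the bracket by at most 1 costs a
factor 2 for b ≤ 1, hence 4 after squaring; this replaces ⟨ξ⟩ by |ξ| in the wave symbols. -/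
theorem norm_bourgain_weight_le {G M : ℝ} {x y b : ℝ} (hb0 : 0 ≤ b) (hb1 : b ≤ 1)
    (h : |x - y| ≤ 1) {c m z : ℂ} (hG : 0 ≤ G) (hM : M = ‖m‖) (hGM : G * M = 1)
    (hc : c = ((G * bracket x ^ b : ℝ) : ℂ)) :
    ‖c * (m * z)‖ₑ ^ (2 : ℝ) ≤ 4 * (ENNReal.ofReal (bracket y ^ (2 * b)) * ‖z‖ₑ ^ (2 : ℝ)) := by
  have hy := bracket_pos y
  have hx := bracket_pos x
  have h1 : bracket x ^ b ≤ 2 * bracket y ^ b := by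
    calc bracket x ^ b ≤ (2 * bracket y) ^ b :=
          Real.rpow_le_rpow hx.le (bracket_le_of_abs_sub_le h) hb0
      _ = 2 ^ b * bracket y ^ b := Real.mul_rpow (by norm_num) hy.le
      _ ≤ 2 ^ (1 : ℝ) * bracket y ^ b := by
          gcongr
          norm_num
      _ = _ := by rw [Real.rpow_one]
  have h2 : ‖c * (m * z)‖ = bracket x ^ b * ‖z‖ := by
    rw [norm_mul, norm_mul, hc, Complex.norm_real, Real.norm_of_nonneg (by positivity), ← hM]
    linear_combination (bracket x ^ b * ‖z‖) * hGM
  have h3 : bracket y ^ (2 * b) = (bracket y ^ b) ^ 2 := by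
    rw [← Real.rpow_natCast, ← Real.rpow_mul hy.le]; congr 1; push_cast; ring
  rw [ENNReal.rpow_ofNat, ENNReal.rpow_ofNat, ← ofReal_norm, ← ofReal_norm, h2, h3,
    ← ENNReal.ofReal_pow (by positivity), ← ENNReal.ofReal_pow (by positivity),
    ← ENNReal.ofReal_mul (by positivity), ← ENNReal.ofReal_ofNat 4,
    ← ENNReal.ofReal_mul (by norm_num)]
  refine ENNReal.ofReal_le_ofReal ?_
  calc (bracket x ^ b * ‖z‖) ^ 2 ≤ (2 * bracket y ^ b * ‖z‖) ^ 2 := by gcongr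
    _ = _ := by ring

theorem exists_spaceTime_function {Ψ : ℝ → L2 d} (hΨ : Integrable Ψ) (hΨ2 : MemLp Ψ 2)
    {m : Space d → ℂ} (hm : Measurable m) {C : ℝ} (hC : ∀ ξ, ‖m ξ‖ ≤ C) :
    ∃ g : L2ST d, Slices (fun t => (𝓕⁻ (mulL m (Ψ t)) : L2 d)) g ∧
      ∀ᵐ τ : ℝ, ∀ᵐ ξ : Space d, (𝓕 g : L2ST d) (WithLp.toLp 2 (τ, ξ)) = m ξ * (𝓕 Ψ τ) ξ := by
  let L : L2 d →L[ℂ] L2 d :=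
    ((Lp.fourierTransformₗᵢ (Space d) ℂ).symm.toLinearIsometry.toContinuousLinearMap).comp (mulL m)
  have hL1 : Integrable fun t => L (Ψ t) := L.integrable_comp hΨ
  have hL2 : MemLp (fun t => L (Ψ t)) 2 := L.comp_memLp' hΨ2
  obtain ⟨g, h1, h2⟩ := hasST (hL2.toLp _)
  refine ⟨g, h1.congr hL2.coeFn_toLp (Filter.EventuallyEq.refl _ _), ?_⟩
  filter_upwards [h2, spaceFourier_coe (𝓕 (hL2.toLp _)), fourier_toLp_ae_eq hL1 hL2]
    with τ e1 e2 e3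
  have e4 : (𝓕 (L (𝓕 Ψ τ)) : L2 d) = mulL m (𝓕 Ψ τ) :=
    (Lp.fourierTransformₗᵢ (Space d) ℂ).apply_symm_apply _
  rw [e2, e3, fourier_clm L hΨ, e4] at e1
  filter_upwards [e1, mulL_coe hm hC (𝓕 Ψ τ)] with ξ e5 e6
  rw [e5, e6]

/-- Here m inverts the Gevrey weight, q is the symbol of the actual flow and h that of the norm. The
power of 2π comes from rescaling the unitary transform to the one in the norm. -/
theorem exists_extension {Ψ : ℝ → L2 d} (hΨ : Integrable Ψ) (hΨ2 : MemLp Ψ 2)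
    {m : Space d → ℂ} (hm : Measurable m) {C : ℝ} (hC : ∀ ξ, ‖m ξ‖ ≤ C) {q h : Space d → ℝ}
    (hq : Measurable q) (hh : Measurable h) {σ s : ℝ}
    (hms : ∀ ξ, gevreySymbol σ s ((2 * Real.pi) • ξ) * ‖m ξ‖ = 1)
    (hqh : ∀ ξ, |q ξ - h ((2 * Real.pi) • ξ)| ≤ 1) :
    ∃ g : L2ST d, Slices (fun t => (𝓕⁻ (mulL m (Ψ t)) : L2 d)) g ∧
      ∀ b : ℝ, 0 ≤ b → b ≤ 1 → bourgainNorm h σ s b g ^ (2 : ℝ) ≤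
        ENNReal.ofReal (|(2 * Real.pi)⁻¹ ^ Module.finrank ℝ (SpaceTime d)|⁻¹) * (4 * (32 *
        ((∫⁻ t, ‖Ψ t‖ₑ ^ (2 : ℝ)) + ∑' k : ℕ, ENNReal.ofReal (2 ^ (2 * b * k)) *
          ∫⁻ t, ‖mulL (ph q (-(2⁻¹ ^ k))) (Ψ (t + 2⁻¹ ^ k)) - Ψ t‖ₑ ^ (2 : ℝ)))) := by
  obtain ⟨g, h1, h2⟩ := exists_spaceTime_function hΨ hΨ2 hm hC
  refine ⟨g, h1, fun b hb0 hb1 => ?_⟩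
  have hpi : (2 * Real.pi)⁻¹ ≠ 0 := by positivity
  let G : SpaceTime d → ℝ≥0∞ := fun ζ =>
    ‖((gevreySymbol σ s ((2 * Real.pi) • ζ.snd) *
      bracket (2 * Real.pi * ζ.fst - h ((2 * Real.pi) • ζ.snd)) ^ b : ℝ) : ℂ) *
        (𝓕 g : L2ST d) ζ‖ₑ ^ (2 : ℝ)
  have hG : Measurable G := by
    have m1 := measurable_gevreySymbol (d := d) σ s
    have m2 := continuous_bracket.measurable
    have m3 := (Lp.stronglyMeasurable (𝓕 g : L2ST d)).measurable
    have m4 : Measurable fun ζ : SpaceTime d => ζ.fst := by fun_prop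
    have m5 : Measurable fun ζ : SpaceTime d => ζ.snd := by fun_prop
    have m6 : Measurable fun ζ : SpaceTime d => (2 * Real.pi) • ζ.snd := by fun_prop
    exact ((Complex.measurable_ofReal.comp ((m1.comp m6).mul ((m2.comp
      ((m4.const_mul _).sub (hh.comp m6))).pow_const _))).mul m3).enorm.pow_const _
  have hB : bourgainNorm h σ s b g ^ (2 : ℝ) = ∫⁻ ζ, G ((2 * Real.pi)⁻¹ • ζ) := by
    rw [bourgainNorm, eLpNorm_two_eq, ← ENNReal.rpow_mul]
    norm_num only [ENNReal.rpow_one]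
    refine lintegral_congr fun ζ => ?_
    have e1 : (2 * Real.pi) • ((2 * Real.pi)⁻¹ • ζ).snd = ζ.snd := by
      rw [WithLp.smul_snd, smul_smul, mul_inv_cancel₀ (by positivity), one_smul]
    have e2 : 2 * Real.pi * ((2 * Real.pi)⁻¹ • ζ).fst = ζ.fst := by
      rw [WithLp.smul_fst, smul_eq_mul, mul_inv_cancel_left₀ (by positivity)]
    simp only [G, e1, e2, stFourier]
  rw [hB, lintegral_comp_smul_eq G hG hpi]
  refine mul_le_mul_right ?_ _
  rw [lintegral_spaceTime hG.aemeasurable]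
  refine le_trans ?_ (mul_le_mul_right (lintegral_bracket_fourier_le hΨ hΨ2 hq hb0 hb1) 4)
  rw [← lintegral_const_mul' _ _ (by norm_num)]
  refine lintegral_mono_ae ?_
  filter_upwards [h2] with τ e1
  rw [← lintegral_const_mul' _ _ (by norm_num)]
  refine lintegral_mono_ae ?_
  filter_upwards [e1] with ξ e2
  simp only [G]
  rw [e2]
  refine norm_bourgain_weight_le hb0 hb1 ?_ ?_ rfl (hms ξ) rfl
  · change |2 * Real.pi * τ - h ((2 * Real.pi) • ξ) - (2 * Real.pi * τ - q ξ)| ≤ 1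
    rw [show 2 * Real.pi * τ - h ((2 * Real.pi) • ξ) - (2 * Real.pi * τ - q ξ) =
      q ξ - h ((2 * Real.pi) • ξ) by ring]
    exact hqh ξ
  · exact mul_nonneg (Real.exp_pos _).le (Real.rpow_nonneg (bracket_pos _).le _)

end Extension

/-! ### A Lipschitz time cutoff -/

section Bump

/-- A piecewise linear cutoff function: `1` on `[-1, 1]` and `0` off `[-2, 2]`. -/
def bump (t : ℝ) : ℝ := max 0 (min 1 (2 - |t|))

theorem bump_nonneg (t : ℝ) : 0 ≤ bump t := le_max_left _ _

theorem bump_le_one (t : ℝ) : bump t ≤ 1 := max_le zero_le_one (min_le_left _ _)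

theorem bump_eq_one {t : ℝ} (h : |t| ≤ 1) : bump t = 1 := by
  rw [bump, min_eq_left (by linarith), max_eq_right zero_le_one]

theorem bump_eq_zero {t : ℝ} (h : 2 ≤ |t|) : bump t = 0 :=
  max_eq_left ((min_le_right _ _).trans (by linarith))

theorem continuous_bump : Continuous bump := by unfold bump; fun_prop

theorem abs_bump_sub_le (s t : ℝ) : |bump s - bump t| ≤ |s - t| := by
  have h1 := abs_max_sub_max_le_max 0 (min 1 (2 - |s|)) 0 (min 1 (2 - |t|))
  have h2 := abs_min_sub_min_le_max 1 (2 - |s|) 1 (2 - |t|)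
  refine h1.trans (max_le (by simp) (h2.trans (max_le (by simp) ?_)))
  rw [sub_sub_sub_cancel_left, abs_sub_comm]
  exact abs_abs_sub_abs_le s t

theorem hasCompactSupport_bump_smul {E : Type*} [NormedAddCommGroup E] [NormedSpace ℝ E]
    (f : ℝ → E) : HasCompactSupport fun t => bump t • f t := by
  refine HasCompactSupport.intro (isCompact_Icc (a := (-2 : ℝ)) (b := 2)) fun t ht => ?_
  rw [bump_eq_zero, zero_smul]
  by_contra h
  exact ht (abs_le.1 (not_le.1 h).le)

end Bump

/-! ### Mean square increments of the cut off profile -/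

section Increment

variable {E : Type*} [NormedAddCommGroup E] [NormedSpace ℝ E] [CompleteSpace E]

theorem enorm_curve_sub_le {ν : Measure ℝ} (x₀ : E) {F : ℝ → E} (hF : Integrable F ν) {s t : ℝ}
    (h : s ≤ t) : ‖curve ν x₀ F t - curve ν x₀ F s‖ₑ ≤ ∫⁻ u in Set.Icc s t, ‖F u‖ₑ ∂ν := by
  have h1 : curve ν x₀ F t - curve ν x₀ F s = ∫ u in s..t, F u ∂ν := by
    rw [curve, curve, add_sub_add_left_eq_sub, intervalIntegral.integral_interval_sub_left
      hF.intervalIntegrable hF.intervalIntegrable]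
  rw [h1, intervalIntegral.integral_of_le h]
  exact (enorm_integral_le_lintegral_enorm _).trans (lintegral_mono_set Set.Ioc_subset_Icc_self)

theorem lintegral_window {ν : Measure ℝ} [SFinite ν] {f : ℝ → ℝ≥0∞} (hf : AEMeasurable f ν)
    (θ : ℝ) : ∫⁻ t : ℝ, ∫⁻ u in Set.Icc t (t + θ), f u ∂ν = ENNReal.ofReal θ * ∫⁻ u, f u ∂ν := by
  let S : Set (ℝ × ℝ) := {p | p.1 ≤ p.2 ∧ p.2 ≤ p.1 + θ}
  have hS : MeasurableSet S := (measurableSet_le measurable_fst measurable_snd).inter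
    (measurableSet_le measurable_snd (measurable_fst.add_const θ))
  have h1 : ∀ t : ℝ, ∫⁻ u in Set.Icc t (t + θ), f u ∂ν =
      ∫⁻ u, S.indicator (fun p => f p.2) (t, u) ∂ν := fun t => by
    rw [← lintegral_indicator measurableSet_Icc]; rfl
  have h2 : ∀ u : ℝ, ∫⁻ t : ℝ, S.indicator (fun p => f p.2) (t, u) = ENNReal.ofReal θ * f u := by
    intro u
    have h3 : ∀ t : ℝ, S.indicator (fun p => f p.2) (t, u) =
        (Set.Icc (u - θ) u).indicator (fun _ => f u) t := fun t => by
      have : (t, u) ∈ S ↔ t ∈ Set.Icc (u - θ) u := by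
        simp only [S, Set.mem_ofPred_eq, Set.mem_Icc]
        constructor <;> rintro ⟨a, b⟩ <;> constructor <;> linarith
      by_cases h : (t, u) ∈ S
      · rw [Set.indicator_of_mem h, Set.indicator_of_mem (this.1 h)]
      · rw [Set.indicator_of_notMem h, Set.indicator_of_notMem (fun h' => h (this.2 h'))]
    simp only [h3]
    rw [lintegral_indicator measurableSet_Icc, setLIntegral_const, Real.volume_Icc, mul_comm]
    congr 2; ring
  simp only [h1]
  rw [lintegral_lintegral_swap]
  · simp only [h2]
    rw [lintegral_const_mul'' _ hf]
  · exact (hf.comp_snd).indicator hS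

/-- The hypothesis gives Hölder continuity of exponent `(1 + 2κ) / 2` in the mean square. -/
theorem lintegral_window_sq_le {F : ℝ → E} {δ B α κ : ℝ} {e : ℝ≥0∞} (hδ : 0 < δ) (hδ1 : δ ≤ 1) (he : e ≠ ∞)
    (hF : Integrable F (volume.restrict (Set.Icc 0 δ))) (hB : 0 ≤ B) (hκ : 0 ≤ κ)
    (hκα : 2 * κ ≤ α) (hb : ∀ s h : ℝ, 0 ≤ h → h ≤ 1 →
      ∫⁻ t in Set.Icc s (s + h), ‖F t‖ₑ ∂(volume.restrict (Set.Icc 0 δ)) ≤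
        ENNReal.ofReal (B * h ^ α) * e) {θ : ℝ} (hθ : 0 < θ) (hθ1 : θ ≤ 1) :
    ∫⁻ t : ℝ, (∫⁻ u in Set.Icc t (t + θ), ‖F u‖ₑ ∂(volume.restrict (Set.Icc 0 δ))) ^ (2 : ℝ) ≤
      ENNReal.ofReal (θ ^ (1 + 2 * κ)) * (ENNReal.ofReal (B * δ ^ (α - κ)) * e) ^ (2 : ℝ) := by
  set ν : Measure ℝ := volume.restrict (Set.Icc 0 δ) with hν
  have htot : ∫⁻ u, ‖F u‖ₑ ∂ν ≤ ENNReal.ofReal (B * δ ^ α) * e := by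
    have h := hb 0 δ hδ.le hδ1
    rwa [zero_add, hν, Measure.restrict_restrict measurableSet_Icc, Set.inter_self] at h
  -- One of the two factors of the square is bounded uniformly, by min(θ, δ)^α ≤ θ^{2κ} δ^{α-2κ}.
  -- The other is integrated over all t and contributes θ times the total integral.
  have hsup : ∀ t, ∫⁻ u in Set.Icc t (t + θ), ‖F u‖ₑ ∂ν ≤
      ENNReal.ofReal (B * (θ ^ (2 * κ) * δ ^ (α - 2 * κ))) * e := by
    intro t
    rcases le_total θ δ with h | h
    · refine (hb t θ hθ.le hθ1).trans (mul_le_mul_left (ENNReal.ofReal_le_ofReal ?_) _)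
      refine mul_le_mul_of_nonneg_left ?_ hB
      rw [show α = 2 * κ + (α - 2 * κ) by ring, Real.rpow_add hθ,
        show 2 * κ + (α - 2 * κ) - 2 * κ = α - 2 * κ by ring]
      gcongr
    · refine ((setLIntegral_le_lintegral _ _).trans htot).trans
        (mul_le_mul_left (ENNReal.ofReal_le_ofReal ?_) _)
      refine mul_le_mul_of_nonneg_left ?_ hB
      nth_rw 1 [show α = 2 * κ + (α - 2 * κ) by ring]
      rw [Real.rpow_add hδ]
      gcongr
  calc _ ≤ ∫⁻ t : ℝ, (ENNReal.ofReal (B * (θ ^ (2 * κ) * δ ^ (α - 2 * κ))) * e) *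
        ∫⁻ u in Set.Icc t (t + θ), ‖F u‖ₑ ∂ν := by
        refine lintegral_mono fun t => ?_
        rw [ENNReal.rpow_ofNat, pow_two]
        exact mul_le_mul_left (hsup t) _
    _ ≤ (ENNReal.ofReal (B * (θ ^ (2 * κ) * δ ^ (α - 2 * κ))) * e) *
        (ENNReal.ofReal θ * (ENNReal.ofReal (B * δ ^ α) * e)) := by
        rw [lintegral_const_mul' _ _ (ENNReal.mul_ne_top ENNReal.ofReal_ne_top he), lintegral_window hF.aestronglyMeasurable.enorm]
        gcongr
    _ = _ := by
        have e1 : θ ^ (1 + 2 * κ) = θ * θ ^ (2 * κ) := by rw [Real.rpow_add hθ, Real.rpow_one]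
        have e2 : (δ ^ (α - κ)) ^ 2 = δ ^ (α - 2 * κ) * δ ^ α := by
          rw [← Real.rpow_natCast, ← Real.rpow_mul hδ.le, ← Real.rpow_add hδ]
          congr 1; push_cast; ring
        have e3 : ENNReal.ofReal (B * (θ ^ (2 * κ) * δ ^ (α - 2 * κ))) *
            (ENNReal.ofReal θ * ENNReal.ofReal (B * δ ^ α)) = ENNReal.ofReal (θ ^ (1 + 2 * κ)) *
              ENNReal.ofReal (B * δ ^ (α - κ)) ^ 2 := by
          rw [← ENNReal.ofReal_pow (by positivity), ← ENNReal.ofReal_mul (by positivity),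
            ← ENNReal.ofReal_mul (by positivity), ← ENNReal.ofReal_mul (by positivity), e1, mul_pow,
            e2]
          congr 1; ring
        rw [ENNReal.rpow_ofNat, mul_pow, ← mul_assoc (ENNReal.ofReal (θ ^ (1 + 2 * κ))), ← e3]
        ring

theorem lintegral_enorm_le_of_window {F : ℝ → E} {δ B α κ : ℝ} {e : ℝ≥0∞} (hδ : 0 < δ)
    (hδ1 : δ ≤ 1) (hB : 0 ≤ B) (hκ : 0 ≤ κ) (hb : ∀ s h : ℝ, 0 ≤ h → h ≤ 1 →
      ∫⁻ t in Set.Icc s (s + h), ‖F t‖ₑ ∂(volume.restrict (Set.Icc 0 δ)) ≤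
        ENNReal.ofReal (B * h ^ α) * e) :
    ∫⁻ u, ‖F u‖ₑ ∂(volume.restrict (Set.Icc 0 δ)) ≤ ENNReal.ofReal (B * δ ^ (α - κ)) * e := by
  have h := hb 0 δ hδ.le hδ1
  rw [zero_add, Measure.restrict_restrict measurableSet_Icc, Set.inter_self] at h
  refine h.trans (mul_le_mul_left (ENNReal.ofReal_le_ofReal (mul_le_mul_of_nonneg_left ?_ hB)) _)
  exact Real.rpow_le_rpow_of_exponent_ge hδ hδ1 (by linarith)

theorem lintegral_bump_increment_le {F : ℝ → E} {δ B α κ : ℝ} {e : ℝ≥0∞} (hδ : 0 < δ)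
    (hδ1 : δ ≤ 1) (he : e ≠ ∞) (hF : Integrable F (volume.restrict (Set.Icc 0 δ))) (hB : 0 ≤ B)
    (hκ : 0 ≤ κ) (hκα : 2 * κ ≤ α) (hκ1 : 2 * κ ≤ 1) (hb : ∀ s h : ℝ, 0 ≤ h → h ≤ 1 →
      ∫⁻ t in Set.Icc s (s + h), ‖F t‖ₑ ∂(volume.restrict (Set.Icc 0 δ)) ≤
        ENNReal.ofReal (B * h ^ α) * e) (x₀ : E) {θ : ℝ} (hθ : 0 < θ) (hθ1 : θ ≤ 1) :
    ∫⁻ t : ℝ, ‖bump (t + θ) • curve (volume.restrict (Set.Icc 0 δ)) x₀ F (t + θ) -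
        bump t • curve (volume.restrict (Set.Icc 0 δ)) x₀ F t‖ₑ ^ (2 : ℝ) ≤
      ENNReal.ofReal (θ ^ (1 + 2 * κ)) *
        (12 * (‖x₀‖ₑ + ENNReal.ofReal (B * δ ^ (α - κ)) * e) ^ (2 : ℝ)) := by
  set ν : Measure ℝ := volume.restrict (Set.Icc 0 δ) with hν
  set D : ℝ≥0∞ := ENNReal.ofReal (B * δ ^ (α - κ)) * e with hD
  have hA : ∀ t, ‖curve ν x₀ F t‖ₑ ≤ ‖x₀‖ₑ + D := fun t =>
    (enorm_curve_le x₀ F t).trans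
      (add_le_add le_rfl (lintegral_enorm_le_of_window hδ hδ1 hB hκ hb))
  -- A discrete product rule. The cutoff varies by at most θ, and only for t in [-3, 2], since θ ≤ 1
  -- and the cutoff lives on [-2, 2]. The length 5 leads to 10 = 2 · 5 below; the part from the
  -- curve adds 2.
  have hpt : ∀ t, ‖bump (t + θ) • curve ν x₀ F (t + θ) - bump t • curve ν x₀ F t‖ₑ ≤
      (Set.Icc (-3 : ℝ) 2).indicator (fun _ => ENNReal.ofReal θ * (‖x₀‖ₑ + D)) t +
        ∫⁻ u in Set.Icc t (t + θ), ‖F u‖ₑ ∂ν := by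
    intro t
    have h1 : bump (t + θ) • curve ν x₀ F (t + θ) - bump t • curve ν x₀ F t =
        (bump (t + θ) - bump t) • curve ν x₀ F (t + θ) +
          bump t • (curve ν x₀ F (t + θ) - curve ν x₀ F t) := by
      rw [sub_smul, smul_sub]; abel
    rw [h1]
    refine (enorm_add_le _ _).trans (add_le_add ?_ ?_)
    · rw [enorm_smul]
      by_cases ht : t ∈ Set.Icc (-3 : ℝ) 2
      · rw [Set.indicator_of_mem ht]
        refine mul_le_mul' ?_ (hA _)
        rw [Real.enorm_eq_ofReal_abs]
        refine ENNReal.ofReal_le_ofReal ((abs_bump_sub_le _ _).trans ?_)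
        rw [add_sub_cancel_left, abs_of_pos hθ]
      · have h2 : bump t = 0 ∧ bump (t + θ) = 0 := by
          rw [Set.mem_Icc, not_and_or, not_le, not_le] at ht
          rcases ht with h | h
          · exact ⟨bump_eq_zero (by rw [abs_of_neg (by linarith)]; linarith),
              bump_eq_zero (by rw [abs_of_neg (by linarith)]; linarith)⟩
          · exact ⟨bump_eq_zero (by rw [abs_of_pos (by linarith)]; linarith),
              bump_eq_zero (by rw [abs_of_pos (by linarith)]; linarith)⟩
        rw [h2.1, h2.2, sub_self, enorm_zero, zero_mul]
        exact zero_le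
    · rw [enorm_smul]
      calc _ ≤ 1 * ‖curve ν x₀ F (t + θ) - curve ν x₀ F t‖ₑ := by
            refine mul_le_mul_left ?_ _
            rw [Real.enorm_eq_ofReal (bump_nonneg t), ← ENNReal.ofReal_one]
            exact ENNReal.ofReal_le_ofReal (bump_le_one t)
        _ ≤ _ := by
            rw [one_mul]
            exact enorm_curve_sub_le x₀ hF (by linarith)
  have hm : Measurable ((Set.Icc (-3 : ℝ) 2).indicator
      (fun _ => 2 * (ENNReal.ofReal θ * (‖x₀‖ₑ + D)) ^ (2 : ℝ))) :=
    measurable_const.indicator measurableSet_Icc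
  calc _ ≤ ∫⁻ t, ((Set.Icc (-3 : ℝ) 2).indicator
        (fun _ => 2 * (ENNReal.ofReal θ * (‖x₀‖ₑ + D)) ^ (2 : ℝ)) t +
        2 * (∫⁻ u in Set.Icc t (t + θ), ‖F u‖ₑ ∂ν) ^ (2 : ℝ)) := by
        refine lintegral_mono fun t => ?_
        refine (ENNReal.rpow_le_rpow (hpt t) (by norm_num)).trans ?_
        refine (ENNReal.rpow_add_le_mul_rpow_add_rpow _ _ (by norm_num)).trans (le_of_eq ?_)
        norm_num only [ENNReal.rpow_one]
        rw [mul_add]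
        congr 1
        by_cases ht : t ∈ Set.Icc (-3 : ℝ) 2
        · rw [Set.indicator_of_mem ht, Set.indicator_of_mem ht]
        · rw [Set.indicator_of_notMem ht, Set.indicator_of_notMem ht]
          simp
    _ ≤ 10 * (ENNReal.ofReal θ * (‖x₀‖ₑ + D)) ^ (2 : ℝ) +
        2 * (ENNReal.ofReal (θ ^ (1 + 2 * κ)) * D ^ (2 : ℝ)) := by
        rw [lintegral_add_left hm, lintegral_const_mul' _ _ (by norm_num),
          lintegral_indicator measurableSet_Icc, setLIntegral_const, Real.volume_Icc]
        refine add_le_add (le_of_eq ?_) (mul_le_mul_right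
          (lintegral_window_sq_le hδ hδ1 he hF hB hκ hκα hb hθ hθ1) _)
        rw [show (2 : ℝ) - -3 = 5 by norm_num, ENNReal.ofReal_ofNat]
        ring
    _ ≤ 10 * (ENNReal.ofReal (θ ^ (1 + 2 * κ)) * (‖x₀‖ₑ + D) ^ (2 : ℝ)) +
        2 * (ENNReal.ofReal (θ ^ (1 + 2 * κ)) * (‖x₀‖ₑ + D) ^ (2 : ℝ)) := by
        refine add_le_add (mul_le_mul_right ?_ _) (mul_le_mul_right (mul_le_mul_right
          (ENNReal.rpow_le_rpow le_add_self (by norm_num)) _) _)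
        rw [ENNReal.mul_rpow_of_nonneg _ _ (by norm_num), ENNReal.ofReal_rpow_of_pos hθ]
        refine mul_le_mul_left (ENNReal.ofReal_le_ofReal ?_) _
        exact Real.rpow_le_rpow_of_exponent_ge hθ hθ1 (by linarith)
    _ = _ := by ring

end Increment

/-! ### The restriction norm of a curve -/

section SlabBound

variable {d : ℕ}

/-- The constant in the estimate of the restriction norm. -/
def slabConst (d : ℕ) (κ : ℝ) : ℝ≥0∞ :=
  (ENNReal.ofReal (|(2 * Real.pi)⁻¹ ^ Module.finrank ℝ (SpaceTime d)|⁻¹) *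
    (4 * (32 * (4 + 12 * (1 - ENNReal.ofReal (2 ^ (-κ)))⁻¹)))) ^ (1 / 2 : ℝ)

theorem slabConst_ne_top {κ : ℝ} (hκ : 0 < κ) : slabConst d κ ≠ ∞ := by
  have h1 : ENNReal.ofReal ((2 : ℝ) ^ (-κ)) < 1 := by
    rw [← ENNReal.ofReal_one]
    exact (ENNReal.ofReal_lt_ofReal_iff one_pos).2
      (Real.rpow_lt_one_of_one_lt_of_neg (by norm_num) (by linarith))
  have h2 : (1 - ENNReal.ofReal ((2 : ℝ) ^ (-κ)))⁻¹ ≠ ∞ :=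
    ENNReal.inv_ne_top.2 (tsub_pos_of_lt h1).ne'
  refine ENNReal.rpow_ne_top_of_nonneg (by norm_num) ?_
  refine ENNReal.mul_ne_top ENNReal.ofReal_ne_top ?_
  finiteness

/-- The weight 2^{2bk} against 2^{-k(1+2κ)} leaves at most 2^{-κk}, a geometric series. Half of the
gain 2κ is spent on b > 1/2 and half on convergence. -/
theorem dyadic_sum_le {b κ : ℝ} (hb : 2 * b ≤ 1 + κ) (S : ℝ≥0∞) {I : ℕ → ℝ≥0∞}
    (hI : ∀ k : ℕ, I k ≤ ENNReal.ofReal (((2 : ℝ)⁻¹ ^ k) ^ (1 + 2 * κ)) * S) :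
    ∑' k : ℕ, ENNReal.ofReal (2 ^ (2 * b * k)) * I k ≤
      (1 - ENNReal.ofReal (2 ^ (-κ)))⁻¹ * S := by
  rw [← ENNReal.tsum_geometric, ← ENNReal.tsum_mul_right]
  refine ENNReal.tsum_le_tsum fun k => ?_
  refine (mul_le_mul_right (hI k) _).trans ?_
  rw [← mul_assoc, ← ENNReal.ofReal_mul (by positivity), ← ENNReal.ofReal_pow (by positivity)]
  refine mul_le_mul_left (ENNReal.ofReal_le_ofReal ?_) _
  have e1 : ((2 : ℝ)⁻¹ ^ k) ^ (1 + 2 * κ) = 2 ^ (-(k * (1 + 2 * κ))) := by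
    rw [inv_pow, Real.inv_rpow (by positivity), ← Real.rpow_natCast, ← Real.rpow_mul (by norm_num),
      Real.rpow_neg (by norm_num)]
  have e2 : ((2 : ℝ) ^ (-κ)) ^ k = 2 ^ (-κ * k) := by
    rw [← Real.rpow_natCast, ← Real.rpow_mul (by norm_num)]
  rw [e1, e2, ← Real.rpow_add (by norm_num)]
  refine Real.rpow_le_rpow_of_exponent_le (by norm_num) ?_
  nlinarith [mul_le_mul_of_nonneg_right hb (Nat.cast_nonneg (α := ℝ) k)]

/-- The curve is defined for all times and is constant off [0, δ]. Its product with the cutoff and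
the free flow is an extension, since the cutoff equals 1 on (0, δ). -/
theorem slabNorm_curve_le {m : Space d → ℂ} (hm : Measurable m) {C : ℝ} (hC : ∀ ξ, ‖m ξ‖ ≤ C)
    {q h : Space d → ℝ} (hq : Measurable q) (hh : Measurable h) {σ s : ℝ}
    (hms : ∀ ξ, gevreySymbol σ s ((2 * Real.pi) • ξ) * ‖m ξ‖ = 1)
    (hqh : ∀ ξ, |q ξ - h ((2 * Real.pi) • ξ)| ≤ 1)
    {F : ℝ → L2 d} {δ B α κ : ℝ} {e : ℝ≥0∞} (hδ : 0 < δ)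
    (hδ1 : δ ≤ 1) (he : e ≠ ∞) (hF : Integrable F (volume.restrict (Set.Icc 0 δ))) (hB : 0 ≤ B)
    (hκ : 0 ≤ κ) (hκα : 2 * κ ≤ α) (hκ1 : 2 * κ ≤ 1) (hb : ∀ s h : ℝ, 0 ≤ h → h ≤ 1 →
      ∫⁻ t in Set.Icc s (s + h), ‖F t‖ₑ ∂(volume.restrict (Set.Icc 0 δ)) ≤
        ENNReal.ofReal (B * h ^ α) * e) (x₀ : L2 d) {b : ℝ} (hb0 : 0 ≤ b) (hb1 : 2 * b ≤ 1 + κ)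
    {v : ℝ → L2 d} (hv : ∀ t, v t =
      𝓕⁻ (mulL m (mulL (ph q t) (curve (volume.restrict (Set.Icc 0 δ)) x₀ F t)))) :
    slabNorm h σ s b δ v ≤
      slabConst d κ * (‖x₀‖ₑ + ENNReal.ofReal (B * δ ^ (α - κ)) * e) := by
  set ν : Measure ℝ := volume.restrict (Set.Icc 0 δ) with hν
  set D : ℝ≥0∞ := ENNReal.ofReal (B * δ ^ (α - κ)) * e with hD
  set A := curve ν x₀ F with hAdef
  have hAc : Continuous A := continuous_curve x₀ hF
  have hA : ∀ t, ‖A t‖ₑ ≤ ‖x₀‖ₑ + D := fun t =>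
    (enorm_curve_le x₀ F t).trans
      (add_le_add le_rfl (lintegral_enorm_le_of_window hδ hδ1 hB hκ hb))
  let Ψ : ℝ → L2 d := fun t => bump t • mulL (ph q t) (A t)
  have hΨc : Continuous Ψ :=
    continuous_bump.smul ((continuous_mulL_ph hq).comp (continuous_id.prodMk hAc))
  have hΨs : HasCompactSupport Ψ := hasCompactSupport_bump_smul _
  have hΨ : Integrable Ψ := hΨc.integrable_of_hasCompactSupport hΨs
  have hΨ2 : MemLp Ψ 2 := hΨc.memLp_of_hasCompactSupport hΨs
  obtain ⟨g, h1, h2⟩ := exists_extension hΨ hΨ2 hm hC hq hh hms hqh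
  have hag : AgreesOnSlab δ v g := by
    filter_upwards [h1] with t ht htδ
    filter_upwards [ht] with x hx
    have e1 : bump t = 1 := bump_eq_one (by
      rw [abs_of_pos htδ.1]; exact htδ.2.le.trans hδ1)
    rw [hx, hv]
    simp only [Ψ, e1, one_smul]
  refine (iInf₂_le g hag).trans ?_
  have hsq := h2 b hb0 (by linarith)
  have hI0 : ∫⁻ t, ‖Ψ t‖ₑ ^ (2 : ℝ) ≤ 4 * (‖x₀‖ₑ + D) ^ (2 : ℝ) := by
    calc _ ≤ ∫⁻ t, (Set.Icc (-2 : ℝ) 2).indicator (fun _ => (‖x₀‖ₑ + D) ^ (2 : ℝ)) t := by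
          refine lintegral_mono fun t => ?_
          by_cases ht : t ∈ Set.Icc (-2 : ℝ) 2
          · rw [Set.indicator_of_mem ht]
            refine ENNReal.rpow_le_rpow ?_ (by norm_num)
            have e1 : ‖mulL (ph q t) (A t)‖ₑ = ‖A t‖ₑ := enorm_eq_iff_norm_eq.2 (norm_mulL_ph hq _ _)
            simp only [Ψ]
            rw [enorm_smul, e1, Real.enorm_eq_ofReal (bump_nonneg t)]
            calc _ ≤ 1 * ‖A t‖ₑ := by
                  refine mul_le_mul_left ?_ _
                  rw [← ENNReal.ofReal_one]
                  exact ENNReal.ofReal_le_ofReal (bump_le_one t)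
              _ ≤ _ := by rw [one_mul]; exact hA t
          · rw [Set.indicator_of_notMem ht]
            have e1 : bump t = 0 := bump_eq_zero (by
              by_contra hc
              exact ht (abs_le.1 (not_le.1 hc).le))
            simp [Ψ, e1]
      _ = _ := by
          rw [lintegral_indicator measurableSet_Icc, setLIntegral_const, Real.volume_Icc,
            show (2 : ℝ) - -2 = 4 by norm_num, ENNReal.ofReal_ofNat, mul_comm]
  have hIk : ∀ k : ℕ, ∫⁻ t, ‖mulL (ph q (-(2⁻¹ ^ k))) (Ψ (t + 2⁻¹ ^ k)) - Ψ t‖ₑ ^ (2 : ℝ) ≤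
      ENNReal.ofReal (((2 : ℝ)⁻¹ ^ k) ^ (1 + 2 * κ)) * (12 * (‖x₀‖ₑ + D) ^ (2 : ℝ)) := by
    intro k
    have hθ : (0 : ℝ) < 2⁻¹ ^ k := by positivity
    have hθ1 : (2 : ℝ)⁻¹ ^ k ≤ 1 := pow_le_one₀ (by norm_num) (by norm_num)
    refine le_trans (le_of_eq (lintegral_congr fun t => ?_))
      (lintegral_bump_increment_le hδ hδ1 he hF hB hκ hκα hκ1 hb x₀ hθ hθ1)
    -- By the group law the increment along the flow is the flow at time t applied to an ordinary
    -- increment of the cut off curve.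
    have e1 : mulL (ph q (-(2⁻¹ ^ k))) (Ψ (t + 2⁻¹ ^ k)) - Ψ t =
        mulL (ph q t) (bump (t + 2⁻¹ ^ k) • A (t + 2⁻¹ ^ k) - bump t • A t) := by
      simp only [Ψ]
      rw [map_sub, ContinuousLinearMap.map_smul_of_tower, ContinuousLinearMap.map_smul_of_tower,
        ContinuousLinearMap.map_smul_of_tower, ← mulL_ph_add hq,
        show -(2⁻¹ ^ k) + (t + 2⁻¹ ^ k) = t by ring]
    rw [e1, enorm_eq_iff_norm_eq.2 (norm_mulL_ph hq t _)]
  have hsum := dyadic_sum_le hb1 _ hIk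
  have hfin : bourgainNorm h σ s b g ^ (2 : ℝ) ≤
      (slabConst d κ * (‖x₀‖ₑ + D)) ^ (2 : ℝ) := by
    refine hsq.trans ((mul_le_mul_right (mul_le_mul_right (mul_le_mul_right
      (add_le_add hI0 hsum) _) _) _).trans (le_of_eq ?_))
    rw [ENNReal.mul_rpow_of_nonneg _ _ (by norm_num), slabConst, ← ENNReal.rpow_mul]
    norm_num only [ENNReal.rpow_one]
    ring
  exact (ENNReal.rpow_le_rpow_iff (by norm_num)).1 hfin

end SlabBound

/-! ### The Bourgain norms of the three components -/

section ProfileBounds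

variable {d : ℕ} {σ : ℝ} [hσ : Fact (0 < σ)]

theorem abs_bracket_sub_le {r : ℝ} (hr : 0 ≤ r) : |bracket r - r| ≤ 1 := by
  have h1 : r ≤ bracket r := Real.le_sqrt_of_sq_le (by linarith)
  have h2 : bracket r ≤ r + 1 := Real.sqrt_le_iff.2 ⟨by linarith, by nlinarith⟩
  exact abs_le.2 ⟨by linarith, by linarith⟩

theorem IsProfile.slabNorm_component_le {δ B κ : ℝ} {x₀ : L2Triple d} {F : ℝ → L2Triple d}
    (hp : IsProfile σ δ B x₀ F) (L : L2Triple d →L[ℝ] L2 d) (hL : ∀ x, ‖L x‖ ≤ ‖x‖)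
    {m : Space d → ℂ} (hm : Measurable m) (hC : ∀ ξ, ‖m ξ‖ ≤ 1)
    {q h : Space d → ℝ} (hq : Measurable q) (hh : Measurable h) {s : ℝ}
    (hms : ∀ ξ, gevreySymbol σ s ((2 * Real.pi) • ξ) * ‖m ξ‖ = 1)
    (hqh : ∀ ξ, |q ξ - h ((2 * Real.pi) • ξ)| ≤ 1) (hδ : 0 < δ) (hδ1 : δ ≤ 1) (hB : 0 ≤ B)
    (hκ : 0 ≤ κ) (hκα : 2 * κ ≤ smoothExp d) {b : ℝ} (hb0 : 0 ≤ b) (hb1 : 2 * b ≤ 1 + κ)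
    {v : ℝ → L2 d} (hv : ∀ t, v t =
      𝓕⁻ (mulL m (mulL (ph q t) (L (curve (volume.restrict (Set.Icc 0 δ)) x₀ F t))))) :
    slabNorm h σ s b δ v ≤
      slabConst d κ * (‖L x₀‖ₑ + ENNReal.ofReal (B * δ ^ (smoothExp d - κ)) * ‖x₀.1‖ₑ) := by
  refine slabNorm_curve_le hm hC hq hh hms hqh hδ hδ1 enorm_ne_top
    (L.integrable_comp hp.integrable) hB hκ hκα (hκα.trans smoothExp_le_one) ?_ (L x₀) hb0 hb1 ?_
  · intro s h h0 h1
    exact (lintegral_mono fun t => enorm_le_iff_norm_le.2 (hL (F t))).trans (hp.bound s h h0 h1)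
  · intro t
    rw [hv, curve_clm L x₀ hp.integrable]

variable {δ B κ : ℝ} {x₀ : L2Triple d} {F : ℝ → L2Triple d}

theorem IsProfile.slabNorm_solU_le (hp : IsProfile σ δ B x₀ F) (hδ : 0 < δ) (hδ1 : δ ≤ 1)
    (hB : 0 ≤ B) (hκ : 0 ≤ κ) (hκα : 2 * κ ≤ smoothExp d) {b : ℝ} (hb0 : 0 ≤ b)
    (hb1 : 2 * b ≤ 1 + κ) :
    slabNorm hSchr σ 0 b δ (solU σ (curve (volume.restrict (Set.Icc 0 δ)) x₀ F)) ≤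
      slabConst d κ * (‖x₀.1‖ₑ + ENNReal.ofReal (B * δ ^ (smoothExp d - κ)) * ‖x₀.1‖ₑ) := by
  refine hp.slabNorm_component_le (ContinuousLinearMap.fst ℝ (L2 d) (L2 d × L2 d))
    (fun x => norm_fst_le x) (continuous_decay σ).measurable (norm_decay_le hσ.out.le)
    measurable_schSymbol (h := hSchr) (by unfold hSchr; fun_prop) ?_ ?_ hδ hδ1 hB hκ hκα hb0 hb1 ?_
  · intro ξ
    rw [gevreySymbol_zero, norm_decay, wt, ← Real.exp_add, add_neg_cancel, Real.exp_zero]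
  · intro ξ
    rw [schSymbol, hSchr, sub_self, abs_zero]; exact zero_le_one
  · intro t
    rw [solU, phys, flowS_apply]; rfl

theorem IsProfile.slabNorm_wave_le (hp : IsProfile σ δ B x₀ F) (L : L2Triple d →L[ℝ] L2 d)
    (hL : ∀ x, ‖L x‖ ≤ ‖x‖) {q h : Space d → ℝ} (hq : Measurable q) (hh : Measurable h)
    (hqh : ∀ ξ, |q ξ - h ((2 * Real.pi) • ξ)| ≤ 1) (hδ : 0 < δ) (hδ1 : δ ≤ 1)
    (hB : 0 ≤ B) (hκ : 0 ≤ κ) (hκα : 2 * κ ≤ smoothExp d) {b : ℝ} (hb0 : 0 ≤ b)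
    (hb1 : 2 * b ≤ 1 + κ) :
    slabNorm h σ 1 b δ (fun t => phys σ (flowQ q t
        (L (curve (volume.restrict (Set.Icc 0 δ)) x₀ F t)))) ≤
      slabConst d κ * (‖L x₀‖ₑ + ENNReal.ofReal (B * δ ^ (smoothExp d - κ)) * ‖x₀.1‖ₑ) := by
  have hdm := (continuous_decay (d := d) σ).measurable
  have hbm := (continuous_brkInv (d := d)).measurable
  have hdn := norm_decay_le (d := d) hσ.out.le
  refine hp.slabNorm_component_le L hL (m := fun ξ => decay σ ξ * brkInv ξ) (hdm.mul hbm) ?_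
    hq hh ?_ hqh hδ hδ1 hB hκ hκα hb0 hb1 ?_
  · intro ξ
    rw [norm_mul]
    exact mul_le_one₀ (hdn ξ) (norm_nonneg _) (norm_brkInv_le ξ)
  · intro ξ
    rw [gevreySymbol_one, norm_mul, norm_decay, norm_brkInv, mul_mul_mul_comm, wt, ← Real.exp_add,
      add_neg_cancel, Real.exp_zero, mul_inv_cancel₀ (brk_pos ξ).ne', mul_one]
  · intro t
    rw [phys, flowQ_apply, mulL_mulL hdm hdn hbm norm_brkInv_le]

theorem IsProfile.slabNorm_solP_le (hp : IsProfile σ δ B x₀ F) (hδ : 0 < δ) (hδ1 : δ ≤ 1)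
    (hB : 0 ≤ B) (hκ : 0 ≤ κ) (hκα : 2 * κ ≤ smoothExp d) {b : ℝ} (hb0 : 0 ≤ b)
    (hb1 : 2 * b ≤ 1 + κ) :
    slabNorm hPlus σ 1 b δ (solP σ (curve (volume.restrict (Set.Icc 0 δ)) x₀ F)) ≤
      slabConst d κ * (‖x₀.2.1‖ₑ + ENNReal.ofReal (B * δ ^ (smoothExp d - κ)) * ‖x₀.1‖ₑ) := by
  refine hp.slabNorm_wave_le ((ContinuousLinearMap.fst ℝ (L2 d) (L2 d)).comp
    (ContinuousLinearMap.snd ℝ (L2 d) (L2 d × L2 d)))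
    (fun x => (norm_fst_le _).trans (norm_snd_le x)) measurable_brkNeg
    (by unfold hPlus; fun_prop) (fun ξ => ?_) hδ hδ1 hB hκ hκα hb0 hb1
  rw [brkNeg, brk, hPlus, ← abs_neg, neg_sub, neg_sub_neg]
  exact abs_bracket_sub_le (norm_nonneg _)

theorem IsProfile.slabNorm_solM_le (hp : IsProfile σ δ B x₀ F) (hδ : 0 < δ) (hδ1 : δ ≤ 1)
    (hB : 0 ≤ B) (hκ : 0 ≤ κ) (hκα : 2 * κ ≤ smoothExp d) {b : ℝ} (hb0 : 0 ≤ b)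
    (hb1 : 2 * b ≤ 1 + κ) :
    slabNorm hMinus σ 1 b δ (solM σ (curve (volume.restrict (Set.Icc 0 δ)) x₀ F)) ≤
      slabConst d κ * (‖x₀.2.2‖ₑ + ENNReal.ofReal (B * δ ^ (smoothExp d - κ)) * ‖x₀.1‖ₑ) := by
  refine hp.slabNorm_wave_le ((ContinuousLinearMap.snd ℝ (L2 d) (L2 d)).comp
    (ContinuousLinearMap.snd ℝ (L2 d) (L2 d × L2 d)))
    (fun x => (norm_snd_le _).trans (norm_snd_le x)) measurable_brk
    (by unfold hMinus; fun_prop) (fun ξ => ?_) hδ hδ1 hB hκ hκα hb0 hb1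
  rw [brk, hMinus]
  exact abs_bracket_sub_le (norm_nonneg _)

end ProfileBounds

/-! ### Exponents of the lifespan -/

section Lifespan

/-- The exponent 4/(4-d) is the reciprocal of 1 - d/4, and ε makes the inequality strict. -/
theorem one_lt_smoothExp_mul {d : ℕ} (hd : d < 4) {ε : ℝ} (hε : 0 < ε) :
    1 < smoothExp d * (lifespanExponent d + ε) := by
  have hα := smoothExp_pos hd
  have h1 : 4 / (4 - (d : ℝ)) ≤ lifespanExponent d := le_max_left _ _
  have h2 : (0 : ℝ) < 4 - d := by
    have : (d : ℝ) < 4 := by exact_mod_cast hd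
    linarith
  have h3 : smoothExp d * (4 / (4 - (d : ℝ))) = 1 := by
    rw [smoothExp]; field_simp
  nlinarith [mul_le_mul_of_nonneg_left h1 hα.le, mul_pos hα hε]

/-- The lifespan absorbs one power of the size of the data. -/
theorem mul_lifespan_rpow_le {C N p β : ℝ} (hC : 0 < C) (hN : 1 ≤ N) (hβ : 1 ≤ β * p) :
    N * (C * N ^ (-p)) ^ β ≤ C ^ β := by
  have hN0 : 0 < N := one_pos.trans_le hN
  rw [Real.mul_rpow hC.le (by positivity), ← Real.rpow_mul hN0.le, mul_left_comm]
  nth_rw 1 [← Real.rpow_one N]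
  rw [← Real.rpow_add hN0]
  refine mul_le_of_le_one_right (by positivity) (Real.rpow_le_one_of_one_le_of_nonpos hN ?_)
  linarith

end Lifespan

end

end KGS

/-! ### The theorem: choice of the constants -/

theorem theorem5p1 (d : ℕ) (hd : d = 1 ∨ d = 2 ∨ d = 3) (ε : ℝ) (hε : 0 < ε) :
    ∃ b₀ : ℝ, 1 / 2 < b₀ ∧ ∃ C : ℝ, 0 < C ∧ ∃ K : ℝ≥0,
      ∀ σ : ℝ, 0 < σ → ∀ u₀ φp φm : KGS.L2 d,
        KGS.MemGevrey σ 0 u₀ → KGS.MemGevrey σ 1 φp → KGS.MemGevrey σ 1 φm →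
        ∀ δ : ℝ,
          δ = C * (1 + (KGS.gevreyNorm σ 0 u₀).toReal + (KGS.gevreyNorm σ 1 φp).toReal +
            (KGS.gevreyNorm σ 1 φm).toReal) ^ (-(KGS.lifespanExponent d + ε)) →
          ∃ u np nm : ℝ → KGS.L2 d,
            KGS.IsSolution σ δ u₀ φp φm u np nm ∧
            (∀ v mp mm : ℝ → KGS.L2 d, KGS.IsSolution σ δ u₀ φp φm v mp mm →
              ∀ t ∈ Set.Icc 0 δ, v t = u t ∧ mp t = np t ∧ mm t = nm t) ∧
            ∀ b : ℝ, 1 / 2 < b → b ≤ b₀ →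
              KGS.slabNorm KGS.hSchr σ 0 b δ u ≤ K * KGS.gevreyNorm σ 0 u₀ ∧
              KGS.slabNorm KGS.hPlus σ 1 b δ np ≤
                K * (KGS.gevreyNorm σ 1 φp + KGS.gevreyNorm σ 0 u₀) ∧
              KGS.slabNorm KGS.hMinus σ 1 b δ nm ≤
                K * (KGS.gevreyNorm σ 1 φm + KGS.gevreyNorm σ 0 u₀) := by
  have hd4 : d < 4 := by omega
  obtain ⟨A, hA⟩ := KGS.exists_flowBound hd4
  have hA0 := hA.1
  set p := KGS.lifespanExponent d + ε with hp
  set α := KGS.smoothExp d with hα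
  have hα0 : 0 < α := KGS.smoothExp_pos hd4
  have hαp : 1 < α * p := KGS.one_lt_smoothExp_mul hd4 hε
  have hp0 : 0 < p := (mul_pos_iff_of_pos_left hα0).1 (one_pos.trans hαp)
  -- The first bound on κ preserves (α - κ)p ≥ 1, which is possible with κ > 0 because αp > 1. The
  -- second provides the 2κ ≤ α required for the increments.
  set κ := min (α - 1 / p) (α / 2) with hκdef
  have hκ : 0 < κ := by
    refine lt_min (sub_pos.2 ?_) (by positivity)
    rwa [div_lt_iff₀ hp0]
  have hκα : 2 * κ ≤ α := by linarith [min_le_right (α - 1 / p) (α / 2)]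
  have hκp : 1 ≤ (α - κ) * p := by
    have h1 : 1 / p ≤ α - κ := by linarith [min_le_left (α - 1 / p) (α / 2)]
    rwa [div_le_iff₀ hp0] at h1
  -- With C = M^{-1/α} one gets N δ^α ≤ C^α = 1/M, which is the smallness needed for the
  -- contraction; M ≥ 1 ensures δ ≤ 1.
  set M := max 1 (24 * (2 ^ d * A)) with hM
  have hM1 : 1 ≤ M := le_max_left _ _
  have hM0 : 0 < M := one_pos.trans_le hM1
  have hC0 : 0 < M ^ (-(1 / α)) := Real.rpow_pos_of_pos hM0 _
  have hC1 : M ^ (-(1 / α)) ≤ 1 :=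
    Real.rpow_le_one_of_one_le_of_nonpos hM1 (neg_nonpos.2 (by positivity))
  have hCα : (M ^ (-(1 / α))) ^ α = M⁻¹ := by
    rw [← Real.rpow_mul hM0.le, ← Real.rpow_neg_one]
    congr 1
    field_simp
  set G : ℝ≥0∞ := ENNReal.ofReal (12 * (2 ^ d * A)) with hG
  have hK : KGS.slabConst d κ * (1 + G) ≠ ∞ :=
    ENNReal.mul_ne_top (KGS.slabConst_ne_top hκ)
      (ENNReal.add_ne_top.2 ⟨ENNReal.one_ne_top, ENNReal.ofReal_ne_top⟩)
  -- This b₀ is the largest b with 2b ≤ 1 + κ.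
  refine ⟨1 / 2 + κ / 2, by linarith, M ^ (-(1 / α)), hC0, (KGS.slabConst d κ * (1 + G)).toNNReal,
    fun σ hσ u₀ φp φm hu hφp hφm δ hδ => ?_⟩
  have : Fact (0 < σ) := ⟨hσ⟩
  obtain ⟨f, rfl⟩ := KGS.exists_eq_phys σ hu
  obtain ⟨fp, rfl⟩ := KGS.exists_eq_phys_brkInv σ hφp
  obtain ⟨fm, rfl⟩ := KGS.exists_eq_phys_brkInv σ hφm
  simp only [KGS.gevreyNorm_phys_zero, KGS.gevreyNorm_phys_one, toReal_enorm] at hδ ⊢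
  set N := 1 + ‖f‖ + ‖fp‖ + ‖fm‖ with hN
  have hN1 : 1 ≤ N := by
    linarith [norm_nonneg f, norm_nonneg fp, norm_nonneg fm]
  have hN0 : 0 < N := one_pos.trans_le hN1
  have hxN : ‖((f, fp, fm) : KGS.L2Triple d)‖ ≤ N := by
    rw [Prod.norm_def, Prod.norm_def]
    have hf := norm_nonneg f
    have hfp := norm_nonneg fp
    have hfm := norm_nonneg fm
    exact max_le (by linarith) (max_le (by linarith) (by linarith))
  have hδ0 : 0 < δ := hδ ▸ mul_pos hC0 (Real.rpow_pos_of_pos hN0 _)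
  have hδ1 : δ ≤ 1 := by
    rw [hδ]
    exact mul_le_one₀ hC1 (Real.rpow_nonneg hN0.le _)
      (Real.rpow_le_one_of_one_le_of_nonpos hN1 (by linarith))
  have hsmall : 24 * (2 ^ d * A * δ ^ α) * ‖((f, fp, fm) : KGS.L2Triple d)‖ ≤ 1 := by
    have h1 : N * δ ^ α ≤ M⁻¹ := by
      rw [hδ, ← hCα]; exact KGS.mul_lifespan_rpow_le hC0 hN1 hαp.le
    calc _ ≤ 24 * (2 ^ d * A * δ ^ α) * N := by gcongr
      _ = 24 * (2 ^ d * A) * (N * δ ^ α) := by ring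
      _ ≤ M * M⁻¹ := by gcongr; exact le_max_right _ _
      _ = 1 := mul_inv_cancel₀ hM0.ne'
  obtain ⟨F, hF⟩ := KGS.exists_isProfile σ hA hδ0.le hδ1 (f, fp, fm) hsmall
  have hB0 : 0 ≤ 12 * (2 ^ d * A) * ‖((f, fp, fm) : KGS.L2Triple d)‖ := by positivity
  -- The window constant grows linearly with the size N of the data, but N δ^{α-κ} ≤ 1 because (α -
  -- κ)p ≥ 1. Hence K does not depend on the data.
  have hBG : ENNReal.ofReal (12 * (2 ^ d * A) * ‖((f, fp, fm) : KGS.L2Triple d)‖ *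
      δ ^ (α - κ)) ≤ G := by
    refine ENNReal.ofReal_le_ofReal ?_
    have h1 : N * δ ^ (α - κ) ≤ 1 := by
      rw [hδ]
      exact (KGS.mul_lifespan_rpow_le hC0 hN1 hκp).trans
        (Real.rpow_le_one hC0.le hC1 (by linarith))
    calc _ ≤ 12 * (2 ^ d * A) * N * δ ^ (α - κ) := by gcongr
      _ = 12 * (2 ^ d * A) * (N * δ ^ (α - κ)) := by ring
      _ ≤ 12 * (2 ^ d * A) := mul_le_of_le_one_right (by positivity) h1
  refine ⟨_, _, _, hF.isSolution, fun v mp mm h' => hF.isSolution.unique h', fun b hb hb0 => ?_⟩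
  have hb1 : 2 * b ≤ 1 + κ := by linarith
  have hb2 : 0 ≤ b := by linarith
  rw [ENNReal.coe_toNNReal hK]
  have hwave : ∀ x y : ℝ≥0∞, x + G * y ≤ (1 + G) * (x + y) := fun x y => by
    calc x + G * y ≤ (x + G * y) + (y + G * x) := le_self_add
      _ = (1 + G) * (x + y) := by ring
  refine ⟨?_, ?_, ?_⟩
  · refine (hF.slabNorm_solU_le hδ0 hδ1 hB0 hκ.le hκα hb2 hb1).trans ?_
    rw [mul_assoc (KGS.slabConst d κ), add_mul, one_mul]
    exact mul_le_mul_right (add_le_add le_rfl (mul_le_mul_left hBG _)) _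
  · refine (hF.slabNorm_solP_le hδ0 hδ1 hB0 hκ.le hκα hb2 hb1).trans ?_
    rw [mul_assoc (KGS.slabConst d κ)]
    exact mul_le_mul_right ((add_le_add le_rfl (mul_le_mul_left hBG _)).trans (hwave _ _)) _
  · refine (hF.slabNorm_solM_le hδ0 hδ1 hB0 hκ.le hκα hb2 hb1).trans ?_
    rw [mul_assoc (KGS.slabConst d κ)]
    exact mul_le_mul_right ((add_le_add le_rfl (mul_le_mul_left hBG _)).trans (hwave _ _)) _
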